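/- Let $M$ be a smooth manifold, $(A,[\cdot,\cdot]_A,a_A)$ a Lie algebroid over $M$ and $\nabla:\Gamma(A)\times\Gamma(E)\to\Gamma(E)$ a representation of $A$ on a vector bundle $E\to M$, with dual representation $\nabla^*$ on $E^*$. Let $\mathcal A=(E[2],A[1],l_1,l_2,l_3,a)$ be the split Lie 2-algebroid with $l_1=0$, $l_3=0$, $a=a_A$, $l_2(X,Y)=[X,Y]_A$ and $l_2(X,e)=\nabla_Xe$. Let $\{\cdot,\cdot\}$ be the canonical graded Poisson bracket, of degree $-3$, on the functions on $T^*[3](A[1]\oplus E[2])$, and let $\mu=\mu^{(2,1,1)}+\mu^{(1,2,1)}+\mu^{(0,3,1)}$ be the degree 4 function that generates the operations of $\mathcal A$ as derived brackets, decomposed by tridegree (the coordinates $x^i$ on $M$, $\xi^j$ on $A[1]$, $\theta^k$ on $E[2]$ and their momenta $p_i,\xi_j,\theta_k$ have tridegrees $(0,0,0),(0,1,0),(1,1,0),(1,1,1),(1,0,1),(0,0,1)$); here $\mu^{(2,1,1)}=\mu^{(0,3,1)}=0$. Put $[P,Q]_S=-\{\{\mu^{(1,2,1)},P\},Q\}$.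 For $H\in\Gamma(A\odot E)$ let $H^\sharp:E^*\to A$ and $H^\natural:A^*\to E$ be the induced bundle maps, $\langle H^\natural(\beta),e^*\rangle=H(e^*,\beta)=\langle \beta,H^\sharp(e^*)\rangle$; for $K\in\Gamma(\wedge^3E)$ let $K^\flat:\wedge^2E^*\to E$ be given by $\langle K^\flat(e_1^*,e_2^*),e_3^*\rangle=K(e_1^*,e_2^*,e_3^*)$. Suppose that $[H,H]_S=0$. (i) $E^*$ with anchor $\mathfrak a_H=a_A\circ H^\sharp$ and bracket $\mathfrak l_2^H(e_1^*,e_2^*)=\nabla^*_{H^\sharp(e_1^*)}e_2^*-\nabla^*_{H^\sharp(e_2^*)}e_1^*$ is a Lie algebroid. (ii) $[H,K]_S=0$ if and only if $K$ is a 3-cocycle of the Lie algebroid $(E^*,\mathfrak l_2^H,\mathfrak a_H)$ with coefficients in the trivial representation. (iii) If moreover $[H,K]_S=0$, then $\mathcal A^*[3]=(A^*,E^*,\mathfrak l_1^H,\mathfrak l_2^H,\mathfrak l_3^{H,K},\mathfrak a_H)$, with $A^*$ in degree $-2$ and $E^*$ in degree $-1$, is a split Lie 2-algebroid, where $\mathfrak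 l_1^H=0$, $\mathfrak l_2^H(e_1^*,e_2^*)$ and $\mathfrak a_H$ are as in (i), $$\mathfrak l_2^H(e_1^*,\beta)=\mathfrak L_{H^\sharp(e_1^*)}\beta+\langle\nabla_\cdot H^\natural(\beta),e_1^*\rangle-d^A\big(H(e_1^*,\beta)\big),$$ $$\mathfrak l_3^{H,K}(e_1^*,e_2^*,e_3^*)=\langle\nabla_\cdot K^\flat(e_1^*,e_2^*),e_3^*\rangle+\langle\nabla_\cdot K^\flat(e_3^*,e_1^*),e_2^*\rangle+\langle\nabla_\cdot K^\flat(e_2^*,e_3^*),e_1^*\rangle-2\,d^A\big(K(e_1^*,e_2^*,e_3^*)\big)$$ for $e_i^*\in\Gamma(E^*)$, $\beta\in\Gamma(A^*)$, and $\mathfrak L$, $d^A$ are the Lie derivative and the differential of $A$. Furthermore $(H^\sharp,-H^\natural,-K^\flat)$ is a morphism of split Lie 2-algebroids from $\mathcal A^*[3]$ to $\mathcal A$, and $(\mathcal A,\mathcal A^*[3])$ is a split Lie 2-bialgebroid, i.e. the structure functions $\mu$ of $\mathcal A$ and $\gamma$ of $\mathcal A^*[3]$ satisfy $\mu^{(2,1,1)}=\gamma^{(2,1,1)}$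 and $\{\mu+\gamma-\mu^{(2,1,1)},\mu+\gamma-\mu^{(2,1,1)}\}=0$. -/

import Mathlib

open scoped Manifold ContDiff Bundle

noncomputable section

namespace SplitLie2

/-! ### Lie algebroids and split Lie 2-algebroids

A vector bundle over `M` is used through its module of smooth sections over `R = C^∞(M)`.
Vector fields are the `ℝ`-linear derivations of `R`, bundle maps are the `R`-linear maps of
sections, and the sections of the dual bundle are the `R`-linear functionals on sections
(`Module.Dual R`). All brackets below are biadditive; together with the Leibniz rule and the
fact that derivations kill real constants this makes them `ℝ`-bilinear. -/

section Algebroids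

/-- A Lie algebroid with module of sections `L`. -/
structure LieAlgebroid (R : Type*) [CommRing R] [Algebra ℝ R]
    (L : Type*) [AddCommGroup L] [Module R L] where
  /-- the bracket on sections -/
  bracket : L →+ L →+ L
  /-- the anchor -/
  anchor : L →ₗ[R] Derivation ℝ R R
  bracket_self : ∀ x, bracket x x = 0
  jacobi : ∀ x y z,
    bracket x (bracket y z) = bracket (bracket x y) z + bracket y (bracket x z)
  leibniz : ∀ x (f : R) y, bracket x (f • y) = f • bracket x y + anchor x f • y
  anchor_bracket : ∀ x y, anchor (bracket x y) = ⁅anchor x, anchor y⁆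

/-- A split Lie 2-algebroid `(A_{-2}, A_{-1}, l₁, l₂, l₃, a)`, where `A1`, `A2` are the modules of
sections of `A_{-1}`, `A_{-2}`. As `l₂` is graded symmetric, it is given by its
restriction `l2` to `A_{-1} × A_{-1}`, which is skew-symmetric, and its restriction `l2m` to
`A_{-1} × A_{-2}`, with `l₂(m, x) = l₂(x, m)`. -/
structure SplitLie2Algebroid (R : Type*) [CommRing R] [Algebra ℝ R]
    (A1 : Type*) [AddCommGroup A1] [Module R A1] (A2 : Type*) [AddCommGroup A2] [Module R A2] where
  l1 : A2 →ₗ[R] A1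
  l2 : A1 →+ A1 →+ A1
  l2m : A1 →+ A2 →+ A2
  l3 : A1 [⋀^Fin 3]→ₗ[R] A2
  anchor : A1 →ₗ[R] Derivation ℝ R R
  l2_self : ∀ x, l2 x x = 0
  l1_l2m : ∀ x m, l1 (l2m x m) = l2 x (l1 m)
  l2m_l1 : ∀ m n, l2m (l1 m) n = -l2m (l1 n) m
  l1_l3 : ∀ x y z, l1 (l3 ![x, y, z]) = l2 x (l2 y z) - l2 (l2 x y) z - l2 y (l2 x z)
  l3_l1 : ∀ x y m, l3 ![x, y, l1 m] = l2m x (l2m y m) - l2m (l2 x y) m - l2m y (l2m x m)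
  jacobiator : ∀ x y z w,
    l2m x (l3 ![y, z, w]) - l2m y (l3 ![x, z, w]) + l2m z (l3 ![x, y, w]) - l2m w (l3 ![x, y, z])
      - l3 ![l2 x y, z, w] - l3 ![y, l2 x z, w] - l3 ![y, z, l2 x w]
      + l3 ![x, l2 y z, w] + l3 ![x, z, l2 y w] - l3 ![x, y, l2 z w] = 0
  leibniz : ∀ x (f : R) y, l2 x (f • y) = f • l2 x y + anchor x f • y
  leibniz_m : ∀ x (f : R) m, l2m x (f • m) = f • l2m x m + anchor x f • m
  l2m_smul : ∀ (f : R) x m, l2m (f • x) m = f • l2m x m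

variable {R : Type*} [CommRing R] [Algebra ℝ R]

/-- A morphism `(F₁, F₂, F₃)` of split Lie 2-algebroids over the same base. -/
structure IsMorphism {A1 A2 B1 B2 : Type*} [AddCommGroup A1] [Module R A1]
    [AddCommGroup A2] [Module R A2] [AddCommGroup B1] [Module R B1] [AddCommGroup B2] [Module R B2]
    (𝒜 : SplitLie2Algebroid R A1 A2) (ℬ : SplitLie2Algebroid R B1 B2)
    (F1 : A1 →ₗ[R] B1) (F2 : A2 →ₗ[R] B2) (F3 : A1 →ₗ[R] A1 →ₗ[R] B2) : Prop where
  F3_self : ∀ x, F3 x x = 0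
  anchor : ∀ x, ℬ.anchor (F1 x) = 𝒜.anchor x
  comm : ∀ m, F1 (𝒜.l1 m) = ℬ.l1 (F2 m)
  l2 : ∀ x y, F1 (𝒜.l2 x y) - ℬ.l2 (F1 x) (F1 y) = ℬ.l1 (F3 x y)
  l2m : ∀ x m, F2 (𝒜.l2m x m) - ℬ.l2m (F1 x) (F2 m) = F3 x (𝒜.l1 m)
  l3 : ∀ x y z,
    -F2 (𝒜.l3 ![x, y, z]) + ℬ.l2m (F1 x) (F3 y z) - ℬ.l2m (F1 y) (F3 x z)
      + ℬ.l2m (F1 z) (F3 x y) - F3 (𝒜.l2 x y) z + F3 x (𝒜.l2 y z) - F3 y (𝒜.l2 x z)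
      + ℬ.l3 ![F1 x, F1 y, F1 z] = 0

variable {A E : Type*} [AddCommGroup A] [Module R A] [AddCommGroup E] [Module R E]

namespace LieAlgebroid

/-- `d^A f ∈ Γ(A*)`, for a function `f`. -/
def d0 (L : LieAlgebroid R A) (f : R) : Module.Dual R A where
  toFun x := L.anchor x f
  map_add' x y := by simp
  map_smul' g x := by simp

theorem bracket_skew (L : LieAlgebroid R A) (x y : A) : L.bracket x y = -L.bracket y x := by
  have h := L.bracket_self (x + y)
  simp only [map_add, AddMonoidHom.add_apply, L.bracket_self, zero_add, add_zero] at h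
  exact eq_neg_of_add_eq_zero_right h

/-- The Lie derivative `𝔏_x : Γ(A*) → Γ(A*)`. -/
def lieDer (L : LieAlgebroid R A) (x : A) (β : Module.Dual R A) : Module.Dual R A where
  toFun y := L.anchor x (β y) - β (L.bracket x y)
  map_add' y z := by simp; ring
  map_smul' f y := by simp [L.leibniz]; ring

/-- The value on `x, y, z, w` of the differential of a 3-form `η` on a Lie algebroid, with
coefficients in the trivial representation. -/
def d3 (L : LieAlgebroid R A) (η : A → A → A → R) (x y z w : A) : R :=
  L.anchor x (η y z w) - L.anchor y (η x z w) + L.anchor z (η x y w) - L.anchor w (η x y z)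
    - η (L.bracket x y) z w + η (L.bracket x z) y w - η (L.bracket x w) y z
    - η (L.bracket y z) x w + η (L.bracket y w) x z - η (L.bracket z w) x y

end LieAlgebroid

/-- A representation of a Lie algebroid on a vector bundle, i.e. a flat `A`-connection. -/
structure Representation (L : LieAlgebroid R A) (E : Type*) [AddCommGroup E] [Module R E] where
  /-- `conn x e = ∇_x e` -/
  conn : A →+ E →+ E
  conn_smul_left : ∀ (f : R) x e, conn (f • x) e = f • conn x e
  conn_smul_right : ∀ x (f : R) e, conn x (f • e) = f • conn x e + L.anchor x f • e
  flat : ∀ x y e, conn (L.bracket x y) e = conn x (conn y e) - conn y (conn x e)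

namespace Representation

variable {L : LieAlgebroid R A}

/-- The dual connection, `⟨∇*_x φ, e⟩ = a(x)⟨φ, e⟩ - ⟨φ, ∇_x e⟩`. -/
def dualConn (ρ : Representation L E) (x : A) (φ : Module.Dual R E) : Module.Dual R E where
  toFun e := L.anchor x (φ e) - φ (ρ.conn x e)
  map_add' e e' := by simp; ring
  map_smul' f e := by simp [ρ.conn_smul_right]; ring

/-- The section `⟨∇_· e, φ⟩` of `A*`. -/
def pairConn (ρ : Representation L E) (e : E) (φ : Module.Dual R E) : Module.Dual R A where
  toFun x := φ (ρ.conn x e)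
  map_add' x y := by simp
  map_smul' f x := by simp [ρ.conn_smul_left]

/-- The split Lie 2-algebroid `(E[2], A[1])` with `l₁ = 0`, `l₃ = 0`, `a = a_A`,
`l₂(x, y) = [x, y]_A` and `l₂(x, e) = ∇_x e`. -/
def semidirect (ρ : Representation L E) : SplitLie2Algebroid R A E where
  l1 := 0
  l2 := L.bracket
  l2m := ρ.conn
  l3 := 0
  anchor := L.anchor
  l2_self := L.bracket_self
  l1_l2m x m := by simp
  l2m_l1 m n := by simp
  l1_l3 x y z := by simp [L.jacobi x y z]
  l3_l1 x y m := by simp [ρ.flat x y m]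
  jacobiator x y z w := by simp
  leibniz := L.leibniz
  leibniz_m := ρ.conn_smul_right
  l2m_smul := ρ.conn_smul_left

end Representation

end Algebroids

/-! ### The graded Poisson algebra of `T*[3](A_{-1} ⊕ A_{-2})`

Let `(x, ξ^j, θ^k, p_i, ξ_j, θ_k)` be Darboux coordinates, of degrees `(0, 1, 2, 3, 2, 1)`. By the
Legendre transformation `T*[3](A_{-1} ⊕ A_{-2})` is the shifted cotangent bundle of the total space
of `A_{-1}* ⊕ A_{-2}`, on which the even coordinates `x, ξ_j, θ^k` live, the odd coordinates
`p_i, ξ^j, θ_k` being their momenta. So the graded Poisson algebra of functions is that of the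
fibrewise polynomial multivector fields on this total space with the Schouten bracket.
The fibrewise polynomial functions form the algebra `Poly R A1 A2 = Sym_R(A1 ⊕ A2*)`, and
a `k`-vector field is an alternating `k`-derivation of it. -/

section BigBracket

/-- A family of maps of `n` arguments, `n = 0, 1, 2, …`; the inhomogeneous multivector fields are
the families that satisfy `IsMultivector`. -/
abbrev Cochain (S : Type*) : Type _ := (n : ℕ) → (Fin n → S) → S

section General

variable {S : Type*} [CommRing S]

/-- Alternating multiderivations over `ℝ`. -/
structure IsMultivector (R : Type*) [CommRing R] [Algebra ℝ R] [Algebra R S] (P : Cochain S) :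
    Prop where
  alt : ∀ n (v : Fin n → S) i j, v i = v j → i ≠ j → P n v = 0
  add : ∀ n (v : Fin n → S) i s t, P n (Function.update v i (s + t)) =
    P n (Function.update v i s) + P n (Function.update v i t)
  const : ∀ n (v : Fin n → S) i (c : ℝ), P n (Function.update v i (algebraMap R S (algebraMap ℝ R c))) = 0
  leibniz : ∀ n (v : Fin n → S) i s t, P n (Function.update v i (s * t)) =
    s * P n (Function.update v i t) + t * P n (Function.update v i s)

/-- The sign of the shuffle that moves the elements of `s` in front of the others. -/
def shuffleSign {n : ℕ} (s : Finset (Fin n)) : ℤ :=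
  (-1) ^ ((s ×ˢ sᶜ).filter (fun q => q.2 < q.1)).card

/-- `P(Q(v_s), v_{sᶜ})`: insert the arguments in `s` into `Q`, its value and the remaining
arguments into `P`. -/
def insertAt (P Q : Cochain S) {n : ℕ} (s : Finset (Fin n)) (v : Fin n → S) : S :=
  P (sᶜ.card + 1) (Fin.cons (Q s.card (fun i => v (s.orderEmbOfFin rfl i)))
    (fun j => v (sᶜ.orderEmbOfFin rfl j)))

/-- The Schouten bracket: for `P`, `Q` of arities `p`, `q` it is
`P ∘ Q - (-1)^((p-1)(q-1)) Q ∘ P`, where `P ∘ Q` is the signed sum of the insertions of `Q` in `P`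
over all `(q, p-1)`-shuffles; it is extended to inhomogeneous elements biadditively. -/
def poisson (P Q : Cochain S) : Cochain S := fun _ v =>
  ∑ s, shuffleSign s •
    (insertAt P Q s v - (-1 : ℤ) ^ ((s.card + 1) * sᶜ.card) • insertAt Q P s v)

/-- A function, as a 0-vector field. -/
def ofPoly (s : S) : Cochain S
  | 0, _ => s
  | _ + 1, _ => 0

/-- A vector field. -/
def ofField (D : S → S) : Cochain S
  | 1, v => D (v 0)
  | _, _ => 0

/-- A trivector field. -/
def ofTri (T : S → S → S → S) : Cochain S
  | 3, v => T (v 0) (v 1) (v 2)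
  | _, _ => 0

end General

section DerLift

open SymmetricAlgebra

variable {R V : Type*} [CommRing R] [AddCommGroup V] [Module R V]

theorem der_ext {M : Type*} [AddCommGroup M] [Module R M] [Module (SymmetricAlgebra R V) M]
    {D D' : Derivation R (SymmetricAlgebra R V) M} (h : ∀ v, D (ι R V v) = D' (ι R V v)) :
    D = D' := by
  ext a
  induction a using SymmetricAlgebra.induction with
  | algebraMap r => simp
  | ι v => exact h v
  | mul a b ha hb => simp [ha, hb]
  | add a b ha hb => simp [ha, hb]

theorem exists_derivation {M : Type*} [AddCommGroup M] [Module R M]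
    [Module (SymmetricAlgebra R V) M] [IsScalarTower R (SymmetricAlgebra R V) M]
    (D : V →ₗ[R] M) :
    ∃ d : Derivation R (SymmetricAlgebra R V) M, ∀ v, d (ι R V v) = D v := by
  let : Module (SymmetricAlgebra R V)ᵐᵒᵖ M :=
    Module.compHom M ((RingHom.id (SymmetricAlgebra R V)).fromOpposite fun _ _ => mul_comm _ _)
  have : IsCentralScalar (SymmetricAlgebra R V) M := ⟨fun _ _ => rfl⟩
  let φ : SymmetricAlgebra R V →ₐ[R] TrivSqZeroExt (SymmetricAlgebra R V) M :=
    lift ((TrivSqZeroExt.inlAlgHom R (SymmetricAlgebra R V) M).toLinearMap ∘ₗ ι R V +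
      (TrivSqZeroExt.inrHom (SymmetricAlgebra R V) M).restrictScalars R ∘ₗ D)
  have hι : ∀ v, φ (ι R V v) = TrivSqZeroExt.inl (ι R V v) + TrivSqZeroExt.inr (D v) := by
    intro v
    simp [φ]
  have hfst : ∀ a, (φ a).fst = a := by
    intro a
    have : (TrivSqZeroExt.fstHom R (SymmetricAlgebra R V) M).comp φ =
        AlgHom.id R (SymmetricAlgebra R V) := by
      apply algHom_ext
      ext v
      simp [hι]
    exact congr($this a)
  refine ⟨Derivation.mk' ((TrivSqZeroExt.sndHom (SymmetricAlgebra R V) M).restrictScalars R ∘ₗ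
    φ.toLinearMap) ?_, ?_⟩
  · intro a b
    simp [hfst]
  · intro v
    simp [hι]

/-- The derivation of the symmetric algebra that extends an `R`-linear map of `V`. -/
def derLift {M : Type*} [AddCommGroup M] [Module R M]
    [Module (SymmetricAlgebra R V) M] [IsScalarTower R (SymmetricAlgebra R V) M] :
    (V →ₗ[R] M) →ₗ[R] Derivation R (SymmetricAlgebra R V) M where
  toFun D := (exists_derivation D).choose
  map_add' D D' := der_ext fun v => by
    simp [(exists_derivation D).choose_spec, (exists_derivation D').choose_spec,
      (exists_derivation (D + D')).choose_spec]
  map_smul' r D := der_ext fun v => by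
    simp [(exists_derivation D).choose_spec, (exists_derivation (r • D)).choose_spec]

theorem derLift_ι {M : Type*} [AddCommGroup M] [Module R M]
    [Module (SymmetricAlgebra R V) M] [IsScalarTower R (SymmetricAlgebra R V) M]
    (D : V →ₗ[R] M) (v : V) : derLift D (ι R V v) = D v :=
  (exists_derivation D).choose_spec v

end DerLift

variable (R : Type*) [CommRing R] (A1 A2 : Type*) [AddCommGroup A1] [Module R A1]
  [AddCommGroup A2] [Module R A2]

/-- Fibrewise polynomial functions on `A_{-1}* ⊕ A_{-2}`. -/
abbrev Poly : Type _ := SymmetricAlgebra R (A1 × Module.Dual R A2)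

variable {R A1 A2}

/-- The map `e ↦ ⟨·, e⟩` on `A1 ⊕ A2*`. -/
def contrSnd : A2 →ₗ[R] (A1 × Module.Dual R A2) →ₗ[R] Poly R A1 A2 :=
  (LinearMap.llcomp R (A1 × Module.Dual R A2) R (Poly R A1 A2)
    (Algebra.linearMap R (Poly R A1 A2))) ∘ₗ
    (LinearMap.lcomp R R (LinearMap.snd R A1 (Module.Dual R A2))) ∘ₗ Module.Dual.eval R A2

/-- The map `α ↦ ⟨α, ·⟩` on `A1 ⊕ A2*`. -/
def contrFst : Module.Dual R A1 →ₗ[R] (A1 × Module.Dual R A2) →ₗ[R] Poly R A1 A2 :=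
  (LinearMap.llcomp R (A1 × Module.Dual R A2) R (Poly R A1 A2)
    (Algebra.linearMap R (Poly R A1 A2))) ∘ₗ
    (LinearMap.lcomp R R (LinearMap.fst R A1 (Module.Dual R A2)))

variable (A1 A2) in
/-- A function on the base, of degree 0. -/
def secR (f : R) : Cochain (Poly R A1 A2) := ofPoly (algebraMap R _ f)

variable (A2) in
/-- A section of `A_{-1}`, as a function of degree 2. -/
def secA1 (x : A1) : Cochain (Poly R A1 A2) := ofPoly (SymmetricAlgebra.ι R _ (x, 0))

variable (A1) in
/-- A section of `A_{-2}*`, as a function of degree 2. -/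
def secA2Dual (φ : Module.Dual R A2) : Cochain (Poly R A1 A2) :=
  ofPoly (SymmetricAlgebra.ι R _ (0, φ))

variable (A1) in
/-- A section of `A_{-2}`, as a function of degree 1: the constant vector field with
`{e, φ} = ⟨e, φ⟩` for `φ ∈ Γ(A_{-2}*)`. -/
def secA2 (e : A2) : Cochain (Poly R A1 A2) := ofField (derLift (contrSnd e))

variable (A2) in
/-- A section of `A_{-1}*`, as a function of degree 1: the constant vector field with
`{α, x} = ⟨α, x⟩` for `x ∈ Γ(A_{-1})`. -/
def secA1Dual (α : Module.Dual R A1) : Cochain (Poly R A1 A2) := ofField (derLift (contrFst α))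

variable (R A1 A2) in
/-- The Euler vector field `ξ_j ∂/∂ξ_j`. -/
def euler1 : Cochain (Poly R A1 A2) :=
  ofField (derLift (SymmetricAlgebra.ι R _ ∘ₗ LinearMap.inl R A1 (Module.Dual R A2) ∘ₗ
    LinearMap.fst R A1 (Module.Dual R A2)))

variable (R A1 A2) in
/-- The Euler vector field `θ^k ∂/∂θ^k`. -/
def euler2 : Cochain (Poly R A1 A2) :=
  ofField (derLift (SymmetricAlgebra.ι R _ ∘ₗ LinearMap.inr R A1 (Module.Dual R A2) ∘ₗ
    LinearMap.snd R A1 (Module.Dual R A2)))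

variable [Algebra ℝ R]

/-- The functions of tridegree `(i, j, k)`, where `x, ξ^j, θ^k, p_i, ξ_j, θ_k` have the tridegrees
`(0,0,0), (0,1,0), (1,1,0), (1,1,1), (1,0,1), (0,0,1)`. So they are the multivector fields of
arity `#p + #ξ^j + #θ_k = j + k - i` that have weight `#ξ_j - #ξ^j = i - j` for the first and
`#θ^k - #θ_k = i - k` for the second Euler vector field. -/
structure IsTridegree (i j k : ℕ) (P : Cochain (Poly R A1 A2)) : Prop where
  multivector : IsMultivector R P
  arity : ∀ n, n + i ≠ j + k → P n = 0
  weight1 : poisson (euler1 R A1 A2) P = ((i : ℤ) - j) • P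
  weight2 : poisson (euler2 R A1 A2) P = ((i : ℤ) - k) • P

/-- The functions `m0`, `m2`, `m4` generate the operations of the split Lie 2-algebroid `𝒞` as
derived brackets; `j1`, `j2` are the inclusions of the sections of `𝒞_{-1}`, `𝒞_{-2}` into the
functions. -/
structure GeneratesBrackets {C1 C2 : Type*} [AddCommGroup C1] [Module R C1] [AddCommGroup C2]
    [Module R C2] (𝒞 : SplitLie2Algebroid R C1 C2)
    (j1 : C1 → Cochain (Poly R A1 A2)) (j2 : C2 → Cochain (Poly R A1 A2))
    (m0 m2 m4 : Cochain (Poly R A1 A2)) : Prop where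
  l1 : ∀ m, j1 (𝒞.l1 m) = -poisson m0 (j2 m)
  l2 : ∀ x y, j1 (𝒞.l2 x y) = -poisson (poisson m2 (j1 x)) (j1 y)
  l2m : ∀ x m, j2 (𝒞.l2m x m) = -poisson (poisson m2 (j1 x)) (j2 m)
  l3 : ∀ x y z, j2 (𝒞.l3 ![x, y, z]) = -poisson (poisson (poisson m4 (j1 x)) (j1 y)) (j1 z)
  anchor : ∀ x f, secR A1 A2 (𝒞.anchor x f) = -poisson (poisson m2 (j1 x)) (secR A1 A2 f)

/-- `μ = m0 + m2 + m4`, with components of tridegrees `(2,1,1)`, `(1,2,1)`, `(0,3,1)`, is the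
structure function of `𝒜` on `T*[3](A_{-1} ⊕ A_{-2})`. -/
structure IsStructureFunction (𝒜 : SplitLie2Algebroid R A1 A2)
    (m0 m2 m4 : Cochain (Poly R A1 A2)) : Prop where
  tri0 : IsTridegree 2 1 1 m0
  tri2 : IsTridegree 1 2 1 m2
  tri4 : IsTridegree 0 3 1 m4
  brackets : GeneratesBrackets 𝒜 (secA1 A2) (secA2 A1) m0 m2 m4

/-- `γ = m0 + m2 + m4`, with components of tridegrees `(2,1,1)`, `(1,1,2)`, `(0,1,3)`, is the
structure function on `T*[3](A_{-1} ⊕ A_{-2})` of a split Lie 2-algebroid `𝒜*[3]` on the dual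
bundle, whose parts of degree `-1` and `-2` are `A_{-2}*` and `A_{-1}*`. -/
structure IsDualStructureFunction
    (ℬ : SplitLie2Algebroid R (Module.Dual R A2) (Module.Dual R A1))
    (m0 m2 m4 : Cochain (Poly R A1 A2)) : Prop where
  tri0 : IsTridegree 2 1 1 m0
  tri2 : IsTridegree 1 1 2 m2
  tri4 : IsTridegree 0 1 3 m4
  brackets : GeneratesBrackets ℬ (secA2Dual A1) (secA1Dual A2) m0 m2 m4

/-- `(𝒜, 𝒜*[3])` is a split Lie 2-bialgebroid: the structure functions `μ` and `γ` satisfy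
`μ^(2,1,1) = γ^(2,1,1)` (the common function `m0`) and
`{μ + γ - μ^(2,1,1), μ + γ - μ^(2,1,1)} = 0`. -/
def IsSplitLie2Bialgebroid (𝒜 : SplitLie2Algebroid R A1 A2)
    (ℬ : SplitLie2Algebroid R (Module.Dual R A2) (Module.Dual R A1)) : Prop :=
  ∃ m0 m2 m4 g2 g4 : Cochain (Poly R A1 A2),
    IsStructureFunction 𝒜 m0 m2 m4 ∧ IsDualStructureFunction ℬ m0 g2 g4 ∧
    poisson ((m0 + m2 + m4) + (m0 + g2 + g4) - m0) ((m0 + m2 + m4) + (m0 + g2 + g4) - m0) = 0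

/-- The bracket `[P, Q]_S = -{{μ^(1,2,1), P}, Q}`, where `m2 = μ^(1,2,1)`. -/
def schouten (m2 P Q : Cochain (Poly R A1 A2)) : Cochain (Poly R A1 A2) :=
  -poisson (poisson m2 P) Q

end BigBracket

/-! ### Sections of `A_{-1} ⊙ A_{-2}` and of `∧³ A_{-2}` -/

section Tensors

variable {R : Type*} [CommRing R] (A1 A2 : Type*) [AddCommGroup A1] [Module R A1]
  [AddCommGroup A2] [Module R A2]

variable (R) in
/-- A section `H` of `A_{-1} ⊙ A_{-2}`, i.e. a bundle map `H^♯ : A_{-2}* → A_{-1}` together with its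
transpose `H^♮ : A_{-1}* → A_{-2}`. -/
structure SymSection where
  sharp : Module.Dual R A2 →ₗ[R] A1
  nat : Module.Dual R A1 →ₗ[R] A2
  transpose : ∀ (α : Module.Dual R A1) (φ : Module.Dual R A2), φ (nat α) = α (sharp φ)

variable (R) in
/-- A section `K` of `∧³ A_{-2}`, given by `K^♭ : ∧² A_{-2}* → A_{-2}`. -/
structure TriSection where
  flat : Module.Dual R A2 →ₗ[R] Module.Dual R A2 →ₗ[R] A2
  flat_self : ∀ φ, flat φ φ = 0
  pair_self : ∀ φ ψ : Module.Dual R A2, ψ (flat φ ψ) = 0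

variable {A1 A2}

/-- `H(φ, α)` for `φ ∈ Γ(A_{-2}*)` and `α ∈ Γ(A_{-1}*)`. -/
def SymSection.eval (H : SymSection R A1 A2) (φ : Module.Dual R A2) (α : Module.Dual R A1) : R :=
  α (H.sharp φ)

/-- `H` as a function of degree 3: the linear vector field with `{α, H} = H^♮ α` and
`{φ, H} = -H^♯ φ`. -/
def SymSection.fn (H : SymSection R A1 A2) : Cochain (Poly R A1 A2) :=
  ofField (derLift (SymmetricAlgebra.ι R _ ∘ₗ LinearMap.inl R A1 (Module.Dual R A2) ∘ₗ
    H.sharp ∘ₗ LinearMap.snd R A1 (Module.Dual R A2)))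

/-- `K(φ, ψ, χ) = ⟨K^♭(φ, ψ), χ⟩`. -/
def TriSection.eval (K : TriSection R A2) (φ ψ χ : Module.Dual R A2) : R := χ (K.flat φ ψ)

variable (A1) in
/-- The trilinear map `K` on `A1 ⊕ A2*`, trivial on `A1`. -/
def TriSection.trilin (K : TriSection R A2) : (A1 × Module.Dual R A2) →ₗ[R]
    (A1 × Module.Dual R A2) →ₗ[R] (A1 × Module.Dual R A2) →ₗ[R] Poly R A1 A2 :=
  (K.flat.compl₁₂ (LinearMap.snd R A1 (Module.Dual R A2))
    (LinearMap.snd R A1 (Module.Dual R A2))).compr₂ contrSnd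

variable (A1) in
/-- The extension of `K` to `Poly R A1 A2`, as a derivation in each argument. -/
def TriSection.triDer (K : TriSection R A2) : Derivation R (Poly R A1 A2)
    (Derivation R (Poly R A1 A2) (Derivation R (Poly R A1 A2) (Poly R A1 A2))) :=
  derLift (derLift ∘ₗ (LinearMap.llcomp R (A1 × Module.Dual R A2)
    ((A1 × Module.Dual R A2) →ₗ[R] Poly R A1 A2)
    (Derivation R (Poly R A1 A2) (Poly R A1 A2)) derLift) ∘ₗ K.trilin A1)

variable (A1) in
/-- `K` as a function of degree 3: the constant trivector field with
`{{{K, φ}, ψ}, χ} = -K(φ, ψ, χ)`. -/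
def TriSection.fn (K : TriSection R A2) : Cochain (Poly R A1 A2) :=
  -ofTri (fun f g h => K.triDer A1 f g h)

end Tensors

/-! ### Sections of a smooth vector bundle as a module over the smooth functions -/

section Sections

open Bundle

variable {E : Type*} [NormedAddCommGroup E] [NormedSpace ℝ E] {H : Type*} [TopologicalSpace H]
  {I : ModelWithCorners ℝ E H} {M : Type*} [TopologicalSpace M] [ChartedSpace H M]
  {F : Type*} [NormedAddCommGroup F] [NormedSpace ℝ F] {V : M → Type*}
  [TopologicalSpace (TotalSpace F V)] [∀ x, AddCommGroup (V x)] [∀ x, Module ℝ (V x)]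
  [∀ x, TopologicalSpace (V x)] [FiberBundle F V] [VectorBundle ℝ F V]

instance sectionSMul : SMul C^∞⟮I, M; 𝓘(ℝ, ℝ), ℝ⟯ Cₛ^∞⟮I; F, V⟯ :=
  ⟨fun f s => ⟨fun x => f x • s x, f.contMDiff.smul_section s.contMDiff⟩⟩

/-- Pointwise multiplication of smooth sections by smooth functions. -/
instance sectionModule : Module C^∞⟮I, M; 𝓘(ℝ, ℝ), ℝ⟯ Cₛ^∞⟮I; F, V⟯ where
  one_smul s := by ext x; exact one_smul ℝ (s x)
  mul_smul f g s := by ext x; exact mul_smul (f x) (g x) (s x)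
  smul_zero f := by ext x; exact smul_zero (f x)
  smul_add f s t := by ext x; exact smul_add (f x) (s x) (t x)
  add_smul f g s := by ext x; exact add_smul (f x) (g x) (s x)
  zero_smul s := by ext x; exact zero_smul ℝ (s x)

end Sections

end SplitLie2

end

/-! Functions on `T*[3](A[1] ⊕ E[2])` are multivector fields on the total space of `A* ⊕ E`, and the
canonical bracket is the Schouten bracket. In this picture `μ` is the linear Poisson bivector `P` of
the semidirect product Lie algebroid `A ⋉ E*`, so `{P, P} = 0` (`IsLinearPoisson.poisson_self`). `H`
is the linear vector field of the endomorphism `S(x, φ) = (H♯φ, 0)`, `K` is a constant trivector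
field, and the structure function of the dual side is `γ = {P, H} + {P, K}`.

The field `{P, H}` generates the deformed bracket `[Su, v] + [u, Sv] - S[u, v]`, which on `E*` is
the bracket of (i). As `S² = 0`, deforming again gives twice the Nijenhuis torsion of `S`. Hence
`[H, H]_S = 0` forces `H♯` to intertwine the bracket of (i) with that of `A`
(`IsLinearPoisson.isCompatible`), and flatness of `∇` then yields the Jacobi identity on `E*`. On
four sections of `E*`, `{{P, H}, K}` is the Lie algebroid differential `dK`, and a weight count
shows that nothing else can be nonzero; this is (ii) (`IsLinearPoisson.poisson_triFn_eq_zero_iff`).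

For (iii), the operation on `E* × A*` is dual to the action `y ↦ [H♯φ, y] + H♯(∇*_y φ)` of `E*` on
`A`, while `𝔩₃(φ, ψ, χ)` evaluated at `y` is `(∇_y K)(φ, ψ, χ)`. Since `dK` is the alternation of
`∇_{H♯} K`, the Jacobiator at `y` is the covariant derivative of `dK` along `y`, by flatness
(`nabla_act_closed`). The morphism equations are the intertwining property, its transpose, and `dK =
0`; those with values in `Γ(E)` are tested against `Γ(E*)`, which separates sections
(`section_eq_zero`). The bialgebroid equation follows from the graded Jacobi identity, `{P, P} = 0`
and the two hypotheses on `H` and `K`, except for `{{P, K}, {P, K}} = 0`, which holds by weight.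

Two devices carry the computations. The contraction formula `ctr_poisson` turns identities for the
Schouten bracket into inductions on the arity. The Euler weights imposed by the tridegree leave only
values on a few linear functions to compare, because polynomials of negative weight vanish
(`eq_zero_of_weight_neg`); together with the derived brackets they also determine `μ^(1,2,1)`
(`isLinearPoisson_of_isStructureFunction`). -/

noncomputable section

namespace SplitLie2

set_option linter.unusedSectionVars false

/-! ### Schouten calculus: shuffles and contractions. -/

section Calculus

variable {S : Type*} [CommRing S]

/-- The contraction of a cochain with a function. -/
def ctr (g : S) (P : Cochain S) : Cochain S := fun n v => P (n + 1) (Fin.cons g v)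

/-- The parity automorphism. -/
def twist (P : Cochain S) : Cochain S := fun n v => (-1 : ℤ) ^ n • P n v

/-- The value of a cochain on a list of arguments. -/
def evalList (P : Cochain S) (l : List S) : S := P l.length l.get

theorem eval_congr (P : Cochain S) {m n : ℕ} (h : m = n) (v : Fin m → S) (w : Fin n → S)
    (hv : ∀ i, v i = w (Fin.cast h i)) : P m v = P n w := by
  subst h
  congr 1
  funext i
  exact hv i

theorem evalList_cons (P : Cochain S) (g : S) (l : List S) :
    evalList P (g :: l) = evalList (ctr g P) l := by
  refine eval_congr P rfl _ _ fun i => ?_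
  refine Fin.cases ?_ (fun j => ?_) i <;> rfl

theorem ctr_apply (g : S) (P : Cochain S) (n : ℕ) (v : Fin n → S) :
    ctr g P n v = P (n + 1) (Fin.cons g v) := rfl

theorem evalList_twist (P : Cochain S) (l : List S) :
    evalList (twist P) l = (-1 : ℤ) ^ l.length • evalList P l := rfl

theorem ctr_twist (g : S) (P : Cochain S) : ctr g (twist P) = -twist (ctr g P) := by
  funext n v
  simp [ctr, twist, pow_succ]

/-- Lists carry their own length, so rewriting is not blocked by arities such as `sᶜ.card + 1`. -/
theorem insertAt_eq_evalList (P Q : Cochain S) {n : ℕ} (s : Finset (Fin n)) (v : Fin n → S) :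
    insertAt P Q s v = evalList P (evalList Q (s.sort.map v) :: sᶜ.sort.map v) := by
  have h : ∀ (T : Cochain S) (t : Finset (Fin n)),
      T t.card (fun i => v (t.orderEmbOfFin rfl i)) = evalList T (t.sort.map v) := fun T t =>
    eval_congr T (by simp) _ _ fun i => by simp [Finset.orderEmbOfFin_apply]
  rw [evalList_cons, ← h, ← h]
  rfl

theorem sort_map_succ {n : ℕ} (s : Finset (Fin n)) :
    (s.map (Fin.succEmb n)).sort = s.sort.map Fin.succ := by
  have := Finset.map_sort (Fin.succEmb n) s (· ≤ ·) (· ≤ ·) (by simp)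
  simpa using this.symm

theorem sort_insert_zero {n : ℕ} (s : Finset (Fin n)) :
    (insert 0 (s.map (Fin.succEmb n))).sort = 0 :: s.sort.map Fin.succ := by
  rw [Finset.sort_insert _ (by simp) (by simp), sort_map_succ]

theorem compl_map_succ {n : ℕ} (s : Finset (Fin n)) :
    (s.map (Fin.succEmb n))ᶜ = insert 0 (sᶜ.map (Fin.succEmb n)) := by
  ext i
  refine Fin.cases ?_ (fun j => ?_) i <;> simp

theorem compl_insert_zero {n : ℕ} (s : Finset (Fin n)) :
    (insert 0 (s.map (Fin.succEmb n)))ᶜ = sᶜ.map (Fin.succEmb n) := by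
  ext i
  refine Fin.cases ?_ (fun j => ?_) i <;> simp

theorem sum_finset_fin_succ {N : Type*} [AddCommMonoid N] {n : ℕ} (F : Finset (Fin (n + 1)) → N) :
    ∑ s, F s = ∑ s : Finset (Fin n),
      (F (s.map (Fin.succEmb n)) + F (insert 0 (s.map (Fin.succEmb n)))) := by
  have h := Finset.sum_powerset_insert (s := Finset.univ.map (Fin.succEmb n)) (a := 0)
    (by simp) F
  have huniv : insert 0 (Finset.univ.map (Fin.succEmb n)) = Finset.univ := by
    ext i
    refine Fin.cases ?_ (fun j => ?_) i <;> simp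
  have hp : (Finset.univ.map (Fin.succEmb n)).powerset =
      Finset.univ.map (Finset.mapEmbedding (Fin.succEmb n)).toEmbedding := by
    ext t
    simp only [Finset.mem_powerset, Finset.mem_map, Finset.mem_univ, true_and]
    rw [Finset.subset_map_iff]
    simp [eq_comm]
  rw [huniv, Finset.powerset_univ, hp, Finset.sum_map, Finset.sum_map,
    ← Finset.sum_add_distrib] at h
  exact h

theorem shuffleSign_eq {n : ℕ} (s : Finset (Fin n)) :
    shuffleSign s = (-1) ^ (∑ a ∈ s, ∑ b ∈ sᶜ, if b < a then 1 else 0) := by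
  rw [shuffleSign, Finset.card_filter, Finset.sum_product]

/-- The index `0` lies in the complement and below everything, so each element of `s` creates one
further inversion. -/
theorem shuffleSign_map_succ {n : ℕ} (s : Finset (Fin n)) :
    shuffleSign (s.map (Fin.succEmb n)) = (-1) ^ s.card * shuffleSign s := by
  rw [shuffleSign_eq, shuffleSign_eq, compl_map_succ, Finset.sum_map, ← pow_add]
  simp [Finset.sum_insert, Finset.sum_add_distrib]

theorem shuffleSign_insert_zero {n : ℕ} (s : Finset (Fin n)) :
    shuffleSign (insert 0 (s.map (Fin.succEmb n))) = shuffleSign s := by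
  rw [shuffleSign_eq, shuffleSign_eq, compl_insert_zero, Finset.sum_insert (by simp)]
  simp [-Finset.sum_boole, Finset.sum_map]

/-- Each pair in `s × sᶜ` is an inversion for exactly one of the two complementary shuffles, so the
inversion numbers add up to `s.card * sᶜ.card`. -/
theorem shuffleSign_compl {n : ℕ} (s : Finset (Fin n)) :
    shuffleSign sᶜ = (-1) ^ (s.card * sᶜ.card) * shuffleSign s := by
  have h : (∑ a ∈ s, ∑ b ∈ sᶜ, if b < a then 1 else 0) +
      (∑ a ∈ sᶜ, ∑ b ∈ s, if b < a then 1 else 0) = s.card * sᶜ.card := by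
    rw [Finset.sum_comm (s := sᶜ), ← Finset.sum_add_distrib]
    have : ∀ a ∈ s, ((∑ b ∈ sᶜ, if b < a then 1 else 0) + ∑ b ∈ sᶜ, if a < b then 1 else 0) =
        sᶜ.card := by
      intro a ha
      rw [← Finset.sum_add_distrib, Finset.card_eq_sum_ones]
      refine Finset.sum_congr rfl fun b hb => ?_
      have hab : a ≠ b := fun h => (Finset.mem_compl.1 hb) (h ▸ ha)
      rcases lt_or_gt_of_ne hab with h | h <;> simp [h, h.not_gt]
    rw [Finset.sum_congr rfl this]
    simp
  rw [shuffleSign_eq, shuffleSign_eq, compl_compl, ← h, pow_add, mul_right_comm, ← mul_pow]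
  simp

theorem map_cons_succ {n : ℕ} (g : S) (v : Fin n → S) (l : List (Fin n)) :
    (l.map Fin.succ).map (Fin.cons g v : Fin (n + 1) → S) = l.map v := by
  simp [Function.comp_def]

theorem poisson_apply (P Q : Cochain S) (n : ℕ) (v : Fin n → S) :
    poisson P Q n v = ∑ s : Finset (Fin n), shuffleSign s •
      (evalList P (evalList Q (s.sort.map v) :: sᶜ.sort.map v) -
        (-1 : ℤ) ^ ((s.card + 1) * sᶜ.card) •
          evalList Q (evalList P (s.sort.map v) :: sᶜ.sort.map v)) := by
  simp only [poisson, insertAt_eq_evalList]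


/-! ### Multivector fields: closure under the bracket, graded antisymmetry, graded Jacobi identity.
-/

section Multivector

variable {R : Type*} [CommRing R] [Algebra ℝ R] [Algebra R S] {P Q T : Cochain S}

theorem ctr_eq_update (g : S) (P : Cochain S) (n : ℕ) (v : Fin n → S) :
    ctr g P n v = P (n + 1) (Function.update (Fin.cons 0 v) 0 g) := by
  rw [Fin.update_cons_zero]
  rfl

theorem evalList_neg (P : Cochain S) (l : List S) : evalList (-P) l = -evalList P l := rfl

theorem evalList_zsmul (z : ℤ) (P : Cochain S) (l : List S) :
    evalList (z • P) l = z • evalList P l := rfl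

theorem ctr_add_cochain (g : S) (P Q : Cochain S) : ctr g (P + Q) = ctr g P + ctr g Q := rfl

theorem ctr_sub_cochain (g : S) (P Q : Cochain S) : ctr g (P - Q) = ctr g P - ctr g Q := rfl

theorem ctr_neg_cochain (g : S) (P : Cochain S) : ctr g (-P) = -ctr g P := rfl

theorem ctr_zero_cochain (g : S) : ctr g (0 : Cochain S) = 0 := rfl

theorem ctr_zsmul_cochain (g : S) (z : ℤ) (P : Cochain S) : ctr g (z • P) = z • ctr g P := rfl

theorem ctr_smul_cochain (g h : S) (P : Cochain S) : ctr g (h • P) = h • ctr g P := rfl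

namespace IsMultivector

theorem contract (hP : IsMultivector R P) (g : S) : IsMultivector R (ctr g P) where
  alt n v i j h hij := hP.alt _ _ i.succ j.succ (by simpa using h) (by simpa using hij)
  add n v i s t := by simp only [ctr_apply, Fin.cons_update, hP.add]
  const n v i c := by simp only [ctr_apply, Fin.cons_update, hP.const]
  leibniz n v i s t := by simp only [ctr_apply, Fin.cons_update, hP.leibniz]

theorem ctr_add (hP : IsMultivector R P) (g h : S) : ctr (g + h) P = ctr g P + ctr h P := by
  funext n v
  simp only [Pi.add_apply, ctr_eq_update, hP.add]

/-- Contraction as an additive map. -/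
def ctrHom (hP : IsMultivector R P) : S →+ Cochain S :=
  AddMonoidHom.mk' (fun g => ctr g P) hP.ctr_add

theorem ctr_zero (hP : IsMultivector R P) : ctr 0 P = 0 := map_zero hP.ctrHom

theorem ctr_neg (hP : IsMultivector R P) (g : S) : ctr (-g) P = -ctr g P := map_neg hP.ctrHom g

theorem ctr_sub (hP : IsMultivector R P) (g h : S) : ctr (g - h) P = ctr g P - ctr h P :=
  map_sub hP.ctrHom g h

theorem ctr_zsmul (hP : IsMultivector R P) (z : ℤ) (g : S) : ctr (z • g) P = z • ctr g P :=
  map_zsmul hP.ctrHom z g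

theorem ctr_mul (hP : IsMultivector R P) (g h : S) :
    ctr (g * h) P = g • ctr h P + h • ctr g P := by
  funext n v
  simp only [Pi.add_apply, Pi.smul_apply, ctr_eq_update, hP.leibniz, smul_eq_mul]

theorem ctr_const (hP : IsMultivector R P) (c : ℝ) :
    ctr (algebraMap R S (algebraMap ℝ R c)) P = 0 := by
  funext n v
  simp only [ctr_eq_update, hP.const, Pi.zero_apply]

theorem ctr_self (hP : IsMultivector R P) (g : S) : ctr g (ctr g P) = 0 := by
  funext n v
  exact hP.alt _ _ 0 1 (by simp [Fin.cons_one]) (by simp)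

theorem ctr_swap (hP : IsMultivector R P) (g h : S) : ctr g (ctr h P) = -ctr h (ctr g P) := by
  have H := hP.ctr_self (g + h)
  rw [hP.ctr_add, ctr_add_cochain, (hP.contract g).ctr_add, (hP.contract h).ctr_add,
    hP.ctr_self, hP.ctr_self, zero_add, add_zero, add_comm] at H
  exact eq_neg_of_add_eq_zero_left H

end IsMultivector

/-- The contraction of a Schouten bracket. -/
theorem ctr_poisson (hP : IsMultivector R P) (hQ : IsMultivector R Q) (g : S) :
    ctr g (poisson P Q) = poisson P (ctr g Q) - poisson (ctr g P) (twist Q) := by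
  funext n v
  rw [ctr_apply, Pi.sub_apply, Pi.sub_apply, poisson_apply, poisson_apply, poisson_apply,
    sum_finset_fin_succ, ← Finset.sum_sub_distrib]
  refine Finset.sum_congr rfl fun s _ => ?_
  -- A subset of `Fin n` extends to `Fin (n + 1)` without or with `0`. With `0`, the function `g`
  -- enters the inner cochain; without it, `g` is the second argument of the outer one, and
  -- `ctr_swap` moves it to the front at the cost of a sign.
  rw [compl_map_succ, compl_insert_zero, sort_insert_zero, sort_map_succ, sort_insert_zero,
    sort_map_succ]
  simp only [List.map_cons, map_cons_succ, Fin.cons_zero, shuffleSign_map_succ,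
    shuffleSign_insert_zero, Finset.card_map, evalList_cons]
  rw [Finset.card_insert_of_notMem (by simp), Finset.card_insert_of_notMem (by simp)]
  simp only [Finset.card_map, ctr_twist, evalList_twist, (hP.contract g).ctr_zsmul,
    hP.ctr_swap g, hQ.ctr_swap g, evalList_neg, evalList_zsmul, List.length_map,
    Finset.length_sort]
  simp only [zsmul_eq_mul, Int.cast_mul, Int.cast_pow, Int.cast_neg, Int.cast_one]
  generalize s.card = m
  generalize sᶜ.card = k
  rcases m.even_or_odd with ⟨m, rfl⟩ | ⟨m, rfl⟩ <;> rcases k.even_or_odd with ⟨k, rfl⟩ | ⟨k, rfl⟩ <;>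
    (ring_nf; simp [pow_mul']; try ring)

theorem evalList_finRange (P : Cochain S) (n : ℕ) (v : Fin n → S) :
    evalList P ((List.finRange n).map v) = P n v :=
  eval_congr P (by simp) _ _ fun i => by simp; rfl

theorem evalList_add (P Q : Cochain S) (l : List S) :
    evalList (P + Q) l = evalList P l + evalList Q l := rfl

theorem evalList_smul (g : S) (P : Cochain S) (l : List S) :
    evalList (g • P) l = g * evalList P l := rfl

theorem poisson_zero_apply (P Q : Cochain S) (v : Fin 0 → S) :
    poisson P Q 0 v = ctr (Q 0 v) P 0 v - ctr (P 0 v) Q 0 v := by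
  have h : ∀ T : Cochain S, evalList T [] = T 0 v := fun T => eval_congr T rfl _ _ fun i => i.elim0
  have hs : (Finset.univ : Finset (Finset (Fin 0))) = {∅} := rfl
  rw [poisson_apply, hs, Finset.sum_singleton]
  simp [shuffleSign, evalList_cons, h]

theorem evalList_ofPoly_cons (g a : S) (l : List S) : evalList (ofPoly g) (a :: l) = 0 := rfl

theorem evalList_ofPoly_map (g : S) {n : ℕ} (v : Fin n → S) {s : Finset (Fin n)} (hs : s ≠ ∅) :
    evalList (ofPoly g) (s.sort.map v) = 0 := by
  obtain ⟨k, hk⟩ := Nat.exists_eq_succ_of_ne_zero (show s.card ≠ 0 by simpa using hs)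
  obtain ⟨a, l, hl⟩ := List.exists_cons_of_length_eq_add_one
    (show (s.sort.map v).length = k + 1 by simpa using hk)
  rw [hl]
  rfl

theorem evalList_zero (l : List S) : evalList (0 : Cochain S) l = 0 := rfl

theorem evalList_ofPoly_nil (g : S) : evalList (ofPoly g) [] = g := rfl

theorem poisson_ofPoly (hP : IsMultivector R P) (g : S) : poisson P (ofPoly g) = ctr g P := by
  funext n v
  rw [poisson_apply, Finset.sum_eq_single ∅]
  · simp [shuffleSign, evalList_ofPoly_cons, evalList_ofPoly_nil, evalList_cons P, Fin.sort_univ,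
      evalList_finRange]
  · intro s _ hs
    simp [evalList_ofPoly_map g v hs, evalList_cons P, hP.ctr_zero, evalList_ofPoly_cons,
      evalList_zero]
  · simp

theorem ofPoly_poisson (hP : IsMultivector R P) (g : S) :
    poisson (ofPoly g) P = -twist (ctr g P) := by
  funext n v
  rw [poisson_apply, Finset.sum_eq_single ∅]
  · simp [shuffleSign, evalList_ofPoly_cons, evalList_ofPoly_nil, evalList_cons P, Fin.sort_univ,
      evalList_finRange, twist]
  · intro s _ hs
    simp [evalList_ofPoly_map g v hs, evalList_cons P, hP.ctr_zero, evalList_ofPoly_cons,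
      evalList_zero]
  · simp

theorem poisson_add_right (hP : IsMultivector R P) (Q Q' : Cochain S) :
    poisson P (Q + Q') = poisson P Q + poisson P Q' := by
  funext n v
  simp only [Pi.add_apply, poisson_apply, ← Finset.sum_add_distrib]
  refine Finset.sum_congr rfl fun s _ => ?_
  simp only [evalList_cons, evalList_add, hP.ctr_add, ctr_add_cochain, zsmul_eq_mul]
  ring

theorem poisson_add_left (hQ : IsMultivector R Q) (P P' : Cochain S) :
    poisson (P + P') Q = poisson P Q + poisson P' Q := by
  funext n v
  simp only [Pi.add_apply, poisson_apply, ← Finset.sum_add_distrib]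
  refine Finset.sum_congr rfl fun s _ => ?_
  simp only [evalList_cons, evalList_add, hQ.ctr_add, ctr_add_cochain, zsmul_eq_mul]
  ring

namespace IsMultivector

/-- The Schouten bracket with a multivector field on the left, as an additive map. -/
def poissonLeftHom (hP : IsMultivector R P) : Cochain S →+ Cochain S :=
  AddMonoidHom.mk' (poisson P) (poisson_add_right hP)

/-- The Schouten bracket with a multivector field on the right, as an additive map. -/
def poissonRightHom (hP : IsMultivector R P) : Cochain S →+ Cochain S :=
  AddMonoidHom.mk' (fun Q => poisson Q P) (poisson_add_left hP)

theorem poisson_zero (hP : IsMultivector R P) : SplitLie2.poisson P 0 = 0 :=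
  map_zero hP.poissonLeftHom

theorem zero_poisson (hP : IsMultivector R P) : SplitLie2.poisson 0 P = 0 :=
  map_zero hP.poissonRightHom

theorem poisson_neg (hP : IsMultivector R P) (Q : Cochain S) :
    SplitLie2.poisson P (-Q) = -SplitLie2.poisson P Q := map_neg hP.poissonLeftHom Q

theorem neg_poisson (hP : IsMultivector R P) (Q : Cochain S) :
    SplitLie2.poisson (-Q) P = -SplitLie2.poisson Q P := map_neg hP.poissonRightHom Q

theorem poisson_sub (hP : IsMultivector R P) (Q Q' : Cochain S) :
    SplitLie2.poisson P (Q - Q') = SplitLie2.poisson P Q - SplitLie2.poisson P Q' :=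
  map_sub hP.poissonLeftHom Q Q'

theorem sub_poisson (hP : IsMultivector R P) (Q Q' : Cochain S) :
    SplitLie2.poisson (Q - Q') P = SplitLie2.poisson Q P - SplitLie2.poisson Q' P :=
  map_sub hP.poissonRightHom Q Q'

theorem poisson_zsmul (hP : IsMultivector R P) (z : ℤ) (Q : Cochain S) :
    SplitLie2.poisson P (z • Q) = z • SplitLie2.poisson P Q := map_zsmul hP.poissonLeftHom z Q

theorem zsmul_poisson (hP : IsMultivector R P) (z : ℤ) (Q : Cochain S) :
    SplitLie2.poisson (z • Q) P = z • SplitLie2.poisson Q P := map_zsmul hP.poissonRightHom z Q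

theorem sum (hP : IsMultivector R P) (hQ : IsMultivector R Q) : IsMultivector R (P + Q) where
  alt n v i j h hij := by simp [hP.alt n v i j h hij, hQ.alt n v i j h hij]
  add n v i s t := by simp only [Pi.add_apply, hP.add, hQ.add]; ring
  const n v i c := by simp [hP.const, hQ.const]
  leibniz n v i s t := by simp only [Pi.add_apply, hP.leibniz, hQ.leibniz]; ring

theorem zsmul (hP : IsMultivector R P) (z : ℤ) : IsMultivector R (z • P) where
  alt n v i j h hij := by simp [hP.alt n v i j h hij]
  add n v i s t := by simp only [Pi.smul_apply, hP.add, smul_add]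
  const n v i c := by simp [hP.const]
  leibniz n v i s t := by simp only [Pi.smul_apply, hP.leibniz, zsmul_eq_mul]; ring

theorem neg (hP : IsMultivector R P) : IsMultivector R (-P) := by
  simpa using hP.zsmul (-1)

theorem sub (hP : IsMultivector R P) (hQ : IsMultivector R Q) : IsMultivector R (P - Q) := by
  simpa [sub_eq_add_neg] using hP.sum hQ.neg

theorem twist (hP : IsMultivector R P) : IsMultivector R (SplitLie2.twist P) where
  alt n v i j h hij := by simp [SplitLie2.twist, hP.alt n v i j h hij]
  add n v i s t := by simp only [SplitLie2.twist, hP.add, smul_add]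
  const n v i c := by simp [SplitLie2.twist, hP.const]
  leibniz n v i s t := by simp only [SplitLie2.twist, hP.leibniz, zsmul_eq_mul]; ring

end IsMultivector

theorem isMultivector_zero : IsMultivector R (0 : Cochain S) where
  alt := by simp
  add := by simp
  const := by simp
  leibniz := by simp

theorem isMultivector_ofPoly (g : S) : IsMultivector R (ofPoly g) where
  alt n v i j h hij := by
    cases n with
    | zero => exact i.elim0
    | succ n => rfl
  add n v i s t := by
    cases n with
    | zero => exact i.elim0
    | succ n => simp [ofPoly]
  const n v i c := by
    cases n with
    | zero => exact i.elim0
    | succ n => rfl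
  leibniz n v i s t := by
    cases n with
    | zero => exact i.elim0
    | succ n => simp [ofPoly]

/-- The wedge product of cochains. -/
def wedge (P Q : Cochain S) : Cochain S := fun n v =>
  ∑ s : Finset (Fin n), shuffleSign s • (evalList P (s.sort.map v) * evalList Q (sᶜ.sort.map v))

/-- `P` is a derivation in the slot that receives the value of `g • Q`; differentiating `g` there
produces the wedge term. -/
theorem poisson_smul_right (hP : IsMultivector R P) (g : S) (Q : Cochain S) :
    poisson P (g • Q) = g • poisson P Q + wedge Q (ctr g P) := by
  funext n v
  simp only [Pi.add_apply, Pi.smul_apply, poisson_apply, wedge, Finset.smul_sum,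
    ← Finset.sum_add_distrib]
  refine Finset.sum_congr rfl fun s _ => ?_
  simp only [evalList_cons, evalList_smul, hP.ctr_mul, ctr_smul_cochain, evalList_add,
    zsmul_eq_mul, smul_eq_mul]
  ring

/-- Mirror image of `poisson_smul_right`, with the twist that occurs in `ctr_poisson`. The
complementary shuffles put the wedge factors in the same order as there, so that the error terms can
cancel. -/
theorem poisson_smul_left (hQ : IsMultivector R Q) (g : S) (P : Cochain S) :
    poisson (g • P) (twist Q) = g • poisson P (twist Q) + wedge (ctr g Q) P := by
  funext n v
  have h : wedge (ctr g Q) P n v = ∑ s : Finset (Fin n), (-1 : ℤ) ^ (s.card * sᶜ.card) •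
      shuffleSign s • (evalList P (s.sort.map v) * evalList (ctr g Q) (sᶜ.sort.map v)) := by
    rw [wedge, ← (compl_involutive (α := Finset (Fin n))).bijective.sum_comp]
    refine Finset.sum_congr rfl fun s _ => ?_
    rw [shuffleSign_compl, compl_compl, smul_smul, mul_comm (evalList P _)]
  simp only [Pi.add_apply, Pi.smul_apply, h]
  simp only [poisson_apply, Finset.smul_sum, ← Finset.sum_add_distrib]
  refine Finset.sum_congr rfl fun s _ => ?_
  simp only [evalList_cons, evalList_smul, hQ.twist.ctr_mul, ctr_smul_cochain, evalList_add,
    ctr_twist g, evalList_neg, evalList_twist, List.length_map, Finset.length_sort,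
    zsmul_eq_mul, smul_eq_mul, Int.cast_pow, Int.cast_neg, Int.cast_one]
  have h2 : ((-1 : S) ^ sᶜ.card) ^ 2 = 1 := by rw [← pow_mul, mul_comm, pow_mul]; simp
  have h3 : (-1 : S) ^ ((s.card + 1) * sᶜ.card) =
    (-1 : S) ^ (s.card * sᶜ.card) * (-1 : S) ^ sᶜ.card := by rw [← pow_add]; ring_nf
  rw [h3]
  linear_combination ((shuffleSign s : S) * (-1) ^ (s.card * sᶜ.card) *
    evalList P (s.sort.map v) * evalList (ctr g Q) (sᶜ.sort.map v)) * h2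

/-- The conditions of `IsMultivector` in one arity. -/
structure IsMultivectorAt (R : Type*) [CommRing R] [Algebra ℝ R] [Algebra R S] (n : ℕ)
    (F : (Fin n → S) → S) : Prop where
  alt : ∀ (v : Fin n → S) i j, v i = v j → i ≠ j → F v = 0
  add : ∀ (v : Fin n → S) i s t, F (Function.update v i (s + t)) =
    F (Function.update v i s) + F (Function.update v i t)
  const : ∀ (v : Fin n → S) i (c : ℝ),
    F (Function.update v i (algebraMap R S (algebraMap ℝ R c))) = 0
  leibniz : ∀ (v : Fin n → S) i s t, F (Function.update v i (s * t)) =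
    s * F (Function.update v i t) + t * F (Function.update v i s)

theorem isMultivector_iff :
    IsMultivector R P ↔ ∀ n, IsMultivectorAt R n (P n) :=
  ⟨fun h n => ⟨h.alt n, h.add n, h.const n, h.leibniz n⟩,
    fun h => ⟨fun n => (h n).alt, fun n => (h n).add, fun n => (h n).const,
      fun n => (h n).leibniz⟩⟩

/-- The induction step for proving multivector properties by contraction: the first slot is governed
by how `ctr g P` depends on `g`, the other slots by the contractions themselves. -/
theorem isMultivectorAt_succ {n : ℕ} (h : ∀ g, IsMultivectorAt R n (ctr g P n))
    (hadd : ∀ g g', ctr (g + g') P = ctr g P + ctr g' P)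
    (hconst : ∀ c : ℝ, ctr (algebraMap R S (algebraMap ℝ R c)) P = 0)
    (hmul : ∀ g g', ctr (g * g') P = g • ctr g' P + g' • ctr g P)
    (hself : ∀ g, ctr g (ctr g P) = 0) : IsMultivectorAt R (n + 1) (P (n + 1)) := by
  have hcons : ∀ v : Fin (n + 1) → S, ∃ g w, v = Fin.cons g w := fun v =>
    ⟨v 0, Fin.tail v, (Fin.cons_self_tail v).symm⟩
  constructor
  · have key : ∀ (v : Fin (n + 1) → S) (j : Fin n), v 0 = v j.succ → P (n + 1) v = 0 := by
      intro v j hv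
      obtain ⟨g, w, rfl⟩ := hcons v
      cases n with
      | zero => exact j.elim0
      | succ m =>
        obtain ⟨f, u, rfl⟩ : ∃ f u, w = Fin.cons f u :=
          ⟨w 0, Fin.tail w, (Fin.cons_self_tail w).symm⟩
        refine Fin.cases (fun hv => ?_) (fun k hv => ?_) j hv
        · obtain rfl : g = f := by simpa using hv
          exact congr($(hself g) m u)
        -- Polarizing `hself` exchanges the first two arguments up to sign. After the exchange both
        -- copies of `g` lie in slots of `ctr f P`, which is already alternating.
        · have hadd2 : ∀ a, ctr (f + g) (ctr a P) m u =
              ctr f (ctr a P) m u + ctr g (ctr a P) m u := fun a => by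
            have h1 := (h a).add (Fin.cons 0 u) 0 f g
            simp only [Fin.update_cons_zero] at h1
            exact h1
          have H := congr($(hself (f + g)) m u)
          rw [hadd, ctr_add_cochain, Pi.add_apply, Pi.add_apply, hadd2, hadd2, hself, hself] at H
          have h0 := (h f).alt (Fin.cons g u) 0 k.succ (by simpa using hv) (Fin.succ_ne_zero k).symm
          change ctr g (ctr f P) m u = 0 at h0
          rw [h0] at H
          simp only [Pi.zero_apply, zero_add, add_zero] at H
          exact H
    intro v i j hij hne
    induction i using Fin.cases with
    | zero =>
      induction j using Fin.cases with
      | zero => exact absurd rfl hne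
      | succ j => exact key v j hij
    | succ i =>
      induction j using Fin.cases with
      | zero => exact key v i hij.symm
      | succ j =>
        obtain ⟨g, w, rfl⟩ := hcons v
        exact (h g).alt w i j (by simpa using hij) (by simpa using hne)
  · intro v i s t
    obtain ⟨g, w, rfl⟩ := hcons v
    induction i using Fin.cases with
    | zero => simp only [Fin.update_cons_zero]; exact congr($(hadd s t) n w)
    | succ i => simp only [← Fin.cons_update]; exact (h g).add w i s t
  · intro v i c
    obtain ⟨g, w, rfl⟩ := hcons v
    induction i using Fin.cases with
    | zero => simp only [Fin.update_cons_zero]; exact congr($(hconst c) n w)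
    | succ i => simp only [← Fin.cons_update]; exact (h g).const w i c
  · intro v i s t
    obtain ⟨g, w, rfl⟩ := hcons v
    induction i using Fin.cases with
    | zero => simp only [Fin.update_cons_zero]; exact congr($(hmul s t) n w)
    | succ i => simp only [← Fin.cons_update]; exact (h g).leibniz w i s t

theorem IsMultivector.poisson (hP : IsMultivector R P) (hQ : IsMultivector R Q) :
    IsMultivector R (poisson P Q) := by
  rw [isMultivector_iff]
  intro n
  induction n generalizing P Q with
  | zero => exact ⟨fun v i => i.elim0, fun v i => i.elim0, fun v i => i.elim0, fun v i => i.elim0⟩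
  | succ n ih =>
    refine isMultivectorAt_succ (fun g => ?_) (fun g g' => ?_) (fun c => ?_) (fun g g' => ?_)
      fun g => ?_
    · rw [ctr_poisson hP hQ]
      have h1 := ih hP (hQ.contract g)
      have h2 := ih (hP.contract g) hQ.twist
      refine ⟨fun v i j h hij => ?_, fun v i s t => ?_, fun v i c => ?_, fun v i s t => ?_⟩
      · simp only [Pi.sub_apply, h1.alt v i j h hij, h2.alt v i j h hij, sub_zero]
      · simp only [Pi.sub_apply, h1.add, h2.add]; ring
      · simp only [Pi.sub_apply, h1.const, h2.const, sub_zero]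
      · simp only [Pi.sub_apply, h1.leibniz, h2.leibniz]; ring
    · simp only [ctr_poisson hP hQ, hP.ctr_add, hQ.ctr_add, poisson_add_right hP,
        poisson_add_left hQ.twist]
      abel
    · rw [ctr_poisson hP hQ, hP.ctr_const, hQ.ctr_const, hP.poisson_zero, hQ.twist.zero_poisson,
        sub_zero]
    -- The wedge terms from the left and from the right slot of the bracket cancel in pairs.
    · simp only [ctr_poisson hP hQ, hP.ctr_mul, hQ.ctr_mul, poisson_add_right hP,
        poisson_add_left hQ.twist, poisson_smul_right hP, poisson_smul_left hQ, smul_sub]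
      abel
    · rw [ctr_poisson hP hQ, ctr_sub_cochain, ctr_poisson hP (hQ.contract g),
        ctr_poisson (hP.contract g) hQ.twist, hQ.ctr_self, hP.ctr_self, ctr_twist,
        hP.poisson_zero, hQ.twist.twist.zero_poisson, (hP.contract g).poisson_neg]
      simp

/-- A cochain all of whose components have arity of the parity of `a`. -/
def HasParity (a : ℕ) (P : Cochain S) : Prop := ∀ n, Odd (n + a) → P n = 0

theorem HasParity.twist_eq {a : ℕ} (h : HasParity a P) : twist P = (-1 : ℤ) ^ a • P := by
  funext n v
  rcases Nat.even_or_odd (n + a) with hn | hn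
  · have : (-1 : ℤ) ^ n = (-1) ^ a := by
      rcases Nat.even_or_odd a with ha | ha
      · rw [ha.neg_one_pow, ((Nat.even_add.1 hn).2 ha).neg_one_pow]
      · rw [ha.neg_one_pow, Odd.neg_one_pow]
        by_contra hc
        exact (Nat.not_even_iff_odd.2 ha) ((Nat.even_add.1 hn).1 (Nat.not_odd_iff_even.1 hc))
    simp only [twist, Pi.smul_apply, this]
  · simp [twist, h n hn]

theorem HasParity.contract {a : ℕ} (h : HasParity a P) (g : S) : HasParity (a + 1) (ctr g P) := by
  intro n hn
  funext v
  rw [ctr_apply, h (n + 1) (by convert hn using 1; ring)]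
  rfl

theorem poisson_eq_zero_of_arity (hP : IsMultivector R P) (hQ : IsMultivector R Q) {n : ℕ}
    (h : ∀ i j, i + j = n → (P (j + 1) = 0 ∨ Q i = 0) ∧ (Q (j + 1) = 0 ∨ P i = 0)) :
    poisson P Q n = 0 := by
  funext v
  rw [poisson_apply]
  refine Finset.sum_eq_zero fun s _ => ?_
  have hs : s.card + sᶜ.card = n := by simp
  have key : ∀ P Q : Cochain S, IsMultivector R P →
      (P (sᶜ.card + 1) = 0 ∨ Q s.card = 0) →
      evalList P (evalList Q (s.sort.map v) :: sᶜ.sort.map v) = 0 := by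
    intro P Q hP h
    have h0 : ∀ (T : Cochain S) (l : List S) (k : ℕ), T k = 0 → l.length = k →
        evalList T l = 0 := by
      rintro T l _ hT rfl
      exact congr($hT _)
    rcases h with h | h
    · exact h0 _ _ _ h (by simp)
    · have h0 : evalList Q (s.sort.map v) = 0 := h0 _ _ _ h (by simp)
      rw [h0, evalList_cons, hP.ctr_zero]
      rfl
  obtain ⟨h1, h2⟩ := h _ _ hs
  rw [key P Q hP h1, key Q P hQ h2]
  simp

theorem HasParity.poisson {a b : ℕ} (ha : HasParity a P) (hb : HasParity b Q)
    (hP : IsMultivector R P) (hQ : IsMultivector R Q) : HasParity (a + b + 1) (poisson P Q) := by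
  intro n hn
  refine poisson_eq_zero_of_arity hP hQ fun i j hij => ?_
  subst hij
  constructor
  · rcases Nat.even_or_odd (i + b) with h | h
    · exact Or.inl (ha _ (by grind))
    · exact Or.inr (hb _ h)
  · rcases Nat.even_or_odd (i + a) with h | h
    · exact Or.inl (hb _ (by grind))
    · exact Or.inr (ha _ h)

theorem ctr_poisson_of_hasParity {b : ℕ} (hb : HasParity b Q) (hP : IsMultivector R P)
    (hQ : IsMultivector R Q) (g : S) :
    ctr g (poisson P Q) = poisson P (ctr g Q) - (-1 : ℤ) ^ b • poisson (ctr g P) Q := by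
  rw [ctr_poisson hP hQ, hb.twist_eq, (hP.contract g).poisson_zsmul]

theorem eq_of_ctr_eq {P Q : Cochain S} {n : ℕ} (h : ∀ g, ctr g P n = ctr g Q n) :
    P (n + 1) = Q (n + 1) := by
  funext v
  rw [← Fin.cons_self_tail v]
  exact congr($(h (v 0)) (Fin.tail v))

theorem neg_one_pow_succ_mul (a b : ℕ) :
    (-1 : ℤ) ^ ((a + 1 + 1) * (b + 1)) = -(-1) ^ b * (-1) ^ ((a + 1) * (b + 1)) := by
  rw [show (a + 1 + 1) * (b + 1) = b + 1 + (a + 1) * (b + 1) by ring, pow_add, pow_succ]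
  ring

theorem neg_one_pow_mul_succ (a b : ℕ) :
    (-1 : ℤ) ^ ((a + 1) * (b + 1 + 1)) = -(-1) ^ a * (-1) ^ ((a + 1) * (b + 1)) := by
  rw [mul_comm, neg_one_pow_succ_mul, mul_comm (b + 1)]

/-- Graded antisymmetry of the Schouten bracket. -/
theorem poisson_comm {a b : ℕ} (ha : HasParity a P) (hb : HasParity b Q)
    (hP : IsMultivector R P) (hQ : IsMultivector R Q) :
    poisson P Q = -(-1 : ℤ) ^ ((a + 1) * (b + 1)) • poisson Q P := by
  funext n
  induction n generalizing P Q a b with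
  | zero =>
    funext v
    rw [Pi.smul_apply, Pi.smul_apply, poisson_zero_apply, poisson_zero_apply]
    rcases Nat.even_or_odd ((a + 1) * (b + 1)) with h | h
    · simp [h]
    -- Here both parities are even, so neither cochain has a vector field part and both sides vanish
    -- in arity zero.
    · have h1 : ctr (Q 0 v) P 0 = 0 := ((ha.contract _) 0 (by grind))
      have h2 : ctr (P 0 v) Q 0 = 0 := ((hb.contract _) 0 (by grind))
      rw [h1, h2]
      simp
  | succ n ih =>
    refine eq_of_ctr_eq fun g => ?_
    rw [ctr_zsmul_cochain, ctr_poisson_of_hasParity hb hP hQ, ctr_poisson_of_hasParity ha hQ hP]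
    have h1 := ih ha (hb.contract g) hP (hQ.contract g)
    have h2 := ih (ha.contract g) hb (hP.contract g) hQ
    simp only [Pi.sub_apply, Pi.smul_apply] at h1 h2 ⊢
    rw [h1, h2, neg_one_pow_succ_mul, neg_one_pow_mul_succ]
    rcases neg_one_pow_eq_or ℤ a with ha | ha <;> rcases neg_one_pow_eq_or ℤ b with hb | hb <;>
      rw [ha, hb] <;> module

/-- The graded Jacobi identity of the Schouten bracket. -/
theorem poisson_jacobi {a b c : ℕ} (ha : HasParity a P) (hb : HasParity b Q) (hc : HasParity c T)
    (hP : IsMultivector R P) (hQ : IsMultivector R Q) (hT : IsMultivector R T) :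
    poisson P (poisson Q T) =
      poisson (poisson P Q) T + (-1 : ℤ) ^ ((a + 1) * (b + 1)) • poisson Q (poisson P T) := by
  funext n
  induction n generalizing P Q T a b c with
  | zero =>
    funext v
    rw [Pi.add_apply, Pi.add_apply, Pi.smul_apply, Pi.smul_apply]
    simp only [poisson_zero_apply, ctr_poisson_of_hasParity hc hQ hT,
      ctr_poisson_of_hasParity hc hP hT, ctr_poisson_of_hasParity hb hP hQ,
      Pi.sub_apply, Pi.smul_apply, hP.ctr_sub, hQ.ctr_sub, hT.ctr_sub]
    -- In arity zero only components of arity at most two matter: an odd cochain has just its vector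
    -- field part, an even one just its function and bivector parts.
    have key : ∀ (U : Cochain S) (d : ℕ), HasParity d U → IsMultivector R U →
        (Odd d ∧ U 0 v = 0 ∧ ∀ x y, ctr x (ctr y U) 0 v = 0) ∨
        (Even d ∧ ∀ x, ctr x U 0 v = 0) := by
      intro U d hd hU
      rcases Nat.even_or_odd d with h | h
      · exact Or.inr ⟨h, fun x => congr($(hd.contract x 0 (by grind)) v)⟩
      · refine Or.inl ⟨h, congr($(hd 0 (by grind)) v), fun x y =>
          congr($((hd.contract y).contract x 0 (by grind)) v)⟩
    rcases key P a ha hP with ⟨h1, h2, h3⟩ | ⟨h1, h2⟩ <;>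
    rcases key Q b hb hQ with ⟨k1, k2, k3⟩ | ⟨k1, k2⟩ <;>
    rcases key T c hc hT with ⟨l1, l2, l3⟩ | ⟨l1, l2⟩ <;>
    simp [*, hP.ctr_zero, hQ.ctr_zero, hT.ctr_zero, ctr_zero_cochain, (hP.contract _).ctr_zero,
      (hQ.contract _).ctr_zero, (hT.contract _).ctr_zero, parity_simps, pow_add, pow_mul]
    · ring
    · ring
    -- All three cochains are even, and the identity compares their bivector parts on the function
    -- parts of the other two.
    · rw [hP.ctr_swap (T 0 v), hQ.ctr_swap (T 0 v), hT.ctr_swap (Q 0 v)]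
      simp only [Pi.neg_apply]
      ring
  | succ n ih =>
    refine eq_of_ctr_eq fun g => ?_
    rw [ctr_add_cochain, ctr_zsmul_cochain, ctr_poisson_of_hasParity (hb.poisson hc hQ hT) hP
      (hQ.poisson hT), ctr_poisson_of_hasParity hc (hP.poisson hQ) hT,
      ctr_poisson_of_hasParity (ha.poisson hc hP hT) hQ (hP.poisson hT),
      ctr_poisson_of_hasParity hc hQ hT, ctr_poisson_of_hasParity hc hP hT,
      ctr_poisson_of_hasParity hb hP hQ]
    have h1 := ih (ha.contract g) hb hc (hP.contract g) hQ hT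
    have h2 := ih ha (hb.contract g) hc hP (hQ.contract g) hT
    have h3 := ih ha hb (hc.contract g) hP hQ (hT.contract g)
    simp only [hP.poisson_sub, hP.poisson_zsmul, hQ.poisson_sub, hQ.poisson_zsmul,
      hT.sub_poisson, hT.zsmul_poisson]
    simp only [Pi.sub_apply, Pi.smul_apply, Pi.add_apply] at h1 h2 h3 ⊢
    rw [h1, h2, h3, neg_one_pow_succ_mul, neg_one_pow_mul_succ]
    simp only [pow_add, pow_one]
    rcases neg_one_pow_eq_or ℤ a with ha | ha <;> rcases neg_one_pow_eq_or ℤ b with hb | hb <;>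
      rcases neg_one_pow_eq_or ℤ c with hc | hc <;> rw [ha, hb, hc] <;> module

end Multivector

end Calculus

/-! ### Functions, vector fields and bivector fields as cochains. -/

section LowArity

variable {S : Type*} [CommRing S] {R : Type*} [CommRing R] [Algebra ℝ R] [Algebra R S]
  {P Q : Cochain S}

theorem isMultivector_of_ctr (h : ∀ g, IsMultivector R (ctr g P))
    (hadd : ∀ g g', ctr (g + g') P = ctr g P + ctr g' P)
    (hconst : ∀ c : ℝ, ctr (algebraMap R S (algebraMap ℝ R c)) P = 0)
    (hmul : ∀ g g', ctr (g * g') P = g • ctr g' P + g' • ctr g P)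
    (hself : ∀ g, ctr g (ctr g P) = 0) : IsMultivector R P := by
  rw [isMultivector_iff]
  rintro (_ | n)
  · exact ⟨fun v i => i.elim0, fun v i => i.elim0, fun v i => i.elim0, fun v i => i.elim0⟩
  · exact isMultivectorAt_succ (fun g => isMultivector_iff.1 (h g) n) hadd hconst hmul hself

/-- A bivector field. -/
def ofBi (F : S → S → S) : Cochain S
  | 2, v => F (v 0) (v 1)
  | _, _ => 0

theorem ctr_ofPoly (g s : S) : ctr g (ofPoly s) = 0 := rfl

theorem ctr_ofField (g : S) (D : S → S) : ctr g (ofField D) = ofPoly (D g) := by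
  funext n v
  rcases n with _ | n <;> rfl

theorem ctr_ofBi (g : S) (F : S → S → S) : ctr g (ofBi F) = ofField (F g) := by
  funext n v
  rcases n with _ | _ | n <;> rfl

theorem ctr_ofTri (g : S) (T : S → S → S → S) : ctr g (ofTri T) = ofBi (T g) := by
  funext n v
  rcases n with _ | _ | _ | n <;> rfl

theorem ofPoly_add (s t : S) : ofPoly (s + t) = ofPoly s + ofPoly t := by
  funext n v
  rcases n with _ | n <;> simp [ofPoly]

theorem ofPoly_zero : ofPoly (0 : S) = 0 := by
  funext n v
  rcases n with _ | n <;> simp [ofPoly]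

theorem ofPoly_mul (s t : S) : ofPoly (s * t) = s • ofPoly t := by
  funext n v
  rcases n with _ | n <;> simp [ofPoly]

theorem ofPoly_neg (s : S) : ofPoly (-s) = -ofPoly s := by
  funext n v
  rcases n with _ | n <;> simp [ofPoly]

theorem ofPoly_injective : Function.Injective (ofPoly (S := S)) := fun _ _ h =>
  congr($h 0 ![])

theorem isMultivector_ofField {D : S → S} (hadd : ∀ s t, D (s + t) = D s + D t)
    (hmul : ∀ s t, D (s * t) = s * D t + t * D s)
    (hconst : ∀ c : ℝ, D (algebraMap R S (algebraMap ℝ R c)) = 0) :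
    IsMultivector R (ofField D) := by
  refine isMultivector_of_ctr (fun g => ?_) (fun g h => ?_) (fun c => ?_) (fun g h => ?_)
    fun g => ?_
  · rw [ctr_ofField]
    exact isMultivector_ofPoly _
  · simp only [ctr_ofField, hadd, ofPoly_add]
  · rw [ctr_ofField, hconst, ofPoly_zero]
  · simp only [ctr_ofField, hmul, ofPoly_add, ofPoly_mul]
  · rw [ctr_ofField, ctr_ofPoly]

theorem isMultivector_derivation (D : Derivation R S S) : IsMultivector R (ofField D) :=
  isMultivector_ofField (map_add D) (fun s t => by simp) fun c => by simp

theorem hasParity_ofPoly (s : S) : HasParity 0 (ofPoly s) := by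
  intro n hn
  rcases n with _ | n
  · simp at hn
  · rfl

theorem hasParity_ofField (D : S → S) : HasParity 1 (ofField D) := by
  intro n hn
  rcases n with _ | _ | n
  · rfl
  · exact absurd hn (by decide)
  · rfl

theorem twist_twist (P : Cochain S) : twist (twist P) = P := by
  funext n v
  rw [twist, twist, smul_smul, ← mul_pow]
  simp

theorem twist_neg (P : Cochain S) : twist (-P) = -twist P := by
  funext n v
  simp [twist]

theorem ofPoly_poisson_twist (hP : IsMultivector R P) (g : S) :
    poisson (ofPoly g) (twist P) = ctr g P := by
  rw [ofPoly_poisson hP.twist, ctr_twist, twist_neg, twist_twist, neg_neg]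

/-- The Lie derivative along a vector field, contracted with a function. -/
theorem ctr_ofField_poisson {D : S → S} (hD : IsMultivector R (ofField D))
    (hP : IsMultivector R P) (g : S) :
    ctr g (poisson (ofField D) P) = poisson (ofField D) (ctr g P) - ctr (D g) P := by
  rw [ctr_poisson hD hP, ctr_ofField, ofPoly_poisson_twist hP]

theorem ofField_poisson_ofPoly {D : S → S} (hD : IsMultivector R (ofField D)) (g : S) :
    poisson (ofField D) (ofPoly g) = ofPoly (D g) := by
  rw [poisson_ofPoly hD, ctr_ofField]

/-- Nonzero integers are invertible because `R` is a real algebra; this is what permits division by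
2 and by differences of weights. -/
theorem zsmul_eq_zero_of_ne_zero (R : Type*) [CommRing R] [Algebra ℝ R] [Algebra R S] {z : ℤ}
    (hz : z ≠ 0) {s : S} (h : z • s = 0) : s = 0 := by
  have h1 : algebraMap R S (algebraMap ℝ R ((z : ℝ)⁻¹)) * (z • s) = s := by
    rw [zsmul_eq_mul, ← mul_assoc]
    have : (z : S) = algebraMap R S (algebraMap ℝ R (z : ℝ)) := by simp
    rw [this, ← map_mul, ← map_mul, inv_mul_cancel₀ (by exact_mod_cast hz)]
    simp
  rw [← h1, h, mul_zero]

theorem cochain_eq_zero_of_zsmul (R : Type*) [CommRing R] [Algebra ℝ R] [Algebra R S] {z : ℤ}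
    (hz : z ≠ 0) (h : z • P = 0) : P = 0 := by
  funext n v
  exact zsmul_eq_zero_of_ne_zero R hz congr($h n v)

end LowArity

/-! ### Euler weights on symmetric algebras and vanishing in negative weight. -/

section Weights

open SymmetricAlgebra

variable {R V : Type*} [CommRing R] [Algebra ℝ R] [AddCommGroup V] [Module R V]

/-- The Euler vector field of the image of a projection. -/
def euler (p : V →ₗ[R] V) : Derivation R (SymmetricAlgebra R V) (SymmetricAlgebra R V) :=
  derLift (ι R V ∘ₗ p)

theorem euler_ι (p : V →ₗ[R] V) (v : V) : euler p (ι R V v) = ι R V (p v) := derLift_ι _ v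

/-- The scaling of the image of a projection. -/
def scaling (p : V →ₗ[R] V) : SymmetricAlgebra R V →ₐ[R] Polynomial (SymmetricAlgebra R V) :=
  lift ((Polynomial.CAlgHom (R := R)).toLinearMap ∘ₗ ι R V ∘ₗ (LinearMap.id - p) +
    LinearMap.mulLeft R Polynomial.X ∘ₗ (Polynomial.CAlgHom (R := R)).toLinearMap ∘ₗ ι R V ∘ₗ p)

theorem scaling_ι (p : V →ₗ[R] V) (v : V) :
    scaling p (ι R V v) = Polynomial.C (ι R V (v - p v)) + Polynomial.X * Polynomial.C (ι R V (p v)) := by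
  rw [scaling, lift_ι_apply]
  simp

/-- The scaling multiplies the image of `p` by the variable `X`, and its infinitesimal generator is
`X d/dX`. Thus the coefficient of `X ^ n` is the part of weight `n`. -/
theorem scaling_euler {p : V →ₗ[R] V} (hp : p ∘ₗ p = p) (s : SymmetricAlgebra R V) :
    scaling p (euler p s) = Polynomial.X * Polynomial.derivative (scaling p s) := by
  have hpp : ∀ v, p (p v) = p v := fun v => congr($hp v)
  induction s using SymmetricAlgebra.induction with
  | algebraMap r =>
    have : algebraMap R (Polynomial (SymmetricAlgebra R V)) r =
      Polynomial.C (algebraMap R (SymmetricAlgebra R V) r) := rfl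
    simp [this]
  | ι v => simp [euler_ι, scaling_ι, hpp]
  | mul a b ha hb =>
    simp only [Derivation.leibniz, smul_eq_mul, map_add, map_mul, ha, hb,
      Polynomial.derivative_mul]
    ring
  | add a b ha hb => simp only [map_add, ha, hb, mul_add]

theorem eval_one_scaling (p : V →ₗ[R] V) (s : SymmetricAlgebra R V) :
    (scaling p s).eval 1 = s := by
  induction s using SymmetricAlgebra.induction with
  | algebraMap r =>
    have : algebraMap R (Polynomial (SymmetricAlgebra R V)) r =
      Polynomial.C (algebraMap R (SymmetricAlgebra R V) r) := rfl
    simp [this]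
  | ι v => simp [scaling_ι]
  | mul a b ha hb => simp [ha, hb]
  | add a b ha hb => simp [ha, hb]

theorem coeff_scaling_eq_zero {p : V →ₗ[R] V} (hp : p ∘ₗ p = p) {s : SymmetricAlgebra R V} {w : ℤ}
    (h : euler p s = w • s) {n : ℕ} (hn : (n : ℤ) ≠ w) : (scaling p s).coeff n = 0 := by
  have h1 := congr(($(scaling_euler hp s)).coeff n)
  rw [h, map_zsmul, Polynomial.coeff_smul] at h1
  have h2 : (Polynomial.X * Polynomial.derivative (scaling p s)).coeff n =
      (n : ℤ) • (scaling p s).coeff n := by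
    rcases n with _ | n
    · simp
    · rw [Polynomial.coeff_X_mul, Polynomial.coeff_derivative]
      simp [mul_comm]
  rw [h2] at h1
  exact zsmul_eq_zero_of_ne_zero R (sub_ne_zero.2 hn) (by rw [sub_smul, h1, sub_self])

theorem eq_zero_of_euler_neg {p : V →ₗ[R] V} (hp : p ∘ₗ p = p) {s : SymmetricAlgebra R V} {w : ℤ}
    (hw : w < 0) (h : euler p s = w • s) : s = 0 := by
  rw [← eval_one_scaling p s]
  have : scaling p s = 0 := by
    ext n
    exact coeff_scaling_eq_zero hp h (by omega)
  rw [this, Polynomial.eval_zero]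

theorem coeff_scaling_id (s : SymmetricAlgebra R V) :
    (∃ r : R, (scaling (LinearMap.id : V →ₗ[R] V) s).coeff 0 = algebraMap R _ r) ∧
      ∃ v : V, (scaling (LinearMap.id : V →ₗ[R] V) s).coeff 1 = ι R V v := by
  induction s using SymmetricAlgebra.induction with
  | algebraMap r =>
    have : algebraMap R (Polynomial (SymmetricAlgebra R V)) r =
      Polynomial.C (algebraMap R (SymmetricAlgebra R V) r) := rfl
    refine ⟨⟨r, by simp [this]⟩, ⟨0, ?_⟩⟩
    rw [AlgHom.commutes, this, Polynomial.coeff_C]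
    simp
  | ι v => exact ⟨⟨0, by simp [scaling_ι]⟩, ⟨v, by simp [scaling_ι]⟩⟩
  | mul a b ha hb =>
    obtain ⟨⟨r, hr⟩, v, hv⟩ := ha
    obtain ⟨⟨r', hr'⟩, v', hv'⟩ := hb
    refine ⟨⟨r * r', by simp [Polynomial.mul_coeff_zero, hr, hr']⟩, ⟨r • v' + r' • v, ?_⟩⟩
    rw [map_mul, Polynomial.mul_coeff_one, hr, hr', hv, hv', map_add, map_smul, map_smul,
      Algebra.smul_def, Algebra.smul_def]
    ring
  | add a b ha hb =>
    obtain ⟨⟨r, hr⟩, v, hv⟩ := ha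
    obtain ⟨⟨r', hr'⟩, v', hv'⟩ := hb
    exact ⟨⟨r + r', by simp [hr, hr']⟩, ⟨v + v', by simp [hv, hv']⟩⟩

/-- Only the coefficient of `X` survives in the scaling, that coefficient is linear, and setting `X
= 1` recovers the polynomial. -/
theorem exists_ι_of_euler_eq {s : SymmetricAlgebra R V}
    (h : euler (LinearMap.id : V →ₗ[R] V) s = s) : ∃ v, s = ι R V v := by
  obtain ⟨v, hv⟩ := (coeff_scaling_id s).2
  refine ⟨v, ?_⟩
  have h1 : scaling (LinearMap.id : V →ₗ[R] V) s = Polynomial.X * Polynomial.C (ι R V v) := by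
    ext n
    rw [mul_comm, Polynomial.coeff_C_mul_X]
    split_ifs with hn
    · rw [hn, hv]
    · exact coeff_scaling_eq_zero (w := 1) (LinearMap.comp_id _) (by rw [h, one_smul])
        (by exact_mod_cast hn)
  rw [← eval_one_scaling LinearMap.id s, h1]
  simp

/-- Let the symmetric algebra act on `V` through the augmentation. The identity of `V` then extends
to a derivation, which is a left inverse of `ι`. -/
theorem ι_injective : Function.Injective (ι R V) := by
  let : Module (SymmetricAlgebra R V) V :=
    Module.compHom V (algebraMapInv : SymmetricAlgebra R V →ₐ[R] R).toRingHom
  have : IsScalarTower R (SymmetricAlgebra R V) V := ⟨fun r s v => by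
    change algebraMapInv (r • s) • v = r • (algebraMapInv s • v)
    rw [map_smul, smul_eq_mul, mul_smul]⟩
  intro v w h
  rw [← LinearMap.id_apply (R := R) v, ← LinearMap.id_apply (R := R) w, ← derLift_ι, h, derLift_ι]

variable {P Q : Cochain (SymmetricAlgebra R V)}

/-- The cochains of a given weight for an Euler vector field. -/
def HasWeight (p : V →ₗ[R] V) (w : ℤ) (P : Cochain (SymmetricAlgebra R V)) : Prop :=
  poisson (ofField (euler p)) P = w • P

theorem isMultivector_euler (p : V →ₗ[R] V) : IsMultivector R (ofField (euler p)) :=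
  isMultivector_derivation _

theorem HasWeight.contract {p : V →ₗ[R] V} {w : ℤ} (h : HasWeight p w P) (hP : IsMultivector R P)
    {g : SymmetricAlgebra R V} {a : ℤ} (hg : euler p g = a • g) : HasWeight p (w + a) (ctr g P) := by
  have h1 := ctr_ofField_poisson (isMultivector_euler p) hP g
  rw [show poisson _ P = _ from h, hg, hP.ctr_zsmul, ctr_zsmul_cochain] at h1
  rw [HasWeight, add_smul, h1, sub_add_cancel]

theorem HasWeight.apply_zero {p : V →ₗ[R] V} {w : ℤ} (h : HasWeight p w P)
    (hP : IsMultivector R P) (v : Fin 0 → SymmetricAlgebra R V) :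
    euler p (P 0 v) = w • P 0 v := by
  have h1 := congr($(show poisson _ P = _ from h) 0 v)
  rw [poisson_zero_apply, ctr_ofField] at h1
  change euler p (P 0 v) - ctr 0 P 0 v = _ at h1
  rw [hP.ctr_zero] at h1
  simpa using h1

theorem HasWeight.poisson {p : V →ₗ[R] V} {w w' : ℤ} {a b : ℕ} (h : HasWeight p w P)
    (h' : HasWeight p w' Q) (ha : HasParity a P) (hb : HasParity b Q) (hP : IsMultivector R P)
    (hQ : IsMultivector R Q) : HasWeight p (w + w') (poisson P Q) := by
  rw [HasWeight, poisson_jacobi (hasParity_ofField _) ha hb (isMultivector_euler p) hP hQ,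
    show SplitLie2.poisson _ P = _ from h, show SplitLie2.poisson _ Q = _ from h',
    hP.poisson_zsmul, hQ.zsmul_poisson, pow_mul, add_smul]
  simp

theorem apply_succ_eq_zero (hP : IsMultivector R P) {n : ℕ}
    (hr : ∀ r : R, ctr (algebraMap R (SymmetricAlgebra R V) r) P n = 0)
    (hv : ∀ v, ctr (ι R V v) P n = 0) : P (n + 1) = 0 := by
  have h : ∀ g, ctr g P n = 0 := by
    intro g
    induction g using SymmetricAlgebra.induction with
    | algebraMap r => exact hr r
    | ι v => exact hv v
    | mul a b ha hb => rw [hP.ctr_mul, Pi.add_apply, Pi.smul_apply, Pi.smul_apply, ha, hb]; simp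
    | add a b ha hb => rw [hP.ctr_add, Pi.add_apply, ha, hb, add_zero]
  exact eq_of_ctr_eq (Q := 0) h

/-- The functions `algebraMap r` and `ι (v - p v)` have weight zero, so contracting with them keeps
the weight negative, and contractions with the image of `p` vanish by hypothesis. The induction ends
with a polynomial of negative weight. -/
theorem eq_zero_of_weight_neg {p : V →ₗ[R] V} (hp : p ∘ₗ p = p) {w : ℤ} (hw : w < 0)
    (h : HasWeight p w P) (hP : IsMultivector R P) (h0 : ∀ v, ctr (ι R V (p v)) P = 0) :
    P = 0 := by
  have hpp : ∀ v, p (p v) = p v := fun v => congr($hp v)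
  funext n
  induction n generalizing P with
  | zero =>
    funext v
    exact eq_zero_of_euler_neg hp hw (h.apply_zero hP v)
  | succ n ih =>
    have key : ∀ g, euler p g = 0 → ctr g P n = 0 := fun g hg =>
      ih (by simpa using h.contract (a := 0) hP (by simpa using hg)) (hP.contract g) fun v => by
        rw [hP.ctr_swap, h0, ctr_zero_cochain, neg_zero]
    refine apply_succ_eq_zero hP (fun r => key _ (by simp)) fun v => ?_
    rw [show v = p v + (v - p v) by abel, map_add, hP.ctr_add, h0, zero_add]
    exact key _ (by simp [euler_ι, hpp])

/-- Each contraction with a generator raises the total weight by at most one, so after `n` of them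
the weight is still negative. -/
theorem apply_eq_zero_of_weight {w : ℤ} {n : ℕ} (hw : w + n < 0)
    (h : HasWeight (LinearMap.id : V →ₗ[R] V) w P) (hP : IsMultivector R P) : P n = 0 := by
  induction n generalizing P w with
  | zero =>
    funext v
    exact eq_zero_of_euler_neg (LinearMap.comp_id _) (by simpa using hw) (h.apply_zero hP v)
  | succ n ih =>
    push_cast at hw
    refine apply_succ_eq_zero hP (fun r => ih (w := w + 0) (by omega)
      (h.contract hP (by simp)) (hP.contract _)) fun v => ih (w := w + 1) (by omega)
      (h.contract hP (by simp [euler_ι])) (hP.contract _)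

end Weights

/-! ### Derivations of the symmetric algebra that are not linear over the base ring. -/

section TwistedLift

open SymmetricAlgebra

variable {R V : Type*} [CommRing R] [AddCommGroup V] [Module R V]

theorem exists_ringHom {T : Type*} [CommRing T] (j : R →+* T) (D : V →+ T)
    (h : ∀ (r : R) v, D (r • v) = j r * D v) :
    ∃ Φ : SymmetricAlgebra R V →+* T,
      (∀ r, Φ (algebraMap R _ r) = j r) ∧ ∀ v, Φ (ι R V v) = D v := by
  let : Algebra R T := j.toAlgebra
  let D' : V →ₗ[R] T := { D with map_smul' := h }
  exact ⟨(lift D').toRingHom, fun r => (lift D').commutes r, fun v => lift_ι_apply D' v⟩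

/-- An additive map on `V` that is `R`-linear up to a derivation of `R` extends to a derivation of
the symmetric algebra. -/
theorem exists_twisted_derivation {M : Type*} [AddCommGroup M] [Module (SymmetricAlgebra R V) M]
    (δ : R →+ M)
    (hδ : ∀ r r', δ (r * r') = algebraMap R (SymmetricAlgebra R V) r • δ r' +
      algebraMap R (SymmetricAlgebra R V) r' • δ r)
    (D : V →+ M)
    (hD : ∀ (r : R) v, D (r • v) = algebraMap R (SymmetricAlgebra R V) r • D v +
      ι R V v • δ r) :
    ∃ d : Derivation ℤ (SymmetricAlgebra R V) M,
      (∀ r, d (algebraMap R _ r) = δ r) ∧ ∀ v, d (ι R V v) = D v := by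
  let : Module (SymmetricAlgebra R V)ᵐᵒᵖ M :=
    Module.compHom M ((RingHom.id (SymmetricAlgebra R V)).fromOpposite fun _ _ => mul_comm _ _)
  have : IsCentralScalar (SymmetricAlgebra R V) M := ⟨fun _ _ => rfl⟩
  have hδ1 : δ 1 = 0 := by
    have := hδ 1 1
    simp only [mul_one, map_one, one_smul] at this
    exact left_eq_add.1 this
  -- The square-zero extension is regarded as an algebra over `R` through `r ↦ r + ε δ(r)`. For this
  -- structure `v ↦ v + ε D(v)` is linear, which is what `hD` says, so the universal property
  -- applies.
  let j : R →+* TrivSqZeroExt (SymmetricAlgebra R V) M :=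
    { toFun := fun r => TrivSqZeroExt.inl (algebraMap R _ r) + TrivSqZeroExt.inr (δ r)
      map_one' := by simp [hδ1]
      map_mul' := fun r r' => by ext <;> simp [hδ]
      map_zero' := by simp
      map_add' := fun r r' => by ext <;> simp }
  let D' : V →+ TrivSqZeroExt (SymmetricAlgebra R V) M :=
    AddMonoidHom.mk' (fun v => TrivSqZeroExt.inl (ι R V v) + TrivSqZeroExt.inr (D v))
      fun v w => by ext <;> simp
  obtain ⟨Φ, hr, hv⟩ := exists_ringHom j D' fun r v => by
    ext
    · simp [j, D', Algebra.smul_def]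
    · simp [j, D', hD]
  have hfst : ∀ a, (Φ a).fst = a := by
    intro a
    induction a using SymmetricAlgebra.induction with
    | algebraMap r => simp [hr, j]
    | ι v => simp [hv, D']
    | mul a b ha hb => simp [ha, hb]
    | add a b ha hb => simp [ha, hb]
  refine ⟨Derivation.mk' (AddMonoidHom.toIntLinearMap
    (AddMonoidHom.mk' (fun a => (Φ a).snd) fun a b => by simp)) ?_, ?_, ?_⟩
  · intro a b
    simp [hfst]
  · intro r
    simp [hr, j]
  · intro v
    simp [hv, D']

theorem int_derivation_ext {M : Type*} [AddCommGroup M] [Module (SymmetricAlgebra R V) M]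
    {d d' : Derivation ℤ (SymmetricAlgebra R V) M}
    (hr : ∀ r, d (algebraMap R _ r) = d' (algebraMap R _ r))
    (hv : ∀ v, d (ι R V v) = d' (ι R V v)) : d = d' := by
  ext a
  induction a using SymmetricAlgebra.induction with
  | algebraMap r => exact hr r
  | ι v => exact hv v
  | mul a b ha hb => simp [ha, hb]
  | add a b ha hb => simp [ha, hb]

end TwistedLift

/-! ### The linear Poisson structure on the dual of a Lie algebroid. -/

section LinearPoisson

open SymmetricAlgebra

variable {R V : Type*} [CommRing R] [Algebra ℝ R] [AddCommGroup V] [Module R V]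

/-- The linear Poisson structure on the dual of a Lie algebroid, up to sign. -/
structure IsLinearPoisson (L : LieAlgebroid R V) (P : Cochain (SymmetricAlgebra R V)) : Prop where
  multivector : IsMultivector R P
  arity : ∀ n, n ≠ 2 → P n = 0
  weight : HasWeight LinearMap.id (-1) P
  ctr_ι_ι : ∀ u v, ctr (ι R V v) (ctr (ι R V u) P) = -ofPoly (ι R V (L.bracket u v))
  ctr_algebraMap_ι : ∀ u f, ctr (algebraMap R _ f) (ctr (ι R V u) P) =
    -ofPoly (algebraMap R _ (L.anchor u f))

/-- The vector field `u ↦ a(u) f` on the dual of a Lie algebroid. -/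
def vertical (L : LieAlgebroid R V) (f : R) :
    Derivation R (SymmetricAlgebra R V) (SymmetricAlgebra R V) :=
  derLift (Algebra.linearMap R _ ∘ₗ L.d0 f)

theorem vertical_ι (L : LieAlgebroid R V) (f : R) (v : V) :
    vertical L f (ι R V v) = algebraMap R _ (L.anchor v f) := derLift_ι _ v

/-- The Leibniz rule of the algebroid is exactly the compatibility needed to extend `r ↦ a(u) r` and
`v ↦ [u, v]` to one derivation. -/
theorem exists_hamiltonian (L : LieAlgebroid R V) (u : V) :
    ∃ d : Derivation ℤ (SymmetricAlgebra R V) (SymmetricAlgebra R V),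
      (∀ r, d (algebraMap R _ r) = algebraMap R _ (L.anchor u r)) ∧
        ∀ v, d (ι R V v) = ι R V (L.bracket u v) := by
  refine exists_twisted_derivation (AddMonoidHom.mk' (fun r => algebraMap R _ (L.anchor u r))
    fun r r' => by simp) (fun r r' => by simp) (AddMonoidHom.mk'
      (fun v => ι R V (L.bracket u v)) fun v w => by simp) fun r v => ?_
  simp [L.leibniz, Algebra.smul_def, mul_comm]

/-- The extension procedure is applied once more, with values in derivations: `u` goes to its
Hamiltonian field and `f` to minus its vertical field. -/
theorem exists_biderivation (L : LieAlgebroid R V) :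
    ∃ d : Derivation ℤ (SymmetricAlgebra R V)
        (Derivation ℤ (SymmetricAlgebra R V) (SymmetricAlgebra R V)),
      (∀ u f, d (ι R V u) (algebraMap R _ f) = algebraMap R _ (L.anchor u f)) ∧
      (∀ u v, d (ι R V u) (ι R V v) = ι R V (L.bracket u v)) ∧
      (∀ f v, d (algebraMap R _ f) (ι R V v) = -algebraMap R _ (L.anchor v f)) ∧
      (∀ f f', d (algebraMap R _ f) (algebraMap R _ f') = 0) := by
  choose X hXr hXv using exists_hamiltonian L
  obtain ⟨d, hr, hv⟩ := exists_twisted_derivation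
    (M := Derivation ℤ (SymmetricAlgebra R V) (SymmetricAlgebra R V))
    (AddMonoidHom.mk' (fun f => -(vertical L f).restrictScalars ℤ) fun f f' =>
      int_derivation_ext (fun r => by simp) (fun v => by simp [vertical_ι]; ring))
    (fun f f' => int_derivation_ext (fun r => by simp) (fun v => by
      simp [vertical_ι, Algebra.smul_def]; ring))
    (AddMonoidHom.mk' X fun u v => int_derivation_ext (fun r => by simp [hXr])
      (fun w => by simp [hXv]))
    (fun f u => int_derivation_ext (fun r => by simp [hXr, Algebra.smul_def]) (fun v => by
      simp [hXv, vertical_ι]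
      -- The Leibniz rule is an axiom in the second argument only; skewness transfers it to the
      -- first.
      rw [L.bracket_skew, L.leibniz, L.bracket_skew v u]
      simp [Algebra.smul_def]
      ring))
  refine ⟨d, fun u f => ?_, fun u v => ?_, fun f v => ?_, fun f f' => ?_⟩
  · rw [hv]; exact hXr u f
  · rw [hv]; exact hXv u v
  · rw [hr]; simp [vertical_ι]
  · rw [hr]; simp

/-- The symmetrization of a biderivation is a derivation in each argument, so it vanishes once it
does on generators. -/
theorem biderivation_ext
    {d : Derivation ℤ (SymmetricAlgebra R V)
        (Derivation ℤ (SymmetricAlgebra R V) (SymmetricAlgebra R V))}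
    (h1 : ∀ u v, d (ι R V u) (ι R V v) + d (ι R V v) (ι R V u) = 0)
    (h2 : ∀ u f, d (ι R V u) (algebraMap R _ f) + d (algebraMap R _ f) (ι R V u) = 0)
    (h3 : ∀ f f', d (algebraMap R _ f) (algebraMap R _ f') +
      d (algebraMap R _ f') (algebraMap R _ f) = 0) (a b : SymmetricAlgebra R V) :
    d a b + d b a = 0 := by
  have hmul : ∀ a a' b, d a b + d b a = 0 → d a' b + d b a' = 0 →
      d (a * a') b + d b (a * a') = 0 := by
    intro a a' b h h'
    simp only [Derivation.leibniz, Derivation.add_apply, Derivation.smul_apply, smul_eq_mul]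
    linear_combination a * h' + a' * h
  have hadd : ∀ a a' b, d a b + d b a = 0 → d a' b + d b a' = 0 →
      d (a + a') b + d b (a + a') = 0 := by
    intro a a' b h h'
    simp only [map_add, Derivation.add_apply]
    linear_combination h' + h
  induction a using SymmetricAlgebra.induction with
  | algebraMap r =>
    rw [add_comm]
    induction b using SymmetricAlgebra.induction with
    | algebraMap r' => exact h3 _ _
    | ι v => exact h2 v r
    | mul a b ha hb => exact hmul _ _ _ ha hb
    | add a b ha hb => exact hadd _ _ _ ha hb
  | ι u =>
    rw [add_comm]
    induction b using SymmetricAlgebra.induction with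
    | algebraMap r => rw [add_comm]; exact h2 u r
    | ι v => exact h1 _ _
    | mul a b ha hb => exact hmul _ _ _ ha hb
    | add a b ha hb => exact hadd _ _ _ ha hb
  | mul a b ha hb => exact hmul _ _ _ ha hb
  | add a b ha hb => exact hadd _ _ _ ha hb

theorem ofField_add {S : Type*} [CommRing S] (D D' : S → S) :
    ofField (D + D') = ofField D + ofField D' := by
  funext n v
  rcases n with _ | _ | n <;> simp [ofField]

theorem ofField_zero {S : Type*} [CommRing S] : ofField (0 : S → S) = 0 := by
  funext n v
  rcases n with _ | _ | n <;> simp [ofField]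

theorem ofField_smul {S : Type*} [CommRing S] (g : S) (D : S → S) :
    ofField (g • D) = g • ofField D := by
  funext n v
  rcases n with _ | _ | n <;> simp [ofField]

/-- The Lie derivative of `P` along the Euler field minus `w • P` is again a bivector field, hence
is determined on generators. There `h1` and `h2` express that bracket and anchor are homogeneous for
the grading defined by `p`. -/
theorem hasWeight_of_generators {p : V →ₗ[R] V} {w : ℤ} {P : Cochain (SymmetricAlgebra R V)}
    {L : LieAlgebroid R V} (hP : IsMultivector R P) (har : ∀ n, n ≠ 2 → P n = 0)
    (hιι : ∀ u v, ctr (ι R V v) (ctr (ι R V u) P) = -ofPoly (ι R V (L.bracket u v)))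
    (hιr : ∀ u f, ctr (algebraMap R _ f) (ctr (ι R V u) P) =
      -ofPoly (algebraMap R _ (L.anchor u f)))
    (hrr : ∀ f f', ctr (algebraMap R _ f') (ctr (algebraMap R _ f) P) = 0)
    (h1 : ∀ u v, p (L.bracket u v) - L.bracket u (p v) - L.bracket (p u) v = w • L.bracket u v)
    (h2 : ∀ u f, L.anchor (p u) f + w • L.anchor u f = 0) : HasWeight p w P := by
  have hE := isMultivector_euler p
  set T := poisson (ofField (euler p)) P - w • P with hT
  have hTm : IsMultivector R T := (hE.poisson hP).sub (hP.zsmul w)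
  have hctr : ∀ g g', ctr g' (ctr g T) = poisson (ofField (euler p)) (ctr g' (ctr g P)) -
      ctr (euler p g') (ctr g P) - ctr g' (ctr (euler p g) P) - w • ctr g' (ctr g P) := by
    intro g g'
    rw [hT, ctr_sub_cochain, ctr_sub_cochain, ctr_ofField_poisson hE hP, ctr_sub_cochain,
      ctr_ofField_poisson hE (hP.contract g)]
    rfl
  have hTar : ∀ n, n ≠ 2 → T n = 0 := by
    intro n hn
    have : poisson (ofField (euler p)) P n = 0 := by
      refine poisson_eq_zero_of_arity hE hP fun i j hij => ⟨?_, ?_⟩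
      · rcases j with _ | j
        · exact Or.inr (har _ (by omega))
        · exact Or.inl rfl
      · by_cases hi : i = 1
        · exact Or.inl (har _ (by omega))
        · refine Or.inr ?_
          rcases i with _ | _ | i
          · rfl
          · exact absurd rfl hi
          · rfl
    rw [hT, Pi.sub_apply, this, Pi.smul_apply, har n hn]
    simp
  have e1 : ∀ u v, ctr (ι R V v) (ctr (ι R V u) T) = 0 := by
    intro u v
    rw [hctr, hιι, hE.poisson_neg, ofField_poisson_ofPoly hE, euler_ι, euler_ι, euler_ι, hιι,
      hιι]
    have := congr(ofPoly (ι R V $(h1 u v)))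
    simp only [map_sub, map_zsmul] at this
    rw [← ofPoly_neg, ← ofPoly_neg, ← ofPoly_neg, ← ofPoly_neg]
    funext n x
    rcases n with _ | n
    · have h := congr($this 0 x)
      simp only [ofPoly, Pi.sub_apply, Pi.smul_apply, Pi.zero_apply] at h ⊢
      rw [zsmul_eq_mul] at h ⊢
      linear_combination -h
    · simp [ofPoly]
  have e2 : ∀ u f, ctr (algebraMap R _ f) (ctr (ι R V u) T) = 0 := by
    intro u f
    rw [hctr, hιr, hE.poisson_neg, ofField_poisson_ofPoly hE, euler_ι, hιr,
      Derivation.map_algebraMap, Derivation.map_algebraMap, (hP.contract _).ctr_zero]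
    have := congr(algebraMap R (SymmetricAlgebra R V) $(h2 u f))
    funext n x
    rcases n with _ | n
    · simp only [map_add, map_zsmul, map_zero] at this
      simp only [ofPoly, Pi.sub_apply, Pi.smul_apply, Pi.neg_apply, Pi.zero_apply]
      rw [zsmul_eq_mul] at this ⊢
      linear_combination this
    · simp [ofPoly]
  have e3 : ∀ f f', ctr (algebraMap R _ f') (ctr (algebraMap R _ f) T) = 0 := by
    intro f f'
    rw [hctr, hrr, hE.poisson_zero]
    simp [(hP.contract _).ctr_zero, hP.ctr_zero, ctr_zero_cochain]
  have hT0 : T 2 = 0 := by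
    refine apply_succ_eq_zero hTm (fun f => ?_) fun u => ?_
    · refine apply_succ_eq_zero (hTm.contract _) (fun f' => ?_) fun u => ?_
      · rw [e3]; rfl
      · rw [hTm.ctr_swap, e2]; simp
    · refine apply_succ_eq_zero (hTm.contract _) (fun f' => ?_) fun v => ?_
      · rw [e2]; rfl
      · rw [e1]; rfl
  have : T = 0 := by
    funext n
    by_cases hn : n = 2
    · rw [hn, hT0]; rfl
    · exact hTar n hn
  exact sub_eq_zero.1 this

theorem exists_linearPoisson (L : LieAlgebroid R V) :
    ∃ P, IsLinearPoisson L P ∧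
      ∀ f f', ctr (algebraMap R _ f') (ctr (algebraMap R _ f) P) = 0 := by
  obtain ⟨d, h1, h2, h3, h4⟩ := exists_biderivation L
  have hskew : ∀ a b, d a b + d b a = 0 := by
    refine biderivation_ext (fun u v => ?_) (fun u f => ?_) fun f f' => ?_
    · rw [h2, h2, ← map_add, L.bracket_skew u v, neg_add_cancel, map_zero]
    · rw [h1, h3, add_neg_cancel]
    · rw [h4, h4, add_zero]
  have hself : ∀ a, d a a = 0 := fun a =>
    zsmul_eq_zero_of_ne_zero R (z := 2) (by decide) (by rw [two_smul, hskew])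
  have hconst : ∀ c : ℝ, d (algebraMap R _ (algebraMap ℝ R c)) = 0 := by
    intro c
    refine int_derivation_ext (fun r => ?_) fun v => ?_
    · rw [h4]; rfl
    · rw [h3]; simp
  have hfield : ∀ a, IsMultivector R (ofField (d a)) := fun a =>
    isMultivector_ofField (fun s t => map_add _ s t) (fun s t => by simp) fun c => by
      have := hskew a (algebraMap R _ (algebraMap ℝ R c))
      rwa [hconst, Derivation.zero_apply, add_zero] at this
  have hbi : IsMultivector R (ofBi fun a b => d a b) := by
    refine isMultivector_of_ctr (fun g => ?_) (fun g h => ?_) (fun c => ?_) (fun g h => ?_)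
      fun g => ?_
    · rw [ctr_ofBi]; exact hfield g
    · simp only [ctr_ofBi, map_add, Derivation.coe_add, ofField_add]
    · rw [ctr_ofBi, hconst]; exact ofField_zero
    · simp only [ctr_ofBi, Derivation.leibniz, Derivation.coe_add, ofField_add,
        Derivation.coe_smul, ofField_smul]
    · rw [ctr_ofBi, ctr_ofField, hself, ofPoly_zero]
  have har : ∀ n, n ≠ 2 → (-ofBi fun a b => d a b) n = 0 := by
    rintro (_ | _ | _ | n) hn
    · simp; rfl
    · simp; rfl
    · exact absurd rfl hn
    · simp; rfl
  have hg : ∀ a b, ctr b (ctr a (-ofBi fun a b => d a b)) = -ofPoly (d a b) := fun a b => by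
    rw [ctr_neg_cochain, ctr_neg_cochain, ctr_ofBi, ctr_ofField]
  have g1 := fun u v => (hg (ι R V u) (ι R V v)).trans (by rw [h2])
  have g2 := fun u f => (hg (ι R V u) (algebraMap R _ f)).trans (by rw [h1])
  have g3 := fun f f' => (hg (algebraMap R _ f) (algebraMap R _ f')).trans
    (by rw [h4, ofPoly_zero, neg_zero])
  exact ⟨_, ⟨hbi.neg, har, hasWeight_of_generators hbi.neg har g1 g2 g3 (by simp) (by simp), g1,
    g2⟩, g3⟩

theorem IsLinearPoisson.hasParity {L : LieAlgebroid R V} {P : Cochain (SymmetricAlgebra R V)}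
    (h : IsLinearPoisson L P) : HasParity 0 P := fun n hn =>
  h.arity n (by rintro rfl; exact absurd hn (by decide))

/-- The square has total weight -2, so it is enough to contract it with two linear functions. This
leaves the defect of `u ↦ ctr u P` as a homomorphism of brackets, a vector field. -/
theorem IsLinearPoisson.poisson_self {L : LieAlgebroid R V} {P : Cochain (SymmetricAlgebra R V)}
    (h : IsLinearPoisson L P) : poisson P P = 0 := by
  have hP := h.multivector
  have hw : HasWeight LinearMap.id (-1 + -1) (poisson P P) :=
    h.weight.poisson h.weight h.hasParity h.hasParity hP hP
  have hm := hP.poisson hP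
  have hu : ∀ u, ctr (ι R V u) (poisson P P) = (-2 : ℤ) • poisson (ctr (ι R V u) P) P := by
    intro u
    rw [ctr_poisson_of_hasParity h.hasParity hP hP,
      poisson_comm h.hasParity (h.hasParity.contract _) hP (hP.contract _)]
    module
  have huv : ∀ u v, ctr (ι R V v) (poisson (ctr (ι R V u) P) P) =
      poisson (ctr (ι R V u) P) (ctr (ι R V v) P) + ctr (ι R V (L.bracket u v)) P := by
    intro u v
    rw [ctr_poisson (hP.contract _) hP, h.ctr_ι_ι, hP.twist.neg_poisson, ofPoly_poisson_twist hP,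
      sub_neg_eq_add]
  have huvg : ∀ u v g a b, ctr g (ctr (ι R V u) P) = ofPoly a → ctr g (ctr (ι R V v) P) = ofPoly b →
      ctr g (poisson (ctr (ι R V u) P) (ctr (ι R V v) P)) =
        ctr b (ctr (ι R V u) P) - ctr a (ctr (ι R V v) P) := by
    intro u v g a b ha hb
    rw [ctr_poisson (hP.contract _) (hP.contract _), ha, hb, poisson_ofPoly (hP.contract _),
      ofPoly_poisson_twist (hP.contract _)]
  have har : ∀ u n, n ≠ 1 → ctr (ι R V u) P n = 0 := fun u n hn => by
    funext x
    rw [ctr_apply, h.arity _ (by omega)]; rfl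
  have key : ∀ u v, ctr (ι R V v) (poisson (ctr (ι R V u) P) P) = 0 := by
    intro u v
    have hmm := ((hP.contract (ι R V u)).poisson hP).contract (ι R V v)
    funext n
    by_cases hn : n = 1
    · subst hn
      -- On base functions the defect vanishes because the anchor preserves brackets, on linear
      -- functions by the Jacobi identity.
      refine apply_succ_eq_zero hmm (fun f => ?_) fun w => ?_
      · rw [huv, ctr_add_cochain, huvg _ _ _ _ _ ((h.ctr_algebraMap_ι _ _).trans (ofPoly_neg _).symm)
          ((h.ctr_algebraMap_ι _ _).trans (ofPoly_neg _).symm), h.ctr_algebraMap_ι,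
          (hP.contract _).ctr_neg, (hP.contract _).ctr_neg, h.ctr_algebraMap_ι,
          h.ctr_algebraMap_ι, L.anchor_bracket]
        funext x
        simp [ofPoly, Derivation.commutator_apply]
      · rw [huv, ctr_add_cochain, huvg _ _ _ _ _ ((h.ctr_ι_ι _ _).trans (ofPoly_neg _).symm)
          ((h.ctr_ι_ι _ _).trans (ofPoly_neg _).symm), h.ctr_ι_ι,
          (hP.contract _).ctr_neg, (hP.contract _).ctr_neg, h.ctr_ι_ι,
          h.ctr_ι_ι, L.jacobi u v w]
        funext x
        simp [ofPoly]
    · rw [huv, Pi.add_apply, har _ n hn]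
      rw [poisson_eq_zero_of_arity (hP.contract _) (hP.contract _)]
      · exact add_zero _
      · intro i j hij
        by_cases hi : i = 1
        · exact ⟨Or.inl (har _ _ (by omega)), Or.inl (har _ _ (by omega))⟩
        · exact ⟨Or.inr (har _ _ (by omega)), Or.inr (har _ _ (by omega))⟩
  refine eq_zero_of_weight_neg (LinearMap.comp_id _) (by decide) hw hm fun u => ?_
  refine eq_zero_of_weight_neg (LinearMap.comp_id _) (w := -1) (by decide) ?_ (hm.contract _) ?_
  · simpa using hw.contract (a := 1) hm (by simp [euler_ι])
  · intro v
    rw [LinearMap.id_apply, LinearMap.id_apply, hu, ctr_zsmul_cochain, key, smul_zero]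

end LinearPoisson

/-! ### The structure function of `𝒜` as the linear Poisson structure of `A ⋉ E*`. -/

section Semidirect

open SymmetricAlgebra

variable {R A E : Type*} [CommRing R] [Algebra ℝ R] [AddCommGroup A] [Module R A]
  [AddCommGroup E] [Module R E] {L : LieAlgebroid R A}

namespace Representation

variable (ρ : Representation L E)

theorem dualConn_apply (x : A) (φ : Module.Dual R E) (e : E) :
    ρ.dualConn x φ e = L.anchor x (φ e) - φ (ρ.conn x e) := rfl

theorem dualConn_add_left (x y : A) (φ : Module.Dual R E) :
    ρ.dualConn (x + y) φ = ρ.dualConn x φ + ρ.dualConn y φ := by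
  ext e
  simp only [dualConn_apply, map_add, AddMonoidHom.add_apply, LinearMap.add_apply,
    Derivation.add_apply]
  ring

theorem dualConn_add_right (x : A) (φ ψ : Module.Dual R E) :
    ρ.dualConn x (φ + ψ) = ρ.dualConn x φ + ρ.dualConn x ψ := by
  ext e
  simp only [dualConn_apply, map_add, LinearMap.add_apply]
  ring

/-- The dual connection as a biadditive map. -/
def dualConnHom : A →+ Module.Dual R E →+ Module.Dual R E :=
  AddMonoidHom.mk' (fun x => AddMonoidHom.mk' (ρ.dualConn x) (ρ.dualConn_add_right x))
    fun x y => by ext1 φ; exact ρ.dualConn_add_left x y φ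

theorem dualConn_sub_right (x : A) (φ ψ : Module.Dual R E) :
    ρ.dualConn x (φ - ψ) = ρ.dualConn x φ - ρ.dualConn x ψ :=
  map_sub (ρ.dualConnHom x) φ ψ

theorem dualConn_zero_left (φ : Module.Dual R E) : ρ.dualConn 0 φ = 0 :=
  congr($(map_zero ρ.dualConnHom) φ)

theorem dualConn_zero_right (x : A) : ρ.dualConn x 0 = 0 := map_zero (ρ.dualConnHom x)

theorem dualConn_smul_left (f : R) (x : A) (φ : Module.Dual R E) :
    ρ.dualConn (f • x) φ = f • ρ.dualConn x φ := by
  ext e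
  simp only [dualConn_apply, map_smul, LinearMap.smul_apply, Derivation.smul_apply,
    ρ.conn_smul_left, smul_eq_mul]
  ring

theorem dualConn_smul_right (x : A) (f : R) (φ : Module.Dual R E) :
    ρ.dualConn x (f • φ) = f • ρ.dualConn x φ + L.anchor x f • φ := by
  ext e
  simp only [dualConn_apply, LinearMap.smul_apply, LinearMap.add_apply, smul_eq_mul,
    Derivation.leibniz]
  ring

theorem dualConn_bracket (x y : A) (φ : Module.Dual R E) :
    ρ.dualConn (L.bracket x y) φ =
      ρ.dualConn x (ρ.dualConn y φ) - ρ.dualConn y (ρ.dualConn x φ) := by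
  ext e
  simp only [dualConn_apply, LinearMap.sub_apply, ρ.flat, map_sub, L.anchor_bracket,
    Derivation.commutator_apply]
  ring

/-- The semidirect product of a Lie algebroid with the dual of a representation. -/
def semidirectDual : LieAlgebroid R (A × Module.Dual R E) where
  bracket := AddMonoidHom.mk' (fun u => AddMonoidHom.mk'
      (fun v => (L.bracket u.1 v.1, ρ.dualConn u.1 v.2 - ρ.dualConn v.1 u.2)) fun v w => by
        simp only [Prod.fst_add, Prod.snd_add, map_add, dualConn_add_right, dualConn_add_left]
        ext1
        · rfl
        · simp only [Prod.snd_add]; abel) fun u v => by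
    ext1 w
    simp only [Prod.fst_add, Prod.snd_add, map_add, dualConn_add_right, dualConn_add_left,
      AddMonoidHom.mk'_apply, AddMonoidHom.add_apply]
    ext1
    · rfl
    · simp only [Prod.snd_add]; abel
  anchor := L.anchor ∘ₗ LinearMap.fst R A (Module.Dual R E)
  bracket_self u := by simp [L.bracket_self]
  jacobi u v w := by
    simp only [AddMonoidHom.mk'_apply]
    ext1
    · exact L.jacobi _ _ _
    · simp only [Prod.snd_add, dualConn_sub_right, dualConn_bracket]
      abel
  leibniz u f v := by
    simp only [AddMonoidHom.mk'_apply]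
    ext1
    · simp [L.leibniz]
    · simp [dualConn_smul_right, dualConn_smul_left, smul_sub]
      abel
  anchor_bracket u v := by simp [L.anchor_bracket]

theorem semidirectDual_bracket (u v : A × Module.Dual R E) :
    ρ.semidirectDual.bracket u v =
      (L.bracket u.1 v.1, ρ.dualConn u.1 v.2 - ρ.dualConn v.1 u.2) := rfl

theorem semidirectDual_anchor (u : A × Module.Dual R E) :
    ρ.semidirectDual.anchor u = L.anchor u.1 := rfl

end Representation

variable (R A E) in
/-- The projection to the first summand. -/
def projA : (A × Module.Dual R E) →ₗ[R] A × Module.Dual R E :=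
  LinearMap.inl R A (Module.Dual R E) ∘ₗ LinearMap.fst R A (Module.Dual R E)

variable (R A E) in
/-- The projection to the second summand. -/
def projE : (A × Module.Dual R E) →ₗ[R] A × Module.Dual R E :=
  LinearMap.inr R A (Module.Dual R E) ∘ₗ LinearMap.snd R A (Module.Dual R E)

theorem projA_apply (u : A × Module.Dual R E) : projA R A E u = (u.1, 0) := rfl

theorem projE_apply (u : A × Module.Dual R E) : projE R A E u = (0, u.2) := rfl

theorem projA_comp : projA R A E ∘ₗ projA R A E = projA R A E := rfl

theorem projE_comp : projE R A E ∘ₗ projE R A E = projE R A E := rfl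

theorem ι_zero_zero : ι R (A × Module.Dual R E) (0, 0) = 0 := map_zero (ι R (A × Module.Dual R E))

theorem euler_projA_fst (x : A) : euler (projA R A E) (ι R _ (x, 0)) = (1 : ℤ) • ι R _ (x, 0) := by
  rw [euler_ι, projA_apply, one_smul]

theorem euler_projA_snd (φ : Module.Dual R E) :
    euler (projA R A E) (ι R _ (0, φ)) = (0 : ℤ) • ι R _ (0, φ) := by
  rw [euler_ι, projA_apply, zero_smul, ι_zero_zero]

theorem euler_projE_fst (x : A) : euler (projE R A E) (ι R _ (x, 0)) = (0 : ℤ) • ι R _ (x, 0) := by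
  rw [euler_ι, projE_apply, zero_smul, ι_zero_zero]

theorem euler_projE_snd (φ : Module.Dual R E) :
    euler (projE R A E) (ι R _ (0, φ)) = (1 : ℤ) • ι R _ (0, φ) := by
  rw [euler_ι, projE_apply, one_smul]

theorem euler_algebraMap {V : Type*} [AddCommGroup V] [Module R V] (p : V →ₗ[R] V) (f : R) :
    euler p (algebraMap R _ f) = (0 : ℤ) • algebraMap R _ f := by simp

variable {P Q : Cochain (Poly R A E)}

theorem euler_id : euler (LinearMap.id : (A × Module.Dual R E) →ₗ[R] _) =
    euler (projA R A E) + euler (projE R A E) := der_ext fun v => by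
  rw [Derivation.add_apply, euler_ι, euler_ι, euler_ι, ← map_add]
  simp [projA_apply, projE_apply]

theorem HasWeight.total {w w' : ℤ} (h : HasWeight (projA R A E) w P)
    (h' : HasWeight (projE R A E) w' P) (hP : IsMultivector R P) :
    HasWeight LinearMap.id (w + w') P := by
  rw [HasWeight, euler_id, Derivation.coe_add, ofField_add, poisson_add_left hP, h, h', add_smul]

theorem isTridegree_iff {i j k : ℕ} : IsTridegree i j k P ↔ IsMultivector R P ∧
    (∀ n, n + i ≠ j + k → P n = 0) ∧ HasWeight (projA R A E) (i - j) P ∧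
      HasWeight (projE R A E) (i - k) P :=
  ⟨fun h => ⟨h.multivector, h.arity, h.weight1, h.weight2⟩, fun h => ⟨h.1, h.2.1, h.2.2.1, h.2.2.2⟩⟩

theorem isTridegree_zero (i j k : ℕ) : IsTridegree i j k (0 : Cochain (Poly R A E)) :=
  isTridegree_iff.2 ⟨isMultivector_zero, fun _ _ => rfl,
    by rw [HasWeight, (isMultivector_euler _).poisson_zero, smul_zero],
    by rw [HasWeight, (isMultivector_euler _).poisson_zero, smul_zero]⟩

theorem eq_ofPoly_of_arity {S : Type*} [CommRing S] {P : Cochain S} (h : ∀ n, n ≠ 0 → P n = 0) :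
    P = ofPoly (P 0 ![]) := by
  funext n v
  rcases n with _ | n
  · simp only [ofPoly]
    congr 1
    exact Subsingleton.elim _ _
  · rw [h _ (by simp)]; rfl

theorem ctr_arity {S : Type*} [CommRing S] {P : Cochain S} {k : ℕ}
    (h : ∀ n, n ≠ k + 1 → P n = 0) (g : S) : ∀ n, n ≠ k → ctr g P n = 0 := fun n hn => by
  funext v
  rw [ctr_apply, h _ (by omega)]
  rfl

theorem eq_zero_of_weight_neg_of_arity {V : Type*} [AddCommGroup V] [Module R V] {p : V →ₗ[R] V}
    (hp : p ∘ₗ p = p) {w : ℤ} (hw : w < 0) {P : Cochain (SymmetricAlgebra R V)}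
    (h : HasWeight p w P) (hP : IsMultivector R P) (har : ∀ n, n ≠ 0 → P n = 0) : P = 0 := by
  funext n
  by_cases hn : n = 0
  · subst hn
    funext v
    exact eq_zero_of_euler_neg hp hw (h.apply_zero hP v)
  · exact har n hn

theorem field_ext {V : Type*} [AddCommGroup V] [Module R V] {P Q : Cochain (SymmetricAlgebra R V)}
    (hP : IsMultivector R P) (hQ : IsMultivector R Q) (hPa : ∀ n, n ≠ 1 → P n = 0)
    (hQa : ∀ n, n ≠ 1 → Q n = 0)
    (hr : ∀ f, ctr (algebraMap R _ f) P = ctr (algebraMap R _ f) Q)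
    (hv : ∀ v, ctr (ι R V v) P = ctr (ι R V v) Q) : P = Q := by
  rw [← sub_eq_zero]
  funext n
  by_cases hn : n = 1
  · subst hn
    refine apply_succ_eq_zero (hP.sub hQ) (fun f => ?_) fun v => ?_
    · rw [ctr_sub_cochain, hr, sub_self]; rfl
    · rw [ctr_sub_cochain, hv, sub_self]; rfl
  · rw [Pi.sub_apply, hPa n hn, hQa n hn, sub_zero]; rfl

theorem ofField_arity {S : Type*} [CommRing S] (D : S → S) : ∀ n, n ≠ 1 → ofField D n = 0 := by
  rintro (_ | _ | n) hn
  · rfl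
  · exact absurd rfl hn
  · rfl

theorem poisson_arity {S : Type*} [CommRing S] [Algebra R S] {P Q : Cochain S}
    (hP : IsMultivector R P) (hQ : IsMultivector R Q) {p q r : ℕ} (hPa : ∀ n, n ≠ p → P n = 0)
    (hQa : ∀ n, n ≠ q → Q n = 0) (hr : p + q = r + 1) : ∀ n, n ≠ r → poisson P Q n = 0 := by
  intro n hn
  refine poisson_eq_zero_of_arity hP hQ fun i j hij => ⟨?_, ?_⟩
  · by_cases hi : i = q
    · exact Or.inl (hPa _ (by omega))
    · exact Or.inr (hQa _ hi)
  · by_cases hi : i = p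
    · exact Or.inl (hQa _ (by omega))
    · exact Or.inr (hPa _ hi)

theorem derLift_contrSnd (e : E) (u : A × Module.Dual R E) :
    derLift (contrSnd e) (ι R (A × Module.Dual R E) u) = algebraMap R _ (u.2 e) := derLift_ι _ u

theorem derLift_contrFst (α : Module.Dual R A) (u : A × Module.Dual R E) :
    derLift (contrFst (A2 := E) α) (ι R (A × Module.Dual R E) u) = algebraMap R _ (α u.1) :=
  derLift_ι _ u

theorem isMultivector_secA2 (e : E) : IsMultivector R (secA2 (R := R) A e) :=
  isMultivector_derivation _

theorem ctr_secA2_ι (e : E) (u : A × Module.Dual R E) :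
    ctr (ι R _ u) (secA2 A e) = ofPoly (algebraMap R _ (u.2 e)) := by
  rw [secA2, ctr_ofField, derLift_contrSnd]

theorem ctr_secA2_algebraMap (e : E) (f : R) :
    ctr (algebraMap R (Poly R A E) f) (secA2 A e) = 0 := by
  rw [secA2, ctr_ofField, Derivation.map_algebraMap, ofPoly_zero]

theorem secA2_arity (e : E) : ∀ n, n ≠ 1 → secA2 (R := R) A e n = 0 := ofField_arity _

theorem secA2_zero : secA2 (R := R) A (0 : E) = 0 :=
  field_ext (isMultivector_secA2 _) isMultivector_zero (secA2_arity _) (fun _ _ => rfl)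
    (fun f => by rw [ctr_secA2_algebraMap, ctr_zero_cochain])
    fun u => by rw [ctr_secA2_ι, map_zero, map_zero, ofPoly_zero, ctr_zero_cochain]

theorem isMultivector_secA1Dual (α : Module.Dual R A) :
    IsMultivector R (secA1Dual (A2 := E) α) :=
  isMultivector_derivation _

theorem ctr_secA1Dual_ι (α : Module.Dual R A) (u : A × Module.Dual R E) :
    ctr (ι R _ u) (secA1Dual E α) = ofPoly (algebraMap R _ (α u.1)) := by
  rw [secA1Dual, ctr_ofField, derLift_contrFst]

theorem ctr_secA1Dual_algebraMap (α : Module.Dual R A) (f : R) :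
    ctr (algebraMap R (Poly R A E) f) (secA1Dual E α) = 0 := by
  rw [secA1Dual, ctr_ofField, Derivation.map_algebraMap, ofPoly_zero]

theorem secA1Dual_arity (α : Module.Dual R A) : ∀ n, n ≠ 1 → secA1Dual E α n = 0 :=
  ofField_arity _

/-- The derived brackets give the values on pairs from `A` and on a section of `A` with a base
function. Values on `E* × E*` and on `E*` with base functions have weight -1 for the first Euler
field and vanish. The mixed value on `A × E*` is forced to be linear by its weights and is then
identified through the derived bracket `∇_x e`. -/
theorem isLinearPoisson_of_isStructureFunction {ρ : Representation L E}
    {m0 m2 m4 : Cochain (Poly R A E)} (h : IsStructureFunction ρ.semidirect m0 m2 m4) :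
    IsLinearPoisson ρ.semidirectDual m2 ∧ HasWeight (projA R A E) (-1) m2 ∧
      HasWeight (projE R A E) 0 m2 := by
  obtain ⟨hP, har, h1, h2⟩ := isTridegree_iff.1 h.tri2
  replace har : ∀ n, n ≠ 2 → m2 n = 0 := fun n hn => har n (by omega)
  replace h1 : HasWeight (projA R A E) (-1) m2 := by simpa using h1
  replace h2 : HasWeight (projE R A E) 0 m2 := by simpa using h2
  have har0 : ∀ g g', ∀ n, n ≠ 0 → ctr g' (ctr g m2) n = 0 := fun g g' =>
    ctr_arity (ctr_arity har g) g'
  have hAA : ∀ x y : A, ctr (ι R (A × Module.Dual R E) (y, 0)) (ctr (ι R _ (x, 0)) m2) =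
      -ofPoly (ι R _ (L.bracket x y, 0)) := by
    intro x y
    have := h.brackets.l2 x y
    rw [secA1, secA1, secA1, poisson_ofPoly hP, poisson_ofPoly (hP.contract _)] at this
    rw [← neg_neg (ctr _ _), ← this]
    rfl
  have hAf : ∀ (x : A) (f : R), ctr (algebraMap R _ f) (ctr (ι R _ (x, 0)) m2) =
      -ofPoly (algebraMap R _ (L.anchor x f)) := by
    intro x f
    have := h.brackets.anchor x f
    rw [secR, secR, secA1, poisson_ofPoly hP, poisson_ofPoly (hP.contract _)] at this
    rw [← neg_neg (ctr _ _), ← this]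
    rfl
  have hφ : ∀ (φ : Module.Dual R E), HasWeight (projA R A E) (-1) (ctr (ι R _ (0, φ)) m2) :=
    fun φ => by simpa using h1.contract hP (euler_projA_snd φ)
  have hEf : ∀ (φ : Module.Dual R E) (f : R), ctr (algebraMap R _ f) (ctr (ι R _ (0, φ)) m2) = 0 :=
    fun φ f => eq_zero_of_weight_neg_of_arity projA_comp (w := -1 + 0) (by decide)
      ((hφ φ).contract (hP.contract _) (by simp)) ((hP.contract _).contract _) (har0 _ _)
  have hEE : ∀ (φ ψ : Module.Dual R E),
      ctr (ι R _ (0, ψ)) (ctr (ι R (A × Module.Dual R E) (0, φ)) m2) = 0 :=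
    fun φ ψ => eq_zero_of_weight_neg_of_arity projA_comp (w := -1 + 0) (by decide)
      ((hφ φ).contract (hP.contract _) (euler_projA_snd ψ))
      ((hP.contract _).contract _) (har0 _ _)
  have hAE : ∀ (x : A) (φ : Module.Dual R E),
      ctr (ι R (A × Module.Dual R E) (0, φ)) (ctr (ι R _ (x, 0)) m2) =
        -ofPoly (ι R _ (0, ρ.dualConn x φ)) := by
    intro x φ
    have hs := eq_ofPoly_of_arity (har0 (ι R (A × Module.Dual R E) (x, 0)) (ι R _ (0, φ)))
    set s := ctr (ι R (A × Module.Dual R E) (0, φ)) (ctr (ι R _ (x, 0)) m2) 0 ![]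
    have w1 : euler (projA R A E) s = (0 : ℤ) • s :=
      ((h1.contract hP (euler_projA_fst x)).contract (hP.contract _) (euler_projA_snd φ)).apply_zero
          ((hP.contract _).contract _) _
    have w2 : euler (projE R A E) s = (1 : ℤ) • s :=
      ((h2.contract hP (euler_projE_fst x)).contract (hP.contract _) (euler_projE_snd φ)).apply_zero
          ((hP.contract _).contract _) _
    -- The weights 0 and 1 add up to total weight one, so `s` is linear; weight zero for `projA`
    -- then removes its component in `A`.
    obtain ⟨⟨y, ψ⟩, hyψ⟩ := exists_ι_of_euler_eq (s := s) (by
      rw [euler_id, Derivation.add_apply, w1, w2]; simp)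
    have hy : y = 0 := by
      rw [hyψ, euler_ι, projA_apply, zero_smul, ← map_zero (ι R (A × Module.Dual R E))] at w1
      exact congr(Prod.fst $(ι_injective w1))
    subst hy
    -- Contracting the derived bracket for `∇_x e` with `φ` gives `⟨φ, ∇_x e⟩ = a(x)⟨φ, e⟩ + ⟨ψ,
    -- e⟩`.
    have hψ : ψ = -ρ.dualConn x φ := by
      ext e
      have hm := congr(ctr (ι R (A × Module.Dual R E) (0, φ)) $(h.brackets.l2m x e))
      rw [secA2, secA1, secA2, ctr_ofField, poisson_ofPoly hP, ctr_neg_cochain,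
        ctr_poisson (hP.contract _) (isMultivector_derivation _), ctr_ofField,
        poisson_ofPoly (hP.contract _), hs, ofPoly_poisson_twist (isMultivector_derivation _),
        ctr_ofField, derLift_contrSnd, derLift_contrSnd, hAf, hyψ, derLift_contrSnd] at hm
      have h0 := congr($hm 0 ![])
      simp only [ofPoly, Pi.neg_apply, Pi.sub_apply] at h0
      have h3 : φ (ρ.conn x e) = L.anchor x (φ e) + ψ e := by
        apply algebraMap_leftInverse (M := A × Module.Dual R E) |>.injective
        rw [map_add]
        change algebraMap R _ (φ (ρ.conn x e)) = _ at h0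
        rw [h0]
        ring
      rw [LinearMap.neg_apply, ρ.dualConn_apply, h3]
      ring
    rw [hs, hyψ, hψ, ← ofPoly_neg, ← map_neg]
    simp
  refine ⟨⟨hP, har, by simpa using h1.total h2 hP, ?_, ?_⟩, h1, h2⟩
  · rintro ⟨x, φ⟩ ⟨y, ψ⟩
    have e1 : ι R (A × Module.Dual R E) (x, φ) = ι R _ (x, 0) + ι R _ (0, φ) := by
      rw [← map_add]; simp
    have e2 : ι R (A × Module.Dual R E) (y, ψ) = ι R _ (y, 0) + ι R _ (0, ψ) := by
      rw [← map_add]; simp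
    rw [e1, e2, hP.ctr_add, ctr_add_cochain, (hP.contract _).ctr_add, (hP.contract _).ctr_add,
      hAA, hAE, hEE, hP.ctr_swap _ (ι R _ (0, φ)), hAE, ρ.semidirectDual_bracket,
      neg_neg, add_zero]
    simp only [← ofPoly_neg, ← ofPoly_add, ← map_neg, ← map_add]
    congr 2
    simp
    abel
  · rintro ⟨x, φ⟩ f
    have e1 : ι R (A × Module.Dual R E) (x, φ) = ι R _ (x, 0) + ι R _ (0, φ) := by
      rw [← map_add]; simp
    rw [e1, hP.ctr_add, ctr_add_cochain, hAf, hEf, add_zero]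
    rfl

/-- Both sides kill base functions, and on a linear function they agree by the definition of the
dual connection. -/
theorem IsLinearPoisson.poisson_secA2 {ρ : Representation L E}
    (hP : IsLinearPoisson ρ.semidirectDual P) (x : A) (e : E) :
    secA2 A (ρ.conn x e) = -poisson (ctr (ι R _ (x, 0)) P) (secA2 A e) := by
  have hm := hP.multivector
  have hd := isMultivector_secA2 (R := R) (A := A) e
  refine field_ext (isMultivector_secA2 _) ((hm.contract _).poisson hd).neg
    (secA2_arity _) (fun n hn => ?_) (fun f => ?_) fun u => ?_
  · rw [Pi.neg_apply, poisson_arity (p := 1) (q := 1) (r := 1) (hm.contract _) hd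
      (ctr_arity hP.arity _) (secA2_arity _) rfl n hn, neg_zero]
  · rw [ctr_neg_cochain, ctr_poisson (hm.contract _) hd, hP.ctr_algebraMap_ι, ctr_secA2_algebraMap,
      ctr_secA2_algebraMap, hd.twist.neg_poisson, ofPoly_poisson_twist hd, ctr_secA2_algebraMap,
      (hm.contract _).poisson_zero, neg_zero, sub_zero, neg_zero]
  · rw [ctr_neg_cochain, ctr_poisson (hm.contract _) hd, hP.ctr_ι_ι, ctr_secA2_ι, ctr_secA2_ι,
      hd.twist.neg_poisson, ofPoly_poisson_twist hd, ctr_secA2_ι, poisson_ofPoly (hm.contract _),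
      hP.ctr_algebraMap_ι, ρ.semidirectDual_bracket, ρ.semidirectDual_anchor,
      ρ.dualConn_zero_right, sub_zero, ρ.dualConn_apply, sub_neg_eq_add,
      ← ofPoly_neg, ← ofPoly_add, ← ofPoly_neg]
    congr 1
    rw [map_sub]
    ring

theorem isStructureFunction_of_isLinearPoisson {ρ : Representation L E}
    (hP : IsLinearPoisson ρ.semidirectDual P) (h1 : HasWeight (projA R A E) (-1) P)
    (h2 : HasWeight (projE R A E) 0 P) : IsStructureFunction ρ.semidirect 0 P 0 where
  tri0 := isTridegree_zero _ _ _
  tri2 := isTridegree_iff.2 ⟨hP.multivector, fun n hn => hP.arity n (by omega), by simpa using h1,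
    by simpa using h2⟩
  tri4 := isTridegree_zero _ _ _
  brackets :=
    { l1 := fun m => by
        rw [secA2, (isMultivector_derivation _).zero_poisson, neg_zero, secA1]
        change ofPoly (ι R _ ((0 : A), (0 : Module.Dual R E))) = 0
        rw [← Prod.zero_eq_mk, map_zero, ofPoly_zero]
      l2 := fun x y => by
        rw [secA1, secA1, secA1, poisson_ofPoly hP.multivector,
          poisson_ofPoly (hP.multivector.contract _), hP.ctr_ι_ι, ρ.semidirectDual_bracket]
        simp [ρ.dualConn_zero_right]
        rfl
      l2m := fun x e => by
        rw [secA1, poisson_ofPoly hP.multivector]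
        exact hP.poisson_secA2 x e
      l3 := fun x y z => by
        rw [secA1, secA1, secA1, (isMultivector_ofPoly (R := R) _).zero_poisson,
          (isMultivector_ofPoly (R := R) _).zero_poisson,
          (isMultivector_ofPoly (R := R) _).zero_poisson, neg_zero]
        exact secA2_zero
      anchor := fun x f => by
        rw [secA1, secR, secR, poisson_ofPoly hP.multivector,
          poisson_ofPoly (hP.multivector.contract _), hP.ctr_algebraMap_ι, neg_neg]
        rfl }

/-- The weights reflect the grading of the bracket: `[A, A] ⊆ A`, `[A, E*] ⊆ E*`, `[E*, E*] = 0`. So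
`projE` is a derivation of it, whereas `projA` lowers the weight by one. -/
theorem exists_isLinearPoisson_semidirectDual (ρ : Representation L E) :
    ∃ P, IsLinearPoisson ρ.semidirectDual P ∧ HasWeight (projA R A E) (-1) P ∧
      HasWeight (projE R A E) 0 P := by
  obtain ⟨P, hP, h0⟩ := exists_linearPoisson ρ.semidirectDual
  refine ⟨P, hP, ?_, ?_⟩
  · refine hasWeight_of_generators hP.multivector hP.arity hP.ctr_ι_ι hP.ctr_algebraMap_ι h0
      (fun u v => ?_) fun u f => ?_
    · simp only [projA_apply, ρ.semidirectDual_bracket, ρ.dualConn_zero_right]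
      ext1 <;> simp
    · simp [projA_apply, ρ.semidirectDual_anchor]
  · refine hasWeight_of_generators hP.multivector hP.arity hP.ctr_ι_ι hP.ctr_algebraMap_ι h0
      (fun u v => ?_) fun u f => ?_
    · simp only [projE_apply, ρ.semidirectDual_bracket, ρ.dualConn_zero_left]
      ext1 <;> simp
    · simp [projE_apply, ρ.semidirectDual_anchor]

end Semidirect

/-! ### The operations on `E*` and `A*`, and the morphism to `𝒜`. -/

section DualAlgebroid

variable {R A E : Type*} [CommRing R] [Algebra ℝ R] [AddCommGroup A] [Module R A]
  [AddCommGroup E] [Module R E] {L : LieAlgebroid R A}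

namespace TriSection

variable (K : TriSection R E)

theorem eval_apply (φ ψ χ : Module.Dual R E) : K.eval φ ψ χ = χ (K.flat φ ψ) := rfl

theorem flat_swap (φ ψ : Module.Dual R E) : K.flat φ ψ = -K.flat ψ φ := by
  have h := K.flat_self (φ + ψ)
  simp only [map_add, LinearMap.add_apply, K.flat_self, zero_add, add_zero] at h
  exact eq_neg_of_add_eq_zero_right h

theorem eval_swap_left (φ ψ χ : Module.Dual R E) : K.eval φ ψ χ = -K.eval ψ φ χ := by
  rw [eval_apply, flat_swap, map_neg, eval_apply]

theorem eval_swap_right (φ ψ χ : Module.Dual R E) : K.eval φ ψ χ = -K.eval φ χ ψ := by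
  have h := K.pair_self φ (ψ + χ)
  simp only [map_add, LinearMap.add_apply, K.pair_self, zero_add, add_zero] at h
  exact eq_neg_of_add_eq_zero_left h

theorem eval_rotate (φ ψ χ : Module.Dual R E) : K.eval φ ψ χ = K.eval χ φ ψ := by
  rw [eval_swap_right, eval_swap_left, neg_neg]

/-- The covariant derivative of `K`. -/
def nabla (ρ : Representation L E) (y : A) (φ ψ χ : Module.Dual R E) : R :=
  L.anchor y (K.eval φ ψ χ) - K.eval (ρ.dualConn y φ) ψ χ - K.eval φ (ρ.dualConn y ψ) χ -
    K.eval φ ψ (ρ.dualConn y χ)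

variable (ρ : Representation L E)

theorem nabla_add_left (x y : A) (φ ψ χ : Module.Dual R E) :
    K.nabla ρ (x + y) φ ψ χ = K.nabla ρ x φ ψ χ + K.nabla ρ y φ ψ χ := by
  simp only [nabla, ρ.dualConn_add_left, eval_apply, map_add, LinearMap.add_apply,
    Derivation.add_apply]
  ring

theorem nabla_swap_left (y : A) (φ ψ χ : Module.Dual R E) :
    K.nabla ρ y φ ψ χ = -K.nabla ρ y ψ φ χ := by
  rw [nabla, nabla, K.eval_swap_left φ, K.eval_swap_left _ ψ, K.eval_swap_left φ,
    K.eval_swap_left φ ψ, map_neg]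
  ring

theorem nabla_swap_right (y : A) (φ ψ χ : Module.Dual R E) :
    K.nabla ρ y φ ψ χ = -K.nabla ρ y φ χ ψ := by
  rw [nabla, nabla, K.eval_swap_right φ ψ χ, K.eval_swap_right _ ψ χ, K.eval_swap_right φ _ χ,
    K.eval_swap_right φ ψ, map_neg]
  ring

theorem nabla_add (y : A) (φ φ' ψ χ : Module.Dual R E) :
    K.nabla ρ y (φ + φ') ψ χ = K.nabla ρ y φ ψ χ + K.nabla ρ y φ' ψ χ := by
  simp only [nabla, ρ.dualConn_add_right, eval_apply, map_add, LinearMap.add_apply]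
  ring

theorem nabla_smul (y : A) (f : R) (φ ψ χ : Module.Dual R E) :
    K.nabla ρ y (f • φ) ψ χ = f * K.nabla ρ y φ ψ χ := by
  simp only [nabla, ρ.dualConn_smul_right, eval_apply, map_add, map_smul, LinearMap.add_apply,
    LinearMap.smul_apply, smul_eq_mul, Derivation.leibniz]
  ring

theorem nabla_rotate (y : A) (φ ψ χ : Module.Dual R E) :
    K.nabla ρ y φ ψ χ = K.nabla ρ y χ φ ψ := by
  rw [nabla_swap_right, nabla_swap_left, neg_neg]

theorem nabla_sub (y : A) (φ φ' ψ χ : Module.Dual R E) :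
    K.nabla ρ y (φ - φ') ψ χ = K.nabla ρ y φ ψ χ - K.nabla ρ y φ' ψ χ := by
  simp only [nabla, ρ.dualConn_sub_right, eval_apply, map_sub, LinearMap.sub_apply]
  ring

theorem nabla_sub_mid (y : A) (φ ψ ψ' χ : Module.Dual R E) :
    K.nabla ρ y φ (ψ - ψ') χ = K.nabla ρ y φ ψ χ - K.nabla ρ y φ ψ' χ := by
  rw [nabla_swap_left, nabla_sub, K.nabla_swap_left ρ y ψ, K.nabla_swap_left ρ y ψ']
  ring

theorem nabla_sub_right (y : A) (φ ψ χ χ' : Module.Dual R E) :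
    K.nabla ρ y φ ψ (χ - χ') = K.nabla ρ y φ ψ χ - K.nabla ρ y φ ψ χ' := by
  rw [nabla_swap_right, nabla_sub_mid, K.nabla_swap_right ρ y φ χ, K.nabla_swap_right ρ y φ χ']
  ring

/-- Flatness of `∇` passes to the induced connection on `∧³E`. -/
theorem nabla_bracket (x y : A) (φ ψ χ : Module.Dual R E) :
    K.nabla ρ (L.bracket x y) φ ψ χ =
      (L.anchor x (K.nabla ρ y φ ψ χ) - K.nabla ρ y (ρ.dualConn x φ) ψ χ -
        K.nabla ρ y φ (ρ.dualConn x ψ) χ - K.nabla ρ y φ ψ (ρ.dualConn x χ)) -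
      (L.anchor y (K.nabla ρ x φ ψ χ) - K.nabla ρ x (ρ.dualConn y φ) ψ χ -
        K.nabla ρ x φ (ρ.dualConn y ψ) χ - K.nabla ρ x φ ψ (ρ.dualConn y χ)) := by
  simp only [nabla, ρ.dualConn_bracket, eval_apply, map_sub, LinearMap.sub_apply,
    L.anchor_bracket, Derivation.commutator_apply]
  ring

end TriSection

variable (ρ : Representation L E) (H : SymSection R A E)

/-- The condition `[H^♯ φ, H^♯ ψ] = H^♯ [φ, ψ]_H`. -/
def SymSection.IsCompatible : Prop := ∀ φ ψ, L.bracket (H.sharp φ) (H.sharp ψ) =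
  H.sharp (ρ.dualConn (H.sharp φ) ψ - ρ.dualConn (H.sharp ψ) φ)

/-- The action of `E*` on `A` induced by `H`. -/
def SymSection.act (φ : Module.Dual R E) (y : A) : A :=
  L.bracket (H.sharp φ) y + H.sharp (ρ.dualConn y φ)

/-- The operation `l₂^H` on `E* × A*`. -/
def SymSection.coact (φ : Module.Dual R E) (β : Module.Dual R A) : Module.Dual R A :=
  L.lieDer (H.sharp φ) β + ρ.pairConn (H.nat β) φ - L.d0 (H.eval φ β)

variable {ρ H}

/-- Transposing `H♮` into `H♯` absorbs the exact term and exhibits `coact` as the dual of `act`;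
every property of `coact` below is read off from this form. -/
theorem SymSection.coact_apply (φ : Module.Dual R E) (β : Module.Dual R A) (y : A) :
    H.coact ρ φ β y = L.anchor (H.sharp φ) (β y) - β (H.act ρ φ y) := by
  have h1 : φ (ρ.conn y (H.nat β)) = L.anchor y (β (H.sharp φ)) - β (H.sharp (ρ.dualConn y φ)) := by
    rw [← H.transpose, ← H.transpose, ρ.dualConn_apply]
    ring
  change L.anchor (H.sharp φ) (β y) - β (L.bracket (H.sharp φ) y) + φ (ρ.conn y (H.nat β)) -
    L.anchor y (β (H.sharp φ)) = _
  rw [h1, act, map_add]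
  ring

/-- The Lie algebroid structure on `E*` induced by `H`. -/
def dualLieAlgebroid (hH : H.IsCompatible ρ) : LieAlgebroid R (Module.Dual R E) where
  bracket := ρ.dualConnHom.comp H.sharp.toAddMonoidHom -
    (ρ.dualConnHom.comp H.sharp.toAddMonoidHom).flip
  anchor := L.anchor ∘ₗ H.sharp
  bracket_self φ := sub_self _
  jacobi φ ψ χ := by
    change ρ.dualConn (H.sharp φ) (ρ.dualConn (H.sharp ψ) χ - ρ.dualConn (H.sharp χ) ψ) -
      ρ.dualConn (H.sharp (ρ.dualConn (H.sharp ψ) χ - ρ.dualConn (H.sharp χ) ψ)) φ =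
      (ρ.dualConn (H.sharp (ρ.dualConn (H.sharp φ) ψ - ρ.dualConn (H.sharp ψ) φ)) χ -
        ρ.dualConn (H.sharp χ) (ρ.dualConn (H.sharp φ) ψ - ρ.dualConn (H.sharp ψ) φ)) +
      (ρ.dualConn (H.sharp ψ) (ρ.dualConn (H.sharp φ) χ - ρ.dualConn (H.sharp χ) φ) -
        ρ.dualConn (H.sharp (ρ.dualConn (H.sharp φ) χ - ρ.dualConn (H.sharp χ) φ)) ψ)
    simp only [← hH _ _, ρ.dualConn_bracket, ρ.dualConn_sub_right]
    abel
  leibniz φ f ψ := by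
    change ρ.dualConn (H.sharp φ) (f • ψ) - ρ.dualConn (H.sharp (f • ψ)) φ =
      f • (ρ.dualConn (H.sharp φ) ψ - ρ.dualConn (H.sharp ψ) φ) + L.anchor (H.sharp φ) f • ψ
    rw [map_smul, ρ.dualConn_smul_right, ρ.dualConn_smul_left, smul_sub]
    abel
  anchor_bracket φ ψ := by
    change L.anchor (H.sharp (ρ.dualConn (H.sharp φ) ψ - ρ.dualConn (H.sharp ψ) φ)) = _
    rw [← hH, L.anchor_bracket]
    rfl

theorem dualLieAlgebroid_bracket (hH : H.IsCompatible ρ) (φ ψ : Module.Dual R E) :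
    (dualLieAlgebroid hH).bracket φ ψ =
      ρ.dualConn (H.sharp φ) ψ - ρ.dualConn (H.sharp ψ) φ := rfl

theorem dualLieAlgebroid_anchor (hH : H.IsCompatible ρ) (φ : Module.Dual R E) :
    (dualLieAlgebroid hH).anchor φ = L.anchor (H.sharp φ) := rfl

/-- The bracket on `E*` is the skew part of the connection `∇*_{H♯φ} ψ`, that is, this connection is
torsion-free; hence the differential is the alternated covariant derivative. -/
theorem d3_eq_nabla (hH : H.IsCompatible ρ) (K : TriSection R E) (φ ψ χ ζ : Module.Dual R E) :
    (dualLieAlgebroid hH).d3 K.eval φ ψ χ ζ =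
      K.nabla ρ (H.sharp φ) ψ χ ζ - K.nabla ρ (H.sharp ψ) φ χ ζ +
        K.nabla ρ (H.sharp χ) φ ψ ζ - K.nabla ρ (H.sharp ζ) φ ψ χ := by
  have hsub : ∀ a b c d, K.eval (a - b) c d = K.eval a c d - K.eval b c d := fun a b c d => by
    simp only [K.eval_apply, map_sub, LinearMap.sub_apply]
  simp only [LieAlgebroid.d3, dualLieAlgebroid_bracket, dualLieAlgebroid_anchor, hsub,
    TriSection.nabla]
  rw [K.eval_swap_left ψ (ρ.dualConn (H.sharp φ) χ) ζ, K.eval_rotate ψ χ (ρ.dualConn (H.sharp φ) ζ),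
    K.eval_swap_left φ (ρ.dualConn (H.sharp ψ) χ) ζ, K.eval_rotate φ χ (ρ.dualConn (H.sharp ψ) ζ),
    K.eval_swap_left φ (ρ.dualConn (H.sharp χ) ψ) ζ, K.eval_rotate φ ψ (ρ.dualConn (H.sharp χ) ζ),
    K.eval_swap_left φ (ρ.dualConn (H.sharp ζ) ψ) χ, K.eval_rotate φ ψ (ρ.dualConn (H.sharp ζ) χ)]
  ring

/-- Compatibility turns each bracket of two values of `H♯` into a value of `H♯`. What remains is the
Jacobi identity of `A` and the flatness of `∇*`. -/
theorem SymSection.act_act (hH : H.IsCompatible ρ) (φ ψ : Module.Dual R E) (y : A) :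
    H.act ρ ((dualLieAlgebroid hH).bracket φ ψ) y =
      H.act ρ φ (H.act ρ ψ y) - H.act ρ ψ (H.act ρ φ y) := by
  have key : ∀ φ ψ, H.act ρ φ (H.act ρ ψ y) = L.bracket (H.sharp φ) (L.bracket (H.sharp ψ) y) +
      H.sharp (ρ.dualConn (H.sharp φ) (ρ.dualConn y ψ)) +
      H.sharp (ρ.dualConn (L.bracket (H.sharp ψ) y) φ) := by
    intro φ ψ
    simp only [act, map_add, hH _ _, ρ.dualConn_add_left, map_sub]
    abel
  rw [key, key, dualLieAlgebroid_bracket, act, ← hH, L.bracket_skew, L.jacobi y,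
    L.bracket_skew y, L.bracket_skew y, ρ.dualConn_sub_right]
  simp only [ρ.dualConn_bracket, map_neg, AddMonoidHom.neg_apply, map_sub]
  rw [L.bracket_skew (L.bracket (H.sharp φ) y) (H.sharp ψ)]
  abel

theorem SymSection.coact_coact (hH : H.IsCompatible ρ) (φ ψ : Module.Dual R E)
    (β : Module.Dual R A) : H.coact ρ ((dualLieAlgebroid hH).bracket φ ψ) β =
      H.coact ρ φ (H.coact ρ ψ β) - H.coact ρ ψ (H.coact ρ φ β) := by
  ext y
  rw [LinearMap.sub_apply, coact_apply, act_act hH, dualLieAlgebroid_bracket, ← hH,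
    L.anchor_bracket, Derivation.commutator_apply]
  simp only [coact_apply, map_sub]
  ring

theorem SymSection.coact_add_left (φ ψ : Module.Dual R E) (β : Module.Dual R A) :
    H.coact ρ (φ + ψ) β = H.coact ρ φ β + H.coact ρ ψ β := by
  ext y
  simp only [LinearMap.add_apply, coact_apply, act, map_add, AddMonoidHom.add_apply,
    ρ.dualConn_add_right, Derivation.add_apply]
  ring

theorem SymSection.coact_add_right (φ : Module.Dual R E) (β γ : Module.Dual R A) :
    H.coact ρ φ (β + γ) = H.coact ρ φ β + H.coact ρ φ γ := by
  ext y
  simp only [LinearMap.add_apply, coact_apply, map_add]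
  ring

theorem SymSection.coact_smul_right (φ : Module.Dual R E) (f : R) (β : Module.Dual R A) :
    H.coact ρ φ (f • β) = f • H.coact ρ φ β + L.anchor (H.sharp φ) f • β := by
  ext y
  simp only [LinearMap.add_apply, LinearMap.smul_apply, coact_apply, smul_eq_mul,
    Derivation.leibniz]
  ring

theorem SymSection.coact_smul_left (f : R) (φ : Module.Dual R E) (β : Module.Dual R A) :
    H.coact ρ (f • φ) β = f • H.coact ρ φ β := by
  ext y
  simp only [LinearMap.smul_apply, coact_apply, act, smul_eq_mul, map_smul, Derivation.smul_apply,
    ρ.dualConn_smul_right, map_add]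
  rw [L.bracket_skew, L.leibniz, L.bracket_skew y]
  simp only [map_neg, map_add, map_smul, smul_eq_mul]
  ring

/-- The section `⟨∇_· K^♭(φ, ψ), χ⟩ + c.p. - 2 d(K(φ, ψ, χ))` of `A*`. -/
def TriSection.coderiv (ρ : Representation L E) (K : TriSection R E) (φ ψ χ : Module.Dual R E) :
    Module.Dual R A :=
  ρ.pairConn (K.flat φ ψ) χ + ρ.pairConn (K.flat χ φ) ψ + ρ.pairConn (K.flat ψ χ) φ
    - (2 : ℕ) • L.d0 (K.eval φ ψ χ)

/-- Each of the three pairings equals `a(y) K(φ, ψ, χ)` minus the term in which one argument is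
differentiated. The sum contains the first term three times, and `-2 d K(φ, ψ, χ)` leaves one copy,
as in the covariant derivative. -/
theorem TriSection.coderiv_apply (K : TriSection R E) (φ ψ χ : Module.Dual R E) (y : A) :
    K.coderiv ρ φ ψ χ y = K.nabla ρ y φ ψ χ := by
  have key : ∀ φ ψ χ : Module.Dual R E, χ (ρ.conn y (K.flat φ ψ)) =
      L.anchor y (K.eval φ ψ χ) - K.eval φ ψ (ρ.dualConn y χ) := by
    intro φ ψ χ
    rw [K.eval_apply, K.eval_apply, ρ.dualConn_apply]
    ring
  change χ (ρ.conn y (K.flat φ ψ)) + ψ (ρ.conn y (K.flat χ φ)) + φ (ρ.conn y (K.flat ψ χ)) -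
    (2 : ℕ) • L.anchor y (K.eval φ ψ χ) = _
  rw [key, key, key, nabla, K.eval_swap_left χ φ ψ, K.eval_swap_right φ χ ψ,
    K.eval_swap_right ψ χ φ, K.eval_swap_left ψ φ χ, K.eval_swap_left χ φ, K.eval_swap_right φ χ,
    K.eval_swap_right ψ χ, K.eval_swap_left ψ (ρ.dualConn y φ)]
  simp only [neg_neg, nsmul_eq_mul, Nat.cast_ofNat]
  ring

/-- The operation `l₃^{H,K}`. -/
def TriSection.alternating (ρ : Representation L E) (K : TriSection R E) :
    Module.Dual R E [⋀^Fin 3]→ₗ[R] Module.Dual R A where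
  toFun v := K.coderiv ρ (v 0) (v 1) (v 2)
  map_update_add' v i φ ψ := by
    ext y
    obtain rfl | rfl | rfl : i = 0 ∨ i = 1 ∨ i = 2 := by omega
    all_goals simp only [LinearMap.add_apply, coderiv_apply, Function.update_self,
      Function.update_of_ne (show (0 : Fin 3) ≠ 1 by omega),
      Function.update_of_ne (show (0 : Fin 3) ≠ 2 by omega),
      Function.update_of_ne (show (1 : Fin 3) ≠ 0 by omega),
      Function.update_of_ne (show (1 : Fin 3) ≠ 2 by omega),
      Function.update_of_ne (show (2 : Fin 3) ≠ 0 by omega),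
      Function.update_of_ne (show (2 : Fin 3) ≠ 1 by omega)]
    · exact K.nabla_add ρ y φ ψ (v 1) (v 2)
    · simpa only [K.nabla_rotate ρ y _ (v 2) (v 0)] using K.nabla_add ρ y φ ψ (v 2) (v 0)
    · simpa only [K.nabla_rotate ρ y (v 0) (v 1)] using K.nabla_add ρ y φ ψ (v 0) (v 1)
  map_update_smul' v i f φ := by
    ext y
    obtain rfl | rfl | rfl : i = 0 ∨ i = 1 ∨ i = 2 := by omega
    all_goals simp only [LinearMap.smul_apply, smul_eq_mul, coderiv_apply, Function.update_self,
      Function.update_of_ne (show (0 : Fin 3) ≠ 1 by omega),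
      Function.update_of_ne (show (0 : Fin 3) ≠ 2 by omega),
      Function.update_of_ne (show (1 : Fin 3) ≠ 0 by omega),
      Function.update_of_ne (show (1 : Fin 3) ≠ 2 by omega),
      Function.update_of_ne (show (2 : Fin 3) ≠ 0 by omega),
      Function.update_of_ne (show (2 : Fin 3) ≠ 1 by omega)]
    · exact K.nabla_smul ρ y f φ (v 1) (v 2)
    · simpa only [K.nabla_rotate ρ y _ (v 2) (v 0)] using K.nabla_smul ρ y f φ (v 2) (v 0)
    · simpa only [K.nabla_rotate ρ y (v 0) (v 1)] using K.nabla_smul ρ y f φ (v 0) (v 1)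
  map_eq_zero_of_eq' v i j h hij := by
    ext y
    have h0 : ∀ φ ψ, K.nabla ρ y φ φ ψ = 0 := by
      intro φ ψ
      have hf := fun χ ψ => K.eval_swap_left (ρ.dualConn y χ) χ ψ
      have h1 : ∀ ψ, K.eval φ φ ψ = 0 := fun ψ => by rw [K.eval_apply, K.flat_self, map_zero]
      rw [nabla, hf, h1, h1, map_zero]
      ring
    rw [coderiv_apply, LinearMap.zero_apply]
    obtain rfl | rfl | rfl : i = 0 ∨ i = 1 ∨ i = 2 := by omega
    all_goals obtain rfl | rfl | rfl : j = 0 ∨ j = 1 ∨ j = 2 := by omega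
    all_goals first
      | exact absurd rfl hij
      | rw [h, h0]
      | rw [h, nabla_rotate, h0]
      | rw [h, nabla_rotate, nabla_rotate, h0]

theorem TriSection.alternating_apply (K : TriSection R E) (φ ψ χ : Module.Dual R E) (y : A) :
    K.alternating ρ ![φ, ψ, χ] y = K.nabla ρ y φ ψ χ := K.coderiv_apply φ ψ χ y

/-- The left side is the Jacobiator at `y`, and it equals the covariant derivative along `y` of the
4-form `dK`: differentiate `dK(φ, ψ, χ, ζ)` by `a(y)`, subtract `dK` with each argument in turn
replaced by its `∇*_y`, and use `nabla_bracket` for the directions `[H♯φ, y]`. -/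
theorem nabla_act_closed (hH : H.IsCompatible ρ) (K : TriSection R E)
    (hK : ∀ φ ψ χ ζ, (dualLieAlgebroid hH).d3 K.eval φ ψ χ ζ = 0) (y : A)
    (φ ψ χ ζ : Module.Dual R E) :
    (L.anchor (H.sharp φ) (K.nabla ρ y ψ χ ζ) - K.nabla ρ (H.act ρ φ y) ψ χ ζ) -
    (L.anchor (H.sharp ψ) (K.nabla ρ y φ χ ζ) - K.nabla ρ (H.act ρ ψ y) φ χ ζ) +
    (L.anchor (H.sharp χ) (K.nabla ρ y φ ψ ζ) - K.nabla ρ (H.act ρ χ y) φ ψ ζ) -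
    (L.anchor (H.sharp ζ) (K.nabla ρ y φ ψ χ) - K.nabla ρ (H.act ρ ζ y) φ ψ χ) -
    K.nabla ρ y ((dualLieAlgebroid hH).bracket φ ψ) χ ζ -
    K.nabla ρ y ψ ((dualLieAlgebroid hH).bracket φ χ) ζ -
    K.nabla ρ y ψ χ ((dualLieAlgebroid hH).bracket φ ζ) +
    K.nabla ρ y φ ((dualLieAlgebroid hH).bracket ψ χ) ζ +
    K.nabla ρ y φ χ ((dualLieAlgebroid hH).bracket ψ ζ) -
    K.nabla ρ y φ ψ ((dualLieAlgebroid hH).bracket χ ζ) = 0 := by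
  simp only [d3_eq_nabla] at hK
  have hy := congr(L.anchor y $(hK φ ψ χ ζ))
  simp only [map_add, map_sub, map_zero] at hy
  simp only [SymSection.act, K.nabla_add_left, K.nabla_bracket, dualLieAlgebroid_bracket,
    K.nabla_sub, K.nabla_sub_mid, K.nabla_sub_right]
  have e1 := K.nabla_swap_left ρ y (ρ.dualConn (H.sharp χ) φ) ψ ζ
  have e2 := K.nabla_rotate ρ y ψ χ (ρ.dualConn (H.sharp ζ) φ)
  have e3 := K.nabla_rotate ρ y φ χ (ρ.dualConn (H.sharp ζ) ψ)
  have e4 := K.nabla_swap_left ρ y φ (ρ.dualConn (H.sharp ζ) ψ) χ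
  linear_combination hy - hK (ρ.dualConn y φ) ψ χ ζ - hK φ (ρ.dualConn y ψ) χ ζ -
    hK φ ψ (ρ.dualConn y χ) ζ - hK φ ψ χ (ρ.dualConn y ζ) + e1 + e2 - e3 - e4

/-- The split Lie 2-algebroid structure on `(A*, E*)` induced by `H` and `K`. -/
def dualSplitLie2Algebroid (hH : H.IsCompatible ρ) (K : TriSection R E)
    (hK : ∀ φ ψ χ ζ, (dualLieAlgebroid hH).d3 K.eval φ ψ χ ζ = 0) :
    SplitLie2Algebroid R (Module.Dual R E) (Module.Dual R A) where
  l1 := 0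
  l2 := (dualLieAlgebroid hH).bracket
  l2m := AddMonoidHom.mk' (fun φ => AddMonoidHom.mk' (H.coact ρ φ) (H.coact_add_right φ))
    fun φ ψ => by ext1 β; exact H.coact_add_left φ ψ β
  l3 := K.alternating ρ
  anchor := L.anchor ∘ₗ H.sharp
  l2_self := (dualLieAlgebroid hH).bracket_self
  l1_l2m φ β := by simp
  l2m_l1 β γ := by
    rw [LinearMap.zero_apply, LinearMap.zero_apply, map_zero]
    exact neg_zero.symm
  l1_l3 φ ψ χ := by simp [(dualLieAlgebroid hH).jacobi φ ψ χ]
  l3_l1 φ ψ β := by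
    change K.alternating ρ ![φ, ψ, 0] = H.coact ρ φ (H.coact ρ ψ β) -
      H.coact ρ ((dualLieAlgebroid hH).bracket φ ψ) β - H.coact ρ ψ (H.coact ρ φ β)
    rw [H.coact_coact hH, AlternatingMap.map_coord_zero (K.alternating ρ) 2 rfl]
    abel
  jacobiator φ ψ χ ζ := by
    ext y
    have h := nabla_act_closed hH K hK y φ ψ χ ζ
    simpa only [← K.alternating_apply, ← H.coact_apply, AddMonoidHom.mk'_apply,
      LinearMap.sub_apply, LinearMap.add_apply, LinearMap.zero_apply] using h
  leibniz := (dualLieAlgebroid hH).leibniz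
  leibniz_m φ f β := H.coact_smul_right φ f β
  l2m_smul f φ β := H.coact_smul_left f φ β

/-- Compatibility of `H♯` gives the equation on `E* × E*`, its transpose the one on `E* × A*`, and
`dK = 0` the one on three sections. The last two are equations in `E`, and `hE` allows them to be
checked after pairing with `E*`. -/
theorem isMorphism_dualSplitLie2Algebroid (hH : H.IsCompatible ρ) (K : TriSection R E)
    (hK : ∀ φ ψ χ ζ, (dualLieAlgebroid hH).d3 K.eval φ ψ χ ζ = 0)
    (hE : ∀ e : E, (∀ φ : Module.Dual R E, φ e = 0) → e = 0) :
    IsMorphism (dualSplitLie2Algebroid hH K hK) ρ.semidirect H.sharp (-H.nat) (-K.flat) where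
  F3_self φ := by simp [K.flat_self]
  anchor φ := rfl
  comm β := by
    change H.sharp 0 = 0
    exact map_zero _
  l2 φ ψ := by
    change H.sharp (ρ.dualConn (H.sharp φ) ψ - ρ.dualConn (H.sharp ψ) φ) -
      L.bracket (H.sharp φ) (H.sharp ψ) = 0
    rw [hH, sub_self]
  l2m φ β := by
    change -H.nat (H.coact ρ φ β) - ρ.conn (H.sharp φ) (-H.nat β) = -K.flat φ 0
    refine sub_eq_zero.1 (hE _ fun ψ => ?_)
    simp only [map_neg, map_zero, neg_zero, sub_zero, sub_neg_eq_add, H.transpose,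
      SymSection.coact_apply, SymSection.act, map_add]
    have h1 : ψ (ρ.conn (H.sharp φ) (H.nat β)) =
        L.anchor (H.sharp φ) (β (H.sharp ψ)) - β (H.sharp (ρ.dualConn (H.sharp φ) ψ)) := by
      rw [← H.transpose, ← H.transpose, ρ.dualConn_apply]
      ring
    rw [h1, hH, map_sub, map_sub]
    ring
  l3 φ ψ χ := by
    change -(-H.nat (K.coderiv ρ φ ψ χ)) + ρ.conn (H.sharp φ) (-K.flat ψ χ) -
      ρ.conn (H.sharp ψ) (-K.flat φ χ) + ρ.conn (H.sharp χ) (-K.flat φ ψ) -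
      (-K.flat ((dualLieAlgebroid hH).bracket φ ψ) χ) +
      (-K.flat φ ((dualLieAlgebroid hH).bracket ψ χ)) -
      (-K.flat ψ ((dualLieAlgebroid hH).bracket φ χ)) + 0 = 0
    refine hE _ fun ζ => ?_
    have key : ∀ φ ψ χ : Module.Dual R E, ζ (ρ.conn (H.sharp φ) (K.flat ψ χ)) =
        L.anchor (H.sharp φ) (K.eval ψ χ ζ) - K.eval ψ χ (ρ.dualConn (H.sharp φ) ζ) := by
      intro φ ψ χ
      rw [K.eval_apply, K.eval_apply, ρ.dualConn_apply]
      ring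
    have h := hK φ ψ χ ζ
    rw [d3_eq_nabla] at h
    have h1 := K.eval_swap_left (ρ.dualConn (H.sharp χ) φ) ψ ζ
    simp only [TriSection.nabla] at h
    simp only [map_neg, map_sub, map_add, LinearMap.sub_apply, H.transpose,
      TriSection.coderiv_apply, key, add_zero, neg_neg, sub_neg_eq_add,
      dualLieAlgebroid_bracket, ← K.eval_apply, TriSection.nabla]
    linear_combination -h - h1

end DualAlgebroid

/-! ### Brackets of linear bivector fields with linear vector fields and constant trivector fields.
-/

section Generators

open SymmetricAlgebra

variable {R V : Type*} [CommRing R] [Algebra ℝ R] [AddCommGroup V] [Module R V]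
  {T N : Cochain (SymmetricAlgebra R V)}

theorem eq_zero_of_leibniz {F : SymmetricAlgebra R V → SymmetricAlgebra R V}
    (hadd : ∀ s t, F (s + t) = F s + F t) (hmul : ∀ s t, F (s * t) = s * F t + t * F s)
    (hr : ∀ r, F (algebraMap R _ r) = 0) (hv : ∀ v, F (ι R V v) = 0) (s) : F s = 0 := by
  induction s using SymmetricAlgebra.induction with
  | algebraMap r => exact hr r
  | ι v => exact hv v
  | mul a b ha hb => rw [hmul, ha, hb, mul_zero, mul_zero, add_zero]
  | add a b ha hb => rw [hadd, ha, hb, add_zero]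

theorem hasWeight_derivation {p : V →ₗ[R] V} {w : ℤ}
    {D : Derivation R (SymmetricAlgebra R V) (SymmetricAlgebra R V)}
    (h : ∀ v, euler p (D (ι R V v)) - D (ι R V (p v)) = w • D (ι R V v)) :
    HasWeight p w (ofField D) := by
  have hD : IsMultivector R (ofField D) := isMultivector_derivation D
  have hE := isMultivector_euler p
  have hc : ∀ g, ctr g (poisson (ofField (euler p)) (ofField D)) =
      ofPoly (euler p (D g) - D (euler p g)) := fun g => by
    rw [ctr_ofField_poisson hE hD, ctr_ofField, ofField_poisson_ofPoly hE, ctr_ofField,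
      sub_eq_add_neg, sub_eq_add_neg, ofPoly_add, ofPoly_neg]
  refine field_ext (hE.poisson hD) (hD.zsmul w)
    (poisson_arity hE hD (ofField_arity _) (ofField_arity _) rfl) (fun n hn => ?_)
    (fun f => ?_) fun v => ?_
  · rw [Pi.smul_apply, ofField_arity _ n hn, smul_zero]
  · rw [hc, ctr_zsmul_cochain, ctr_ofField]
    simp [ofPoly_zero]
  · rw [hc, ctr_zsmul_cochain, ctr_ofField, euler_ι, h]
    funext n x
    rcases n with _ | n <;> simp [ofPoly]

/-- `T` is the linear bivector field of the bracket `b` and the anchor `a`. -/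
structure GeneratesBracket (T : Cochain (SymmetricAlgebra R V)) (b : V → V → V)
    (a : V → R → R) : Prop where
  bracket : ∀ u v, ctr (ι R V v) (ctr (ι R V u) T) = -ofPoly (ι R V (b u v))
  anchor : ∀ u f, ctr (algebraMap R _ f) (ctr (ι R V u) T) = -ofPoly (algebraMap R _ (a u f))

/-- The linear vector field of an endomorphism. -/
def linearField (S : V →ₗ[R] V) : Cochain (SymmetricAlgebra R V) := ofField (euler S)

theorem isMultivector_linearField (S : V →ₗ[R] V) : IsMultivector R (linearField S) :=
  isMultivector_euler S

theorem hasParity_linearField (S : V →ₗ[R] V) : HasParity 1 (linearField S) :=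
  hasParity_ofField _

theorem ctr_ctr_poisson_linearField (hT : IsMultivector R T) (S : V →ₗ[R] V)
    {g h s : SymmetricAlgebra R V} (hs : ctr h (ctr g T) = ofPoly s) :
    ctr h (ctr g (poisson T (linearField S))) =
      ctr h (ctr (euler S g) T) + ctr (euler S h) (ctr g T) - ofPoly (euler S s) := by
  have hS := isMultivector_linearField S
  have hSp := hasParity_linearField S
  rw [ctr_poisson_of_hasParity hSp hT hS, ctr_sub_cochain, ctr_zsmul_cochain,
    ctr_poisson_of_hasParity hSp (hT.contract _) hS, hs, ofPoly_poisson hS, linearField,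
    ctr_ofField, ctr_ofField, ctr_ofField, poisson_ofPoly hT, poisson_ofPoly (hT.contract _),
    (hasParity_ofPoly _).twist_eq]
  module

/-- The Lie derivative of the bivector along the linear field of `S` deforms bracket and anchor by
`S`. No antisymmetry or Jacobi identity for `b` is assumed, so the deformation can be iterated. -/
theorem GeneratesBracket.poisson_linearField {b : V → V → V} {a : V → R → R}
    (h : GeneratesBracket T b a) (hT : IsMultivector R T) (S : V →ₗ[R] V) :
    GeneratesBracket (poisson T (linearField S))
      (fun u v => b (S u) v + b u (S v) - S (b u v)) fun u f => a (S u) f where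
  bracket u v := by
    rw [ctr_ctr_poisson_linearField hT S ((h.bracket u v).trans (ofPoly_neg _).symm), euler_ι,
      euler_ι, h.bracket, h.bracket, map_neg, euler_ι]
    simp only [map_add, map_neg, ofPoly_add, ofPoly_neg, sub_eq_add_neg]
    abel
  anchor u f := by
    rw [ctr_ctr_poisson_linearField hT S ((h.anchor u f).trans (ofPoly_neg _).symm), euler_ι,
      h.anchor, map_neg, Derivation.map_algebraMap, Derivation.map_algebraMap,
      (hT.contract _).ctr_zero, neg_zero, ofPoly_zero, add_zero, sub_zero]

theorem ctr_poisson_of_ctr (hT : IsMultivector R T) (hN : IsMultivector R N)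
    {g s : SymmetricAlgebra R V} (hs : ctr g T = -ofPoly s) :
    ctr g (poisson T N) = poisson T (ctr g N) + ctr s N := by
  rw [ctr_poisson hT hN, hs, hN.twist.neg_poisson, ofPoly_poisson_twist hN, sub_neg_eq_add]

/-- The bracket of a linear bivector field with a constant trivector field. -/
theorem GeneratesBracket.poisson_const {b : V → V → V} {a : V → R → R}
    (h : GeneratesBracket T b a) (hT : IsMultivector R T) (hN : IsMultivector R N)
    (hNp : HasParity 1 N) {k : V → V → V → R}
    (hk : ∀ u v w, ctr (ι R V w) (ctr (ι R V v) (ctr (ι R V u) N)) =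
      -ofPoly (algebraMap R _ (k u v w))) (u v w z : V) :
    ctr (ι R V z) (ctr (ι R V w) (ctr (ι R V v) (ctr (ι R V u) (poisson T N)))) =
      ofPoly (algebraMap R _ (a u (k v w z) - a v (k u w z) + a w (k u v z) - a z (k u v w) -
        k (b u v) w z - k v (b u w) z - k v w (b u z) + k u (b v w) z + k u w (b v z) -
        k u v (b w z))) := by
  have hfield : ∀ u v w z, ctr (ι R V z) (poisson (ctr (ι R V u) T)
      (ctr (ι R V w) (ctr (ι R V v) N))) =
        ofPoly (algebraMap R _ (a u (k v w z) - k v w (b u z))) := by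
    intro u v w z
    rw [ctr_poisson_of_ctr (hT.contract _) ((hN.contract _).contract _) (h.bracket u z), hk, hk,
      (hT.contract _).poisson_neg, poisson_ofPoly (hT.contract _), h.anchor, neg_neg,
      ← sub_eq_add_neg, map_sub, sub_eq_add_neg, sub_eq_add_neg, ofPoly_add, ofPoly_neg]
  -- Each contraction either enters `N` or turns `T` into a vector field. A contraction of that
  -- field is a function: a linear one gives a term `k(b(·,·), ·, ·)`, and one with a value of `N`
  -- gives an anchor term.
  have h1 := ctr_poisson_of_hasParity hNp hT hN (ι R V u)
  have h2 := ctr_poisson_of_hasParity (hNp.contract (ι R V u)) hT (hN.contract _) (ι R V v)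
  have h3 := ctr_poisson_of_hasParity ((hNp.contract (ι R V u)).contract (ι R V v)) hT
    ((hN.contract _).contract _) (ι R V w)
  have hbi : ∀ u v w, ctr (ι R V w) (poisson (ctr (ι R V u) T) (ctr (ι R V v) N)) =
      poisson (ctr (ι R V u) T) (ctr (ι R V w) (ctr (ι R V v) N)) +
        ctr (ι R V (b u w)) (ctr (ι R V v) N) := fun u v w =>
    ctr_poisson_of_ctr (hT.contract _) (hN.contract _) (h.bracket u w)
  have htri := ctr_poisson_of_ctr (hT.contract _) hN (h.bracket u v)
  rw [hk, hT.poisson_neg, poisson_ofPoly hT] at h3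
  rw [h1]
  simp only [ctr_sub_cochain, ctr_add_cochain, ctr_zsmul_cochain, htri, h2, h3, hbi, hfield, hk,
    ctr_neg_cochain]
  rw [hT.ctr_swap, h.anchor]
  simp only [map_add, map_neg, sub_eq_add_neg, ofPoly_add, ofPoly_neg]
  module

end Generators

/-! ### `H` and `K` as multivector fields, with their weights. -/

section Tensors

open SymmetricAlgebra

variable {R A E : Type*} [CommRing R] [Algebra ℝ R] [AddCommGroup A] [Module R A]
  [AddCommGroup E] [Module R E] {L : LieAlgebroid R A}

namespace SymSection

variable (H : SymSection R A E)

/-- The endomorphism `(x, φ) ↦ (H^♯ φ, 0)` of `A ⊕ E*`. -/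
def toEnd : (A × Module.Dual R E) →ₗ[R] A × Module.Dual R E :=
  LinearMap.inl R A (Module.Dual R E) ∘ₗ H.sharp ∘ₗ LinearMap.snd R A (Module.Dual R E)

theorem toEnd_apply (u : A × Module.Dual R E) : H.toEnd u = (H.sharp u.2, 0) := rfl

theorem fn_eq : H.fn = linearField H.toEnd := rfl

theorem isMultivector_fn : IsMultivector R H.fn := isMultivector_derivation _

theorem hasParity_fn : HasParity 1 H.fn := hasParity_ofField _

theorem hasWeight_projA_fn : HasWeight (projA R A E) 1 H.fn := hasWeight_derivation fun v => by
  rw [← toEnd, ← euler, euler_ι, euler_ι, euler_ι, toEnd_apply, toEnd_apply, projA_apply, projA_apply]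
  simp [ι_zero_zero]

theorem hasWeight_projE_fn : HasWeight (projE R A E) (-1) H.fn := hasWeight_derivation fun v => by
  rw [← toEnd, ← euler, euler_ι, euler_ι, euler_ι, toEnd_apply, toEnd_apply, projE_apply, projE_apply]
  simp [ι_zero_zero]

end SymSection

namespace TriSection

variable (K : TriSection R E)

theorem triDer_ι (u v w : A × Module.Dual R E) :
    K.triDer A (ι R _ u) (ι R _ v) (ι R _ w) = algebraMap R _ (K.eval u.2 v.2 w.2) := by
  rw [triDer, derLift_ι]
  change derLift (derLift ∘ₗ (K.trilin A u)) (ι R _ v) (ι R _ w) = _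
  rw [derLift_ι]
  change derLift (K.trilin A u v) (ι R _ w) = _
  rw [derLift_ι]
  rfl

/-- The sum is a derivation in each argument, so three reductions to generators bring it down to the
antisymmetry of `K`. -/
theorem triDer_swap_right (a b c : Poly R A E) : K.triDer A a b c + K.triDer A a c b = 0 := by
  refine eq_zero_of_leibniz (F := fun c => K.triDer A a b c + K.triDer A a c b) (fun s t => ?_)
    (fun s t => ?_) (fun r => ?_) (fun w => ?_) c
  · simp only [map_add, Derivation.add_apply]; ring
  · simp only [Derivation.leibniz, Derivation.add_apply, Derivation.smul_apply, smul_eq_mul]; ring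
  · simp
  refine eq_zero_of_leibniz (F := fun b => K.triDer A a b (ι R _ w) + K.triDer A a (ι R _ w) b)
    (fun s t => ?_) (fun s t => ?_) (fun r => ?_) (fun v => ?_) b
  · simp only [map_add, Derivation.add_apply]; ring
  · simp only [Derivation.leibniz, Derivation.add_apply, Derivation.smul_apply, smul_eq_mul]; ring
  · simp
  refine eq_zero_of_leibniz (F := fun a => K.triDer A a (ι R _ v) (ι R _ w) +
    K.triDer A a (ι R _ w) (ι R _ v)) (fun s t => ?_) (fun s t => ?_) (fun r => ?_) (fun u => ?_) a
  · simp only [map_add, Derivation.add_apply]; ring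
  · simp only [Derivation.leibniz, Derivation.add_apply, Derivation.smul_apply, smul_eq_mul]; ring
  · simp
  · rw [triDer_ι, triDer_ι, K.eval_swap_right, map_neg, neg_add_cancel]

theorem triDer_swap_left (a b c : Poly R A E) : K.triDer A a b c + K.triDer A b a c = 0 := by
  refine eq_zero_of_leibniz (F := fun c => K.triDer A a b c + K.triDer A b a c) (fun s t => ?_)
    (fun s t => ?_) (fun r => ?_) (fun w => ?_) c
  · simp only [map_add]; ring
  · simp only [Derivation.leibniz, smul_eq_mul]; ring
  · simp
  refine eq_zero_of_leibniz (F := fun b => K.triDer A a b (ι R _ w) + K.triDer A b a (ι R _ w))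
    (fun s t => ?_) (fun s t => ?_) (fun r => ?_) (fun v => ?_) b
  · simp only [map_add, Derivation.add_apply]; ring
  · simp only [Derivation.leibniz, Derivation.add_apply, Derivation.smul_apply, smul_eq_mul]; ring
  · simp
  refine eq_zero_of_leibniz (F := fun a => K.triDer A a (ι R _ v) (ι R _ w) +
    K.triDer A (ι R _ v) a (ι R _ w)) (fun s t => ?_) (fun s t => ?_) (fun r => ?_) (fun u => ?_) a
  · simp only [map_add, Derivation.add_apply]; ring
  · simp only [Derivation.leibniz, Derivation.add_apply, Derivation.smul_apply, smul_eq_mul]; ring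
  · simp
  · rw [triDer_ι, triDer_ι, K.eval_swap_left, map_neg, neg_add_cancel]

theorem ctr_fn (a : Poly R A E) : ctr a (K.fn A) = -ofBi fun b c => K.triDer A a b c := by
  rw [fn, ctr_neg_cochain, ctr_ofTri]

theorem ctr_ctr_fn (a b : Poly R A E) :
    ctr b (ctr a (K.fn A)) = -ofField (K.triDer A a b) := by
  rw [ctr_fn, ctr_neg_cochain, ctr_ofBi]

theorem ctr_ctr_ctr_fn (a b c : Poly R A E) :
    ctr c (ctr b (ctr a (K.fn A))) = -ofPoly (K.triDer A a b c) := by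
  rw [ctr_ctr_fn, ctr_neg_cochain, ctr_ofField]

theorem isMultivector_fn : IsMultivector R (K.fn A) := by
  have hbi : ∀ a, IsMultivector R (ofBi fun b c => K.triDer A a b c) := by
    intro a
    refine isMultivector_of_ctr (fun g => ?_) (fun g h => ?_) (fun c => ?_) (fun g h => ?_)
      fun g => ?_
    · rw [ctr_ofBi]; exact isMultivector_derivation _
    · simp only [ctr_ofBi, map_add, Derivation.coe_add, ofField_add]
    · rw [ctr_ofBi, Derivation.map_algebraMap]; exact ofField_zero
    · simp only [ctr_ofBi, Derivation.leibniz, Derivation.coe_add, ofField_add,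
        Derivation.coe_smul, ofField_smul]
    · have h : K.triDer A a g g = 0 := zsmul_eq_zero_of_ne_zero R (z := 2) (by decide)
        (by rw [two_smul, triDer_swap_right])
      rw [ctr_ofBi, ctr_ofField, h, ofPoly_zero]
  refine isMultivector_of_ctr (fun g => ?_) (fun g h => ?_) (fun c => ?_) (fun g h => ?_)
    fun g => ?_
  · rw [ctr_fn]; exact (hbi g).neg
  · simp only [ctr_fn]
    funext n v
    rcases n with _ | _ | _ | n <;> simp [ofBi]; ring
  · rw [ctr_fn, Derivation.map_algebraMap]
    funext n v
    rcases n with _ | _ | _ | n <;> simp [ofBi]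
  · simp only [ctr_fn]
    funext n v
    rcases n with _ | _ | _ | n <;> simp [ofBi]; ring
  · rw [ctr_ctr_fn]
    funext n v
    rcases n with _ | _ | n
    · simp [ofField]
    · simp only [ofField, Pi.neg_apply, Pi.zero_apply, neg_eq_zero]
      exact zsmul_eq_zero_of_ne_zero R (z := 2) (by decide) (by rw [two_smul, triDer_swap_left])
    · simp [ofField]

theorem fn_arity : ∀ n, n ≠ 3 → K.fn A n = 0 := by
  rintro (_ | _ | _ | _ | n) hn
  · simp [fn]; rfl
  · simp [fn]; rfl
  · simp [fn]; rfl
  · exact absurd rfl hn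
  · simp [fn]; rfl

theorem hasParity_fn : HasParity 1 (K.fn A) := fun n hn =>
  K.fn_arity n (by rintro rfl; exact absurd hn (by decide))

theorem ctr_ι_fn (u v w : A × Module.Dual R E) :
    ctr (ι R _ w) (ctr (ι R _ v) (ctr (ι R _ u) (K.fn A))) =
      -ofPoly (algebraMap R _ (K.eval u.2 v.2 w.2)) := by
  rw [ctr_ctr_ctr_fn, triDer_ι]

theorem ctr_algebraMap_fn (f : R) : ctr (algebraMap R (Poly R A E) f) (K.fn A) = 0 := by
  rw [ctr_fn, Derivation.map_algebraMap]
  funext n v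
  rcases n with _ | _ | _ | n <;> simp [ofBi]

end TriSection

theorem trivector_eq_zero {V : Type*} [AddCommGroup V] [Module R V]
    {P : Cochain (SymmetricAlgebra R V)} (hP : IsMultivector R P) (har : ∀ n, n ≠ 3 → P n = 0)
    (hr : ∀ f, ctr (algebraMap R _ f) P = 0)
    (hv : ∀ u v w, ctr (ι R V w) (ctr (ι R V v) (ctr (ι R V u) P)) = 0) : P = 0 := by
  funext n
  by_cases hn : n = 3
  · subst hn
    refine apply_succ_eq_zero hP (fun f => by rw [hr]; rfl) fun u =>
      apply_succ_eq_zero (hP.contract _) (fun f => ?_) fun v =>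
        apply_succ_eq_zero ((hP.contract _).contract _) (fun f => ?_) fun w => by rw [hv]; rfl
    · rw [hP.ctr_swap, hr, ctr_zero_cochain, neg_zero]; rfl
    · rw [(hP.contract _).ctr_swap, hP.ctr_swap _ (ι R V u), hr, ctr_zero_cochain, neg_zero,
        ctr_zero_cochain, neg_zero]; rfl
  · exact har n hn

namespace TriSection

variable (K : TriSection R E)

theorem hasWeight_fn {p : (A × Module.Dual R E) →ₗ[R] A × Module.Dual R E} {w : ℤ}
    (h : ∀ u v w', -K.eval (p u).2 v.2 w'.2 - K.eval u.2 (p v).2 w'.2 - K.eval u.2 v.2 (p w').2 =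
      w • K.eval u.2 v.2 w'.2) : HasWeight p w (K.fn A) := by
  have hE := isMultivector_euler p
  have hK := K.isMultivector_fn (A := A)
  have hm := hE.poisson hK
  rw [HasWeight, ← sub_eq_zero]
  refine trivector_eq_zero (hm.sub (hK.zsmul w)) (fun n hn => ?_) (fun f => ?_) fun u v x => ?_
  · rw [Pi.sub_apply, Pi.smul_apply, K.fn_arity n hn, poisson_arity hE hK (ofField_arity _)
      K.fn_arity rfl n hn, smul_zero, sub_zero]
  · rw [ctr_sub_cochain, ctr_zsmul_cochain, ctr_algebraMap_fn, ctr_ofField_poisson hE hK,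
      ctr_algebraMap_fn, Derivation.map_algebraMap, hK.ctr_zero, hE.poisson_zero]
    simp
  · rw [ctr_sub_cochain, ctr_sub_cochain, ctr_sub_cochain, ctr_zsmul_cochain, ctr_zsmul_cochain,
      ctr_zsmul_cochain, ctr_ofField_poisson hE hK, ctr_sub_cochain, ctr_sub_cochain,
      ctr_ofField_poisson hE (hK.contract _), ctr_sub_cochain,
      ctr_ofField_poisson hE ((hK.contract _).contract _), euler_ι, euler_ι, euler_ι, ctr_ι_fn,
      ctr_ι_fn, ctr_ι_fn, ctr_ι_fn, hE.poisson_neg, ofField_poisson_ofPoly hE,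
      Derivation.map_algebraMap, ofPoly_zero]
    have := congr(ofPoly (algebraMap R (Poly R A E) $(h u v x)))
    funext n y
    have h1 := congr($this n y)
    rcases n with _ | n
    · simp [ofPoly] at h1 ⊢
      linear_combination -h1
    · simp [ofPoly]

theorem hasWeight_projA_fn : HasWeight (projA R A E) 0 (K.fn A) := K.hasWeight_fn fun u v w => by
  simp [projA_apply, eval_apply]

theorem hasWeight_projE_fn : HasWeight (projE R A E) (-3) (K.fn A) := K.hasWeight_fn fun u v w => by
  simp only [projE_apply, zsmul_eq_mul]
  push_cast
  ring

end TriSection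

end Tensors

/-! ### What `[H, H]_S = 0` and `[H, K]_S = 0` mean. -/

section Bialgebroid

open SymmetricAlgebra

variable {R A E : Type*} [CommRing R] [Algebra ℝ R] [AddCommGroup A] [Module R A]
  [AddCommGroup E] [Module R E] {L : LieAlgebroid R A} {ρ : Representation L E}
  {P : Cochain (Poly R A E)}

theorem ι_inl_injective {x y : A}
    (h : ι R (A × Module.Dual R E) (x, 0) = ι R _ (y, 0)) : x = y :=
  congr(Prod.fst $(ι_injective h))

theorem IsLinearPoisson.generatesBracket (hP : IsLinearPoisson ρ.semidirectDual P) :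
    GeneratesBracket P (fun u v => ρ.semidirectDual.bracket u v)
      fun u f => ρ.semidirectDual.anchor u f :=
  ⟨hP.ctr_ι_ι, hP.ctr_algebraMap_ι⟩

namespace IsLinearPoisson

theorem isMultivector_poisson_fn (hP : IsLinearPoisson ρ.semidirectDual P)
    (H : SymSection R A E) : IsMultivector R (poisson P H.fn) :=
  hP.multivector.poisson H.isMultivector_fn

theorem hasParity_poisson_fn (hP : IsLinearPoisson ρ.semidirectDual P) (H : SymSection R A E) :
    HasParity 2 (poisson P H.fn) :=
  hP.hasParity.poisson H.hasParity_fn hP.multivector H.isMultivector_fn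

theorem poisson_fn_arity (hP : IsLinearPoisson ρ.semidirectDual P) (H : SymSection R A E) :
    ∀ n, n ≠ 2 → poisson P H.fn n = 0 :=
  poisson_arity hP.multivector H.isMultivector_fn hP.arity (ofField_arity _) rfl

theorem generatesBracket_poisson_fn (hP : IsLinearPoisson ρ.semidirectDual P)
    (H : SymSection R A E) : GeneratesBracket (poisson P H.fn)
      (fun u v => ρ.semidirectDual.bracket (H.toEnd u) v + ρ.semidirectDual.bracket u (H.toEnd v) -
        H.toEnd (ρ.semidirectDual.bracket u v))
      fun u f => ρ.semidirectDual.anchor (H.toEnd u) f :=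
  hP.generatesBracket.poisson_linearField hP.multivector H.toEnd

theorem ctr_snd_ctr_snd (hP : IsLinearPoisson ρ.semidirectDual P) (H : SymSection R A E)
    (φ ψ : Module.Dual R E) :
    ctr (ι R _ (0, ψ)) (ctr (ι R (A × Module.Dual R E) (0, φ)) (poisson P H.fn)) =
      -ofPoly (ι R _ (0, ρ.dualConn (H.sharp φ) ψ - ρ.dualConn (H.sharp ψ) φ)) := by
  rw [(hP.generatesBracket_poisson_fn H).bracket]
  congr 3
  simp only [ρ.semidirectDual_bracket, H.toEnd_apply, ρ.dualConn_zero_left,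
    map_zero, AddMonoidHom.zero_apply]
  ext1 <;> simp [sub_eq_add_neg]

theorem ctr_algebraMap_ctr_snd (hP : IsLinearPoisson ρ.semidirectDual P) (H : SymSection R A E)
    (φ : Module.Dual R E) (f : R) :
    ctr (algebraMap R _ f) (ctr (ι R (A × Module.Dual R E) (0, φ)) (poisson P H.fn)) =
      -ofPoly (algebraMap R _ (L.anchor (H.sharp φ) f)) :=
  (hP.generatesBracket_poisson_fn H).anchor _ _

/-- `{{P, H}, H}` generates the bracket deformed twice by `H.toEnd`. This endomorphism has square
zero, so the result is twice its Nijenhuis torsion, whose value on `E* × E*` is the defect of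
compatibility. -/
theorem isCompatible (hP : IsLinearPoisson ρ.semidirectDual P) {H : SymSection R A E}
    (h : schouten P H.fn H.fn = 0) : H.IsCompatible ρ := fun φ ψ => by
  have h1 := ((hP.generatesBracket_poisson_fn H).poisson_linearField
    (hP.isMultivector_poisson_fn H) H.toEnd).bracket (0, φ) (0, ψ)
  rw [← H.fn_eq, neg_eq_zero.1 h, ctr_zero_cochain, ctr_zero_cochain, eq_comm, neg_eq_zero,
    ← ofPoly_zero] at h1
  replace h1 := ofPoly_injective h1
  have h2 : (2 : ℤ) • ι R (A × Module.Dual R E) (L.bracket (H.sharp φ) (H.sharp ψ) -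
      H.sharp (ρ.dualConn (H.sharp φ) ψ - ρ.dualConn (H.sharp ψ) φ), 0) = 0 := by
    rw [← h1, ← map_zsmul]
    congr 1
    simp only [ρ.semidirectDual_bracket, H.toEnd_apply, ρ.dualConn_zero_left,
      ρ.dualConn_zero_right, map_zero, AddMonoidHom.zero_apply]
    ext1
    · simp
      module
    · simp
  rw [← sub_eq_zero]
  exact ι_inl_injective ((zsmul_eq_zero_of_ne_zero R (by decide) h2).trans ι_zero_zero.symm)

/-- On `E*` the bivector field `{P, H}` generates the bracket and anchor of `dualLieAlgebroid`, so
the formula for a constant trivector field becomes the differential; only the order of the arguments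
of `K` has to be matched. -/
theorem ctr_poisson_triFn (hP : IsLinearPoisson ρ.semidirectDual P) {H : SymSection R A E}
    (hH : H.IsCompatible ρ) (K : TriSection R E) (φ ψ χ ζ : Module.Dual R E) :
    ctr (ι R _ (0, ζ)) (ctr (ι R _ (0, χ)) (ctr (ι R _ (0, ψ))
      (ctr (ι R (A × Module.Dual R E) (0, φ)) (poisson (poisson P H.fn) (K.fn A))))) =
        ofPoly (algebraMap R _ ((dualLieAlgebroid hH).d3 K.eval φ ψ χ ζ)) := by
  rw [(hP.generatesBracket_poisson_fn H).poisson_const (hP.isMultivector_poisson_fn H)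
    K.isMultivector_fn K.hasParity_fn K.ctr_ι_fn]
  congr 2
  simp only [ρ.semidirectDual_bracket, H.toEnd_apply, ρ.dualConn_zero_left,
    map_zero, AddMonoidHom.zero_apply, ρ.semidirectDual_anchor,
    Prod.snd_add, Prod.snd_sub, sub_zero, zero_sub, ← sub_eq_add_neg, LieAlgebroid.d3,
    dualLieAlgebroid_bracket, dualLieAlgebroid_anchor]
  rw [K.eval_swap_left ψ (_ - _) ζ, K.eval_rotate ψ χ (_ - _), K.eval_swap_left φ (_ - _) ζ,
    K.eval_rotate φ χ (_ - _), K.eval_rotate φ ψ (_ - _)]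
  ring

theorem hasWeight_projA_poisson_fn (hP : IsLinearPoisson ρ.semidirectDual P)
    (h : HasWeight (projA R A E) (-1) P) (H : SymSection R A E) :
    HasWeight (projA R A E) 0 (poisson P H.fn) := by
  simpa using h.poisson H.hasWeight_projA_fn hP.hasParity H.hasParity_fn hP.multivector
    H.isMultivector_fn

theorem hasWeight_projE_poisson_fn (hP : IsLinearPoisson ρ.semidirectDual P)
    (h : HasWeight (projE R A E) 0 P) (H : SymSection R A E) :
    HasWeight (projE R A E) (-1) (poisson P H.fn) := by
  simpa using h.poisson H.hasWeight_projE_fn hP.hasParity H.hasParity_fn hP.multivector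
    H.isMultivector_fn

/-- The bracket has weight -1 - 3 = -4 for the second Euler field. Every contraction with `E*`
raises it by one, so the weight is negative before each of four contractions and only the value `dK`
on four sections of `E*` can be an obstruction. -/
theorem poisson_triFn_eq_zero_iff (hP : IsLinearPoisson ρ.semidirectDual P)
    (h : HasWeight (projE R A E) 0 P) {H : SymSection R A E} (hH : H.IsCompatible ρ)
    (K : TriSection R E) : poisson (poisson P H.fn) (K.fn A) = 0 ↔
      ∀ φ ψ χ ζ, (dualLieAlgebroid hH).d3 K.eval φ ψ χ ζ = 0 := by
  have hm := (hP.isMultivector_poisson_fn H).poisson (K.isMultivector_fn (A := A))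
  have hw := (hP.hasWeight_projE_poisson_fn h H).poisson (K.hasWeight_projE_fn (A := A))
    (hP.hasParity_poisson_fn H) K.hasParity_fn (hP.isMultivector_poisson_fn H) K.isMultivector_fn
  refine ⟨fun h0 φ ψ χ ζ => ?_, fun h0 => ?_⟩
  · have := hP.ctr_poisson_triFn hH K φ ψ χ ζ
    rw [h0, ctr_zero_cochain, ctr_zero_cochain, ctr_zero_cochain, ctr_zero_cochain,
      ← ofPoly_zero, ← map_zero (algebraMap R (Poly R A E))] at this
    exact (algebraMap_leftInverse _).injective (ofPoly_injective this).symm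
  · refine eq_zero_of_weight_neg projE_comp (by decide) hw hm fun φ => ?_
    have hw1 := hw.contract hm (euler_projE_snd φ.2)
    refine eq_zero_of_weight_neg projE_comp (by decide) hw1 (hm.contract _) fun ψ => ?_
    have hw2 := hw1.contract (hm.contract _) (euler_projE_snd ψ.2)
    refine eq_zero_of_weight_neg projE_comp (by decide) hw2 ((hm.contract _).contract _)
      fun χ => ?_
    have hw3 := hw2.contract ((hm.contract _).contract _) (euler_projE_snd χ.2)
    refine eq_zero_of_weight_neg projE_comp (by decide) hw3
      (((hm.contract _).contract _).contract _) fun ζ => ?_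
    rw [projE_apply, projE_apply, projE_apply, projE_apply, hP.ctr_poisson_triFn hH, h0, map_zero,
      ofPoly_zero]

/-- In `A ⋉ E*` the ideal `E*` is abelian with zero anchor, so only terms in which `y`
differentiates survive; they form the covariant derivative. -/
theorem ctr_poisson_triFn_fst (hP : IsLinearPoisson ρ.semidirectDual P) (K : TriSection R E)
    (φ ψ χ : Module.Dual R E) (y : A) :
    ctr (ι R _ (y, 0)) (ctr (ι R _ (0, χ)) (ctr (ι R _ (0, ψ))
      (ctr (ι R (A × Module.Dual R E) (0, φ)) (poisson P (K.fn A))))) =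
        -ofPoly (algebraMap R _ (K.nabla ρ y φ ψ χ)) := by
  rw [hP.generatesBracket.poisson_const hP.multivector K.isMultivector_fn K.hasParity_fn K.ctr_ι_fn,
    ← ofPoly_neg, ← map_neg]
  congr 2
  have h1 := K.eval_rotate ψ χ (ρ.dualConn y φ)
  have h2 := K.eval_swap_right φ χ (ρ.dualConn y ψ)
  simp only [K.eval_apply] at h1 h2
  simp only [ρ.semidirectDual_bracket, ρ.semidirectDual_anchor, map_zero,
    ρ.dualConn_zero_left, K.eval_apply, TriSection.nabla, LinearMap.zero_apply, zero_sub,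
    LinearMap.neg_apply, sub_zero]
  linear_combination h1 - h2

end IsLinearPoisson

end Bialgebroid

/-! ### The structure function of the dual side and the bialgebroid equation. -/

section MainAlgebra

open SymmetricAlgebra

variable {R A E : Type*} [CommRing R] [Algebra ℝ R] [AddCommGroup A] [Module R A]
  [AddCommGroup E] [Module R E] {L : LieAlgebroid R A} {ρ : Representation L E}
  {P : Cochain (Poly R A E)} {H : SymSection R A E}

namespace IsLinearPoisson

/-- Both sides are vector fields, compared on generators. On a linear function `u` the derived
bracket is the anchor derivative of `β(u.1)` minus `β` of the deformed bracket, whose `A`-part is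
`act`. -/
theorem secA1Dual_coact (hP : IsLinearPoisson ρ.semidirectDual P) (φ : Module.Dual R E)
    (β : Module.Dual R A) : secA1Dual E (H.coact ρ φ β) =
      -poisson (ctr (ι R _ (0, φ)) (poisson P H.fn)) (secA1Dual E β) := by
  have hm := (hP.isMultivector_poisson_fn H).contract (ι R (A × Module.Dual R E) (0, φ))
  have hd := isMultivector_secA1Dual (E := E) β
  refine field_ext (isMultivector_secA1Dual _) (hm.poisson hd).neg (secA1Dual_arity _)
    (fun n hn => ?_) (fun f => ?_) fun u => ?_
  · rw [Pi.neg_apply, poisson_arity (p := 1) (q := 1) (r := 1) hm hd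
      (ctr_arity (hP.poisson_fn_arity H) _) (secA1Dual_arity _) rfl n hn, neg_zero]
  · rw [ctr_neg_cochain, ctr_poisson hm hd, hP.ctr_algebraMap_ctr_snd, ctr_secA1Dual_algebraMap,
      ctr_secA1Dual_algebraMap, hd.twist.neg_poisson, ofPoly_poisson_twist hd,
      ctr_secA1Dual_algebraMap, hm.poisson_zero, neg_zero, sub_zero, neg_zero]
  · rw [ctr_neg_cochain, ctr_poisson hm hd, (hP.generatesBracket_poisson_fn H).bracket,
      ctr_secA1Dual_ι, ctr_secA1Dual_ι, hd.twist.neg_poisson, ofPoly_poisson_twist hd,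
      ctr_secA1Dual_ι, poisson_ofPoly hm, hP.ctr_algebraMap_ctr_snd, sub_neg_eq_add,
      ← ofPoly_neg, ← ofPoly_add, ← ofPoly_neg, ← map_neg, ← map_add, ← map_neg, H.coact_apply]
    congr 2
    simp only [ρ.semidirectDual_bracket, H.toEnd_apply, ρ.dualConn_zero_left,
      map_zero, AddMonoidHom.zero_apply, SymSection.act, map_add, map_sub, map_neg,
      Prod.fst_add, Prod.fst_sub, add_zero, zero_sub]
    ring

theorem isMultivector_poisson_triFn (hP : IsLinearPoisson ρ.semidirectDual P)
    (K : TriSection R E) : IsMultivector R (poisson P (K.fn A)) :=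
  hP.multivector.poisson K.isMultivector_fn

theorem poisson_triFn_arity (hP : IsLinearPoisson ρ.semidirectDual P) (K : TriSection R E) :
    ∀ n, n ≠ 4 → poisson P (K.fn A) n = 0 :=
  poisson_arity hP.multivector K.isMultivector_fn hP.arity K.fn_arity rfl

theorem hasParity_poisson_triFn (hP : IsLinearPoisson ρ.semidirectDual P) (K : TriSection R E) :
    HasParity 2 (poisson P (K.fn A)) :=
  hP.hasParity.poisson K.hasParity_fn hP.multivector K.isMultivector_fn

theorem hasWeight_projA_poisson_triFn (hP : IsLinearPoisson ρ.semidirectDual P)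
    (h : HasWeight (projA R A E) (-1) P) (K : TriSection R E) :
    HasWeight (projA R A E) (-1) (poisson P (K.fn A)) := by
  simpa using h.poisson K.hasWeight_projA_fn hP.hasParity K.hasParity_fn hP.multivector
    K.isMultivector_fn

theorem hasWeight_projE_poisson_triFn (hP : IsLinearPoisson ρ.semidirectDual P)
    (h : HasWeight (projE R A E) 0 P) (K : TriSection R E) :
    HasWeight (projE R A E) (-3) (poisson P (K.fn A)) := by
  simpa using h.poisson K.hasWeight_projE_fn hP.hasParity K.hasParity_fn hP.multivector
    K.isMultivector_fn

/-- After three contractions with `E*` a vector field of weight -1 for the first Euler field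
remains. Base functions and sections of `E*` have weight zero, so it annihilates them and is
determined by its values on `A`. -/
theorem secA1Dual_alternating (hP : IsLinearPoisson ρ.semidirectDual P)
    (h : HasWeight (projA R A E) (-1) P) (K : TriSection R E) (φ ψ χ : Module.Dual R E) :
    secA1Dual E (K.alternating ρ ![φ, ψ, χ]) = -ctr (ι R _ (0, χ)) (ctr (ι R _ (0, ψ))
      (ctr (ι R (A × Module.Dual R E) (0, φ)) (poisson P (K.fn A)))) := by
  have h4 := hP.isMultivector_poisson_triFn K
  have hm := ((h4.contract (ι R (A × Module.Dual R E) (0, φ))).contract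
    (ι R _ (0, ψ))).contract (ι R _ (0, χ))
  have har := ctr_arity (ctr_arity (ctr_arity (hP.poisson_triFn_arity K)
    (ι R (A × Module.Dual R E) (0, φ))) (ι R _ (0, ψ))) (ι R _ (0, χ))
  have hw := (((hP.hasWeight_projA_poisson_triFn h K).contract h4 (euler_projA_snd φ)).contract
    (h4.contract _) (euler_projA_snd ψ)).contract ((h4.contract _).contract _) (euler_projA_snd χ)
  refine field_ext (isMultivector_secA1Dual _) hm.neg (secA1Dual_arity _)
    (fun n hn => ?_) (fun f => ?_) fun u => ?_
  · rw [Pi.neg_apply, har n hn, neg_zero]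
  · rw [ctr_neg_cochain, ctr_secA1Dual_algebraMap, eq_comm, neg_eq_zero]
    exact eq_zero_of_weight_neg_of_arity projA_comp (by decide)
      (hw.contract hm (euler_algebraMap _ f)) (hm.contract _) (ctr_arity har _)
  · have e : ι R (A × Module.Dual R E) u = ι R _ (u.1, 0) + ι R _ (0, u.2) := by
      rw [← map_add]; simp
    rw [ctr_neg_cochain, ctr_secA1Dual_ι, K.alternating_apply, e, hm.ctr_add,
      hP.ctr_poisson_triFn_fst, eq_zero_of_weight_neg_of_arity projA_comp (by decide)
      (hw.contract hm (euler_projA_snd u.2)) (hm.contract _) (ctr_arity har _), add_zero, neg_neg]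

theorem isDualStructureFunction (hP : IsLinearPoisson ρ.semidirectDual P)
    (h1 : HasWeight (projA R A E) (-1) P) (h2 : HasWeight (projE R A E) 0 P)
    (hH : H.IsCompatible ρ) (K : TriSection R E)
    (hK : ∀ φ ψ χ ζ, (dualLieAlgebroid hH).d3 K.eval φ ψ χ ζ = 0) :
    IsDualStructureFunction (dualSplitLie2Algebroid hH K hK) 0 (poisson P H.fn)
      (poisson P (K.fn A)) where
  tri0 := isTridegree_zero _ _ _
  tri2 := isTridegree_iff.2 ⟨hP.isMultivector_poisson_fn H,
    fun n hn => hP.poisson_fn_arity H n (by omega),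
    by simpa using hP.hasWeight_projA_poisson_fn h1 H,
    by simpa using hP.hasWeight_projE_poisson_fn h2 H⟩
  tri4 := isTridegree_iff.2 ⟨hP.isMultivector_poisson_triFn K,
    fun n hn => hP.poisson_triFn_arity K n (by omega),
    by simpa using hP.hasWeight_projA_poisson_triFn h1 K,
    by simpa using hP.hasWeight_projE_poisson_triFn h2 K⟩
  brackets :=
    { l1 := fun β => by
        rw [secA1Dual, (isMultivector_derivation _).zero_poisson, neg_zero, secA2Dual]
        change ofPoly (ι R _ ((0 : A), (0 : Module.Dual R E))) = 0
        rw [ι_zero_zero, ofPoly_zero]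
      l2 := fun φ ψ => by
        rw [secA2Dual, secA2Dual, secA2Dual, poisson_ofPoly (hP.isMultivector_poisson_fn H),
          poisson_ofPoly ((hP.isMultivector_poisson_fn H).contract _), hP.ctr_snd_ctr_snd, neg_neg]
        rfl
      l2m := fun φ β => by
        rw [secA2Dual, poisson_ofPoly (hP.isMultivector_poisson_fn H)]
        exact hP.secA1Dual_coact φ β
      l3 := fun φ ψ χ => by
        have h4 := hP.isMultivector_poisson_triFn K
        rw [secA2Dual, secA2Dual, secA2Dual, poisson_ofPoly h4, poisson_ofPoly (h4.contract _),
          poisson_ofPoly ((h4.contract _).contract _)]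
        exact hP.secA1Dual_alternating h1 K φ ψ χ
      anchor := fun φ f => by
        rw [secA2Dual, secR, secR, poisson_ofPoly (hP.isMultivector_poisson_fn H),
          poisson_ofPoly ((hP.isMultivector_poisson_fn H).contract _),
          hP.ctr_algebraMap_ctr_snd, neg_neg]
        rfl }

/-- Since `{P, P} = 0`, the graded Jacobi identity says that `{P, {P, Q}}` equals its own negative.
-/
theorem poisson_poisson_eq_zero (hP : IsLinearPoisson ρ.semidirectDual P)
    {Q : Cochain (Poly R A E)} (hQ : IsMultivector R Q) (hQp : HasParity 1 Q) :
    poisson P (poisson P Q) = 0 := by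
  have h := poisson_jacobi hP.hasParity hP.hasParity hQp hP.multivector hP.multivector hQ
  rw [hP.poisson_self, hQ.zero_poisson, zero_add] at h
  refine cochain_eq_zero_of_zsmul R (z := 2) (by decide) ?_
  nth_rewrite 1 [two_smul, h]
  simp

/-- If `{Q, T} = 0` for a `d_P`-closed `Q` then `{Q, d_P T} = 0`. -/
theorem poisson_poisson_of_commute (hP : IsLinearPoisson ρ.semidirectDual P)
    {Q T : Cochain (Poly R A E)} (hQ : IsMultivector R Q) (hT : IsMultivector R T) {b : ℕ}
    (hQp : HasParity b Q) (hTp : HasParity 1 T) (hPQ : poisson P Q = 0) (hQT : poisson Q T = 0) :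
    poisson Q (poisson P T) = 0 := by
  rw [poisson_jacobi hQp hP.hasParity hTp hQ hP.multivector hT, hQT, hP.multivector.poisson_zero,
    poisson_comm hQp hP.hasParity hQ hP.multivector, hPQ, smul_zero, hT.zero_poisson, smul_zero,
    add_zero]

/-- Expand the square of `P + {P, H} + {P, K}`. Terms with a factor `P` vanish because `{P, ·}`
squares to zero; `{{P, H}, {P, H}}` and `{{P, H}, {P, K}}` vanish because `{P, H}` is closed and
commutes with `H` and with `K`. -/
theorem isSplitLie2Bialgebroid (hP : IsLinearPoisson ρ.semidirectDual P)
    (h1 : HasWeight (projA R A E) (-1) P) (h2 : HasWeight (projE R A E) 0 P)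
    (hH : H.IsCompatible ρ) (hHH : schouten P H.fn H.fn = 0) (K : TriSection R E)
    (hHK : schouten P H.fn (K.fn A) = 0)
    (hK : ∀ φ ψ χ ζ, (dualLieAlgebroid hH).d3 K.eval φ ψ χ ζ = 0) :
    IsSplitLie2Bialgebroid ρ.semidirect (dualSplitLie2Algebroid hH K hK) := by
  refine ⟨0, P, 0, poisson P H.fn, poisson P (K.fn A),
    isStructureFunction_of_isLinearPoisson hP h1 h2, hP.isDualStructureFunction h1 h2 hH K hK, ?_⟩
  have m2 := hP.isMultivector_poisson_fn H
  have m4 := hP.isMultivector_poisson_triFn K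
  have p2 := hP.hasParity_poisson_fn H
  have p4 := hP.hasParity_poisson_triFn K
  have e02 := hP.poisson_poisson_eq_zero H.isMultivector_fn H.hasParity_fn
  have e04 := hP.poisson_poisson_eq_zero (K.isMultivector_fn (A := A)) K.hasParity_fn
  have e20 : poisson (poisson P H.fn) P = 0 := by
    rw [poisson_comm p2 hP.hasParity m2 hP.multivector, e02, smul_zero]
  have e40 : poisson (poisson P (K.fn A)) P = 0 := by
    rw [poisson_comm p4 hP.hasParity m4 hP.multivector, e04, smul_zero]
  have e22 := hP.poisson_poisson_of_commute m2 H.isMultivector_fn p2 H.hasParity_fn e02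
    (neg_eq_zero.1 hHH)
  have e24 := hP.poisson_poisson_of_commute m2 K.isMultivector_fn p2 K.hasParity_fn e02
    (neg_eq_zero.1 hHK)
  have e42 : poisson (poisson P (K.fn A)) (poisson P H.fn) = 0 := by
    rw [poisson_comm p4 p2 m4 m2, e24, smul_zero]
  have e44 : poisson (poisson P (K.fn A)) (poisson P (K.fn A)) = 0 := by
    have w4 := (hP.hasWeight_projA_poisson_triFn h1 K).total
      (hP.hasWeight_projE_poisson_triFn h2 K) m4
    funext n
    -- The field `{P, K}` has arity 4 and total weight -1 - 3 = -4. Its square is concentrated in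
    -- arity 4 + 4 - 1 = 7 and has weight -8, which seven contractions cannot bring up to zero.
    by_cases hn : n = 7
    · exact apply_eq_zero_of_weight (by subst hn; decide) (w4.poisson w4 p4 p4 m4 m4)
        (m4.poisson m4)
    · exact poisson_arity m4 m4 (hP.poisson_triFn_arity K) (hP.poisson_triFn_arity K) rfl n hn
  have hs := (m2.sum m4)
  rw [show (0 + P + 0) + (0 + poisson P H.fn + poisson P (K.fn A)) - 0 =
    P + (poisson P H.fn + poisson P (K.fn A)) by abel, poisson_add_left (hP.multivector.sum hs),
    poisson_add_left (hP.multivector.sum hs), poisson_add_right hP.multivector,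
    poisson_add_right hP.multivector, poisson_add_right m2, poisson_add_right m2,
    poisson_add_right m4, poisson_add_right m4, hP.poisson_self, e02, e04, e20, e22, e24, e40, e42,
    e44]
  simp

end IsLinearPoisson

variable (ρ H) in
theorem exists_dual_of_torsionless (hE : ∀ e : E, (∀ φ : Module.Dual R E, φ e = 0) → e = 0)
    (K : TriSection R E) :
    (∃ m0 m2 m4, IsStructureFunction ρ.semidirect m0 m2 m4) ∧
    ∀ m0 m2 m4, IsStructureFunction ρ.semidirect m0 m2 m4 → schouten m2 H.fn H.fn = 0 →
      (∃ B : LieAlgebroid R (Module.Dual R E),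
          (∀ φ ψ, B.bracket φ ψ = ρ.dualConn (H.sharp φ) ψ - ρ.dualConn (H.sharp ψ) φ) ∧
          B.anchor = L.anchor ∘ₗ H.sharp ∧
          (schouten m2 H.fn (K.fn _) = 0 ↔ ∀ φ ψ χ ζ, B.d3 K.eval φ ψ χ ζ = 0)) ∧
      (schouten m2 H.fn (K.fn _) = 0 →
        ∃ ℬ : SplitLie2Algebroid R (Module.Dual R E) (Module.Dual R A),
          ℬ.l1 = 0 ∧
          (∀ φ ψ, ℬ.l2 φ ψ = ρ.dualConn (H.sharp φ) ψ - ρ.dualConn (H.sharp ψ) φ) ∧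
          (∀ φ β, ℬ.l2m φ β =
            L.lieDer (H.sharp φ) β + ρ.pairConn (H.nat β) φ - L.d0 (H.eval φ β)) ∧
          (∀ φ ψ χ, ℬ.l3 ![φ, ψ, χ] =
            ρ.pairConn (K.flat φ ψ) χ + ρ.pairConn (K.flat χ φ) ψ + ρ.pairConn (K.flat ψ χ) φ
              - (2 : ℕ) • L.d0 (K.eval φ ψ χ)) ∧
          ℬ.anchor = L.anchor ∘ₗ H.sharp ∧
          IsMorphism ℬ ρ.semidirect H.sharp (-H.nat) (-K.flat) ∧
          IsSplitLie2Bialgebroid ρ.semidirect ℬ) := by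
  refine ⟨?_, fun m0 m2 m4 hm hHH => ?_⟩
  · obtain ⟨P, hP, h1, h2⟩ := exists_isLinearPoisson_semidirectDual ρ
    exact ⟨0, P, 0, isStructureFunction_of_isLinearPoisson hP h1 h2⟩
  · obtain ⟨hP, h1, h2⟩ := isLinearPoisson_of_isStructureFunction hm
    have hH := hP.isCompatible hHH
    have hiff : schouten m2 H.fn (K.fn A) = 0 ↔
        ∀ φ ψ χ ζ, (dualLieAlgebroid hH).d3 K.eval φ ψ χ ζ = 0 :=
      neg_eq_zero.trans (hP.poisson_triFn_eq_zero_iff h2 hH K)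
    refine ⟨⟨dualLieAlgebroid hH, fun _ _ => rfl, rfl, hiff⟩, fun hHK => ?_⟩
    have hK := hiff.1 hHK
    exact ⟨dualSplitLie2Algebroid hH K hK, rfl, fun _ _ => rfl, fun _ _ => rfl, fun _ _ _ => rfl,
      rfl, isMorphism_dualSplitLie2Algebroid hH K hK hE,
      hP.isSplitLie2Bialgebroid h1 h2 hH hHH K hHK hK⟩

end MainAlgebra

/-! ### Sections of a smooth vector bundle are separated by functionals. -/

section Torsionless

open Bundle

variable {E : Type*} [NormedAddCommGroup E] [NormedSpace ℝ E] [FiniteDimensional ℝ E]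
  {H : Type*} [TopologicalSpace H] {I : ModelWithCorners ℝ E H} {M : Type*} [TopologicalSpace M]
  [T2Space M] [ChartedSpace H M] [IsManifold I ∞ M]
  {F : Type*} [NormedAddCommGroup F] [NormedSpace ℝ F] {V : M → Type*}
  [TopologicalSpace (TotalSpace F V)] [∀ x, AddCommGroup (V x)] [∀ x, Module ℝ (V x)]
  [∀ x, TopologicalSpace (V x)] [FiberBundle F V] [VectorBundle ℝ F V]
  [ContMDiffVectorBundle ∞ F V I]

/-- The functional on sections given by a functional on the model fibre and a bump function with
support in the domain of a trivialization. -/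
def localFunctional {c : M} (f : SmoothBumpFunction I c)
    (hf : tsupport f ⊆ (trivializationAt F V c).baseSet) (l : F →L[ℝ] ℝ) :
    Module.Dual C^∞⟮I, M; 𝓘(ℝ, ℝ), ℝ⟯ Cₛ^∞⟮I; F, V⟯ where
  toFun s := ⟨fun x => f x * l ((trivializationAt F V c).linearMapAt ℝ x (s x)), by
    refine contMDiff_of_tsupport fun x hx => ?_
    have hx' : x ∈ (trivializationAt F V c).baseSet :=
      hf (tsupport_smul_subset_left (f := f) _ hx)
    have h1 : ContMDiffAt I 𝓘(ℝ, F) ∞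
        (fun x => (trivializationAt F V c).linearMapAt ℝ x (s x)) x := by
      refine (((trivializationAt F V c).contMDiffAt_section_iff hx').1
        (s.contMDiff x)).congr_of_eventuallyEq ?_
      filter_upwards [(trivializationAt F V c).open_baseSet.mem_nhds hx'] with y hy
      rw [(trivializationAt F V c).coe_linearMapAt_of_mem hy]
    exact f.contMDiffAt.mul (l.contMDiff.contMDiffAt.comp x h1)⟩
  map_add' s t := by
    ext x
    change f x * l ((trivializationAt F V c).linearMapAt ℝ x (s x + t x)) = f x * _ + f x * _
    rw [map_add, map_add, mul_add]
  map_smul' g s := by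
    ext x
    change f x * l ((trivializationAt F V c).linearMapAt ℝ x (g x • s x)) = g x * (f x * _)
    rw [map_smul, map_smul, smul_eq_mul, mul_left_comm]

/-- If `s c ≠ 0`, some linear form on the model fibre is nonzero on the local representative of `s`
at `c`. Cut off by a bump function equal to one at `c`, it becomes a global functional that does not
kill `s`. -/
theorem section_eq_zero (s : Cₛ^∞⟮I; F, V⟯)
    (h : ∀ φ : Module.Dual C^∞⟮I, M; 𝓘(ℝ, ℝ), ℝ⟯ Cₛ^∞⟮I; F, V⟯, φ s = 0) : s = 0 := by
  ext c
  by_contra hc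
  have hmem := mem_baseSet_trivializationAt F V c
  have hne : (trivializationAt F V c).linearMapAt ℝ c (s c) ≠ 0 := by
    rw [(trivializationAt F V c).linearMapAt_def_of_mem hmem]
    exact fun h0 => hc ((LinearEquiv.map_eq_zero_iff _).1 h0)
  obtain ⟨l, hl⟩ := SeparatingDual.exists_ne_zero (R := ℝ) hne
  obtain ⟨f, -, hf⟩ := (SmoothBumpFunction.nhds_basis_tsupport (I := I) c).mem_iff.1
    ((trivializationAt F V c).open_baseSet.mem_nhds hmem)
  have h0 : f c * l ((trivializationAt F V c).linearMapAt ℝ c (s c)) = 0 :=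
    congr($(h (localFunctional f hf l)) c)
  rw [f.eq_one, one_mul] at h0
  exact hl h0

end Torsionless

end SplitLie2

end

/-! ### The theorem for smooth vector bundles. -/

theorem mainTheorem7 {n : ℕ} {M : Type*} [TopologicalSpace M] [T2Space M] [SigmaCompactSpace M]
    [ChartedSpace (EuclideanSpace ℝ (Fin n)) M] [IsManifold (𝓡 n) ∞ M]
    {FA : Type*} [NormedAddCommGroup FA] [NormedSpace ℝ FA] [FiniteDimensional ℝ FA]
    {A : M → Type*} [TopologicalSpace (Bundle.TotalSpace FA A)] [∀ x, AddCommGroup (A x)]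
    [∀ x, Module ℝ (A x)] [∀ x, TopologicalSpace (A x)] [FiberBundle FA A] [VectorBundle ℝ FA A]
    [ContMDiffVectorBundle ∞ FA A (𝓡 n)]
    {FE : Type*} [NormedAddCommGroup FE] [NormedSpace ℝ FE] [FiniteDimensional ℝ FE]
    {E : M → Type*} [TopologicalSpace (Bundle.TotalSpace FE E)] [∀ x, AddCommGroup (E x)]
    [∀ x, Module ℝ (E x)] [∀ x, TopologicalSpace (E x)] [FiberBundle FE E] [VectorBundle ℝ FE E]
    [ContMDiffVectorBundle ∞ FE E (𝓡 n)]
    (L : SplitLie2.LieAlgebroid C^∞⟮𝓡 n, M; 𝓘(ℝ, ℝ), ℝ⟯ Cₛ^∞⟮𝓡 n; FA, A⟯)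
    (ρ : SplitLie2.Representation L Cₛ^∞⟮𝓡 n; FE, E⟯)
    (H : SplitLie2.SymSection C^∞⟮𝓡 n, M; 𝓘(ℝ, ℝ), ℝ⟯ Cₛ^∞⟮𝓡 n; FA, A⟯ Cₛ^∞⟮𝓡 n; FE, E⟯)
    (K : SplitLie2.TriSection C^∞⟮𝓡 n, M; 𝓘(ℝ, ℝ), ℝ⟯ Cₛ^∞⟮𝓡 n; FE, E⟯) :
    (∃ m0 m2 m4, SplitLie2.IsStructureFunction ρ.semidirect m0 m2 m4) ∧
    ∀ m0 m2 m4, SplitLie2.IsStructureFunction ρ.semidirect m0 m2 m4 →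
      SplitLie2.schouten m2 H.fn H.fn = 0 →
      (∃ B : SplitLie2.LieAlgebroid C^∞⟮𝓡 n, M; 𝓘(ℝ, ℝ), ℝ⟯
            (Module.Dual C^∞⟮𝓡 n, M; 𝓘(ℝ, ℝ), ℝ⟯ Cₛ^∞⟮𝓡 n; FE, E⟯),
          (∀ φ ψ, B.bracket φ ψ = ρ.dualConn (H.sharp φ) ψ - ρ.dualConn (H.sharp ψ) φ) ∧
          B.anchor = L.anchor ∘ₗ H.sharp ∧
          (SplitLie2.schouten m2 H.fn (K.fn _) = 0 ↔
            ∀ φ ψ χ ζ, B.d3 K.eval φ ψ χ ζ = 0)) ∧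
      (SplitLie2.schouten m2 H.fn (K.fn _) = 0 →
        ∃ ℬ : SplitLie2.SplitLie2Algebroid C^∞⟮𝓡 n, M; 𝓘(ℝ, ℝ), ℝ⟯
            (Module.Dual C^∞⟮𝓡 n, M; 𝓘(ℝ, ℝ), ℝ⟯ Cₛ^∞⟮𝓡 n; FE, E⟯)
            (Module.Dual C^∞⟮𝓡 n, M; 𝓘(ℝ, ℝ), ℝ⟯ Cₛ^∞⟮𝓡 n; FA, A⟯),
          ℬ.l1 = 0 ∧
          (∀ φ ψ, ℬ.l2 φ ψ = ρ.dualConn (H.sharp φ) ψ - ρ.dualConn (H.sharp ψ) φ) ∧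
          (∀ φ β, ℬ.l2m φ β =
            L.lieDer (H.sharp φ) β + ρ.pairConn (H.nat β) φ - L.d0 (H.eval φ β)) ∧
          (∀ φ ψ χ, ℬ.l3 ![φ, ψ, χ] =
            ρ.pairConn (K.flat φ ψ) χ + ρ.pairConn (K.flat χ φ) ψ + ρ.pairConn (K.flat ψ χ) φ
              - (2 : ℕ) • L.d0 (K.eval φ ψ χ)) ∧
          ℬ.anchor = L.anchor ∘ₗ H.sharp ∧
          SplitLie2.IsMorphism ℬ ρ.semidirect H.sharp (-H.nat) (-K.flat) ∧
          SplitLie2.IsSplitLie2Bialgebroid ρ.semidirect ℬ) :=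
  SplitLie2.exists_dual_of_torsionless ρ H SplitLie2.section_eq_zero K
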